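/- Let $D$ be a domain in $\mathbb R^n$, $n\ge 2$, and let $f_j$, $j=1,2,\dots$, be homeomorphisms of $D$ into $\mathbb R^n$ of the Sobolev class $W^{1,1}_{\mathrm{loc}}(D)$ that converge locally uniformly in $D$ to a map $f:D\to\mathbb R^n$ which is differentiable almost everywhere in $D$. For a map $g:D\to\mathbb R^n$ put $P_g(x)=K_g(x)^{1/(n-1)}$, where $K_g(x)=\|g'(x)\|^n/|J_g(x)|$ if $g$ has all first partial derivatives at $x$ and $J_g(x)=\det g'(x)\ne0$, $K_g(x)=1$ if $g$ has all first partial derivatives at $x$ and $g'(x)=0$, and $K_g(x)=\infty$ at all other points; here $g'(x)$ is the Jacobian matrix of the partial derivatives and $\|g'(x)\|=\sup_{|h|=1}|g'(x)h|$. Let $\Phi:[1,\infty]\to[0,\infty]$ be strictly convex in the following sense: $\Phi$ is nondecreasing and convex, and $\Phi(t)/t\to\infty$ as $t\to\infty$. Suppose further that $\Phi$ is continuous from the left at $T=\sup\{t\in[1,\infty]:\Phi(t)<\infty\}$ in the topology of $[0,\infty]$ (no condition is imposed if $T=1$ or if $\Phi\equiv\infty$). Then, for every open set $\Omega\subseteq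 D$, $$\int_\Omega \Phi(P_f(x))\,dm(x)\ \le\ \liminf_{j\to\infty}\int_\Omega\Phi(P_{f_j}(x))\,dm(x).$$ Moreover, if $f$ is a homeomorphism of $D$ into $\mathbb R^n$ and the right-hand side is finite, then $f\in W^{1,1}_{\mathrm{loc}}(\Omega)$. If in addition $\limsup_{j\to\infty}\int_\Omega\Phi(P_{f_j}(x))\,dm(x)<\infty$, then for every $i=1,\dots,n$ the weak partial derivatives satisfy $\partial_i f_j\to\partial_i f$ weakly in $L^1_{\mathrm{loc}}(\Omega)$, that is, weakly in $L^1(C)$ for every compact $C\subseteq\Omega$. -/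

import Mathlib

open MeasureTheory Filter Topology Set
open scoped ENNReal NNReal ContDiff

namespace OuterDilatation

/-- The Euclidean space `ℝⁿ`. -/
abbrev Rn (n : ℕ) : Type := EuclideanSpace ℝ (Fin n)

/-- The `i`-th vector of the standard basis of `ℝⁿ`. -/
noncomputable abbrev stdVec {n : ℕ} (i : Fin n) : Rn n := EuclideanSpace.single i (1 : ℝ)

/-- The map `f` has all first partial derivatives at `x` (in the classical, pointwise sense). -/
def HasPartials {n : ℕ} (f : Rn n → Rn n) (x : Rn n) : Prop :=
  ∀ i : Fin n, LineDifferentiableAt ℝ f x (stdVec i)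

/-- The Jacobian matrix of the first partial derivatives of `f` at `x`: the entry `(k, i)` is the
derivative of the `k`-th component in the `i`-th coordinate direction. -/
noncomputable def jacobiMatrix {n : ℕ} (f : Rn n → Rn n) (x : Rn n) :
    Matrix (Fin n) (Fin n) ℝ :=
  Matrix.of fun k i => lineDeriv ℝ f x (stdVec i) k

/-- The norm `sup {|A h| : |h| = 1}` of a square matrix, for the Euclidean norm. -/
noncomputable def matNorm {n : ℕ} (A : Matrix (Fin n) (Fin n) ℝ) : ℝ :=
  ‖Matrix.toEuclideanCLM (n := Fin n) (𝕜 := ℝ) A‖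

open Classical in
/-- The outer dilatation `K_f(x) ∈ [1, ∞]`: it is `‖f'(x)‖ⁿ / |J_f(x)|` where the partial
derivatives exist and `J_f(x) ≠ 0`, it is `1` where they exist and `f'(x) = 0`, and it is `∞` at
all other points, including those without first partial derivatives. -/
noncomputable def K {n : ℕ} (f : Rn n → Rn n) (x : Rn n) : ℝ≥0∞ :=
  if HasPartials f x ∧ (jacobiMatrix f x).det ≠ 0 then
    ENNReal.ofReal (matNorm (jacobiMatrix f x) ^ n / |(jacobiMatrix f x).det|)
  else if HasPartials f x ∧ jacobiMatrix f x = 0 then 1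
  else ⊤

/-- The dilatation `P_f = K_f ^ (1 / (n - 1))`, used for `n ≥ 2`. -/
noncomputable def P {n : ℕ} (f : Rn n → Rn n) (x : Rn n) : ℝ≥0∞ :=
  K f x ^ (1 / ((n : ℝ) - 1))

/-- `g` is a locally integrable weak (distributional) partial derivative `∂ᵢ f` on `Ω`. -/
structure IsWeakPartial {n : ℕ} (Ω : Set (Rn n)) (i : Fin n) (f g : Rn n → Rn n) : Prop where
  locInt : LocallyIntegrableOn f Ω volume
  locInt_deriv : LocallyIntegrableOn g Ω volume
  integral_eq : ∀ φ : Rn n → ℝ, ContDiff ℝ ∞ φ → HasCompactSupport φ → tsupport φ ⊆ Ω →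
    ∫ x in Ω, (fderiv ℝ φ x (stdVec i)) • f x = - ∫ x in Ω, φ x • g x

/-- The Sobolev class `W^{1,1}_loc(Ω)` of maps into `ℝⁿ`. -/
def MemW11loc {n : ℕ} (Ω : Set (Rn n)) (f : Rn n → Rn n) : Prop :=
  LocallyIntegrableOn f Ω volume ∧ ∀ i : Fin n, ∃ g : Rn n → Rn n, IsWeakPartial Ω i f g

/-- Weak convergence in `L¹_loc(Ω)`: weak convergence in `L¹(C)` for every compact `C ⊆ Ω`,
tested against bounded measurable functions. -/
def TendstoWeaklyL1loc {n : ℕ} (Ω : Set (Rn n)) (u : ℕ → Rn n → Rn n) (v : Rn n → Rn n) : Prop :=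
  ∀ C : Set (Rn n), IsCompact C → C ⊆ Ω →
    (∀ j, IntegrableOn (u j) C volume) ∧ IntegrableOn v C volume ∧
    ∀ φ : Rn n → ℝ, Measurable φ → (∃ M : ℝ, ∀ x, |φ x| ≤ M) →
      Tendsto (fun j => ∫ x in C, φ x • u j x) atTop (𝓝 (∫ x in C, φ x • v x))

/-- `f` maps `D` homeomorphically (onto its image) into `ℝⁿ`. -/
def IsHomeoInto {n : ℕ} (D : Set (Rn n)) (f : Rn n → Rn n) : Prop :=
  IsEmbedding (D.domRestrict f)

/-- A strictly convex function `Φ : [1, ∞] → [0, ∞]` in the sense of superlinear growth: it is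
nondecreasing and convex, and `Φ(t) / t → ∞` as `t → ∞`. Only the values on `[1, ∞]` matter. -/
structure IsStrictlyConvex (Φ : ℝ≥0∞ → ℝ≥0∞) : Prop where
  mono : MonotoneOn Φ (Ici 1)
  convex : ConvexOn ℝ≥0 (Ici 1) Φ
  superlinear : Tendsto (fun t : ℝ => Φ (ENNReal.ofReal t) / ENNReal.ofReal t) atTop (𝓝 ⊤)

/-- The point `T = sup {t ∈ [1, ∞] : Φ(t) < ⊤}`. -/
noncomputable def finiteSup (Φ : ℝ≥0∞ → ℝ≥0∞) : ℝ≥0∞ :=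
  sSup {t : ℝ≥0∞ | 1 ≤ t ∧ Φ t < ⊤}

/-- `Φ : [1, ∞] → [0, ∞]` is continuous from the left at `T`, in the topology of `[0, ∞]`. -/
def LeftContAtFiniteSup (Φ : ℝ≥0∞ → ℝ≥0∞) : Prop :=
  ContinuousWithinAt Φ (Icc 1 (finiteSup Φ)) (finiteSup Φ)

end OuterDilatation

/-! The semicontinuity is an instance of polyconvexity. If p = `dilat A` is finite and det A ≠ 0,
then p^(n-1) |det A| = ‖A‖^n, and the weighted AM-GM inequality gives n s ‖A‖ ≤ (n-1) p + s^n |det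
A| for all s ≥ 0, with equality for a suitable s. So p is a supremum of expressions increasing in
‖A‖ and decreasing in |det A|. Composing with nondecreasing affine minorants of Φ
(`exists_affine_minorant`; left continuity at T supplies them at the end of the finiteness interval)
and replacing ‖A‖ by a norming functional, one finds below each value of Φ ∘ `dilat` a minorant L B
- c |det B| + b with c ≥ 0 (`exists_polyconvex_minorant`).

The two terms pass to the limit for different reasons. The linear one needs weak L¹ convergence of
the derivatives. The Jacobian enters with a favourable sign, so an upper bound is enough: an
injective Sobolev map satisfies ∫_B |J| ≤ |f(B)| (`lintegral_abs_det_formalDeriv_le`), and near a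
differentiability point of the limit the images of a small ball lie in a thin neighbourhood of an
affine image of that ball (`eventually_image_closedBall_le`). This yields the inequality, up to ε,
on all small balls about almost every point; a Vitali covering makes it global.

Weak convergence comes from equi-integrability. AM-GM with a small s, together with Φ(t)/t → ∞,
gives ‖B‖ ≤ N + ε |det B| + ε Φ(`dilat B`) (`exists_enorm_le_add`). Energies are bounded along a
subsequence and Jacobian integrals are bounded by the areas of images, so `sobolev_limit` applies:
integrals of the derivatives over measurable sets converge by comparison with smooth cutoffs,
Radon-Nikodym produces a limit density, and it is the weak derivative of the limit.

The area inequality is obtained by covering the domain up to a null set with closed sets on which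
the map is Lipschitz (pointwise maximal function estimate), and using Rademacher's theorem and the
area formula on each. -/

namespace OuterDilatation

open Metric

/-! ### Weak derivatives and increments along segments. -/

section TranslationIdentity

variable {E F : Type*} [NormedAddCommGroup E] [NormedSpace ℝ E] [FiniteDimensional ℝ E]
  [MeasurableSpace E] [BorelSpace E] [NormedAddCommGroup F] {μ : Measure E} [μ.IsAddHaarMeasure]

/-- The shear `(x, t) ↦ x + t v` pulls integrable functions back to integrable functions. -/
lemma integrable_comp_add_smul {w : E → F} (hw : Integrable w μ) (v : E) (ν : Measure ℝ)
    [IsFiniteMeasure ν] :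
    Integrable (fun p : E × ℝ => w (p.1 + p.2 • v)) (μ.prod ν) := by
  have h1 : MeasurePreserving (fun p : ℝ × E => (p.1, p.2 + p.1 • v)) (ν.prod μ) (ν.prod μ) := by
    refine MeasurePreserving.skew_product (g := fun t x => x + t • v)
      (MeasurePreserving.id ν) (by fun_prop) ?_
    exact Eventually.of_forall fun t => (measurePreserving_add_right μ (t • v)).map_eq
  have h2 : Integrable (fun p : ℝ × E => w p.2) (ν.prod μ) := hw.comp_snd ν
  have h3 : Integrable (fun p : ℝ × E => w (p.2 + p.1 • v)) (ν.prod μ) :=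
    h1.integrable_comp_of_integrable h2
  exact h3.swap

/-- A function whose weak derivative in the direction `v` is `w` satisfies the fundamental theorem
of calculus on almost every segment parallel to `v`. -/
lemma ae_sub_eq_integral_of_weak [NormedSpace ℝ F] [CompleteSpace F] {f w : E → F} (hf : Integrable f μ)
    (hw : Integrable w μ)
    {V W : Set E} (hV : IsOpen V) (v : E)
    (hVW : ∀ x ∈ V, ∀ t ∈ Icc (0 : ℝ) 1, x + t • v ∈ W)
    (h : ∀ ψ : E → ℝ, ContDiff ℝ ∞ ψ → HasCompactSupport ψ → tsupport ψ ⊆ W →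
      ∫ x, (fderiv ℝ ψ x v) • f x ∂μ = - ∫ x, ψ x • w x ∂μ) :
    ∀ᵐ x ∂μ, x ∈ V → f (x + v) - f x = ∫ t in (0 : ℝ)..1, w (x + t • v) := by
  set ν : Measure ℝ := volume.restrict (Ioc (0 : ℝ) 1) with hν
  have hint : Integrable (fun p : E × ℝ => w (p.1 + p.2 • v)) (μ.prod ν) :=
    integrable_comp_add_smul hw v ν
  have hint1 : Integrable (fun x => ∫ t, w (x + t • v) ∂ν) μ := hint.integral_prod_left
  have hfv : Integrable (fun x => f (x + v)) μ := hf.comp_add_right v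
  -- Test against ψ supported in V. The translation is moved onto ψ, the increment ψ (x - v) - ψ x
  -- is the integral of its own derivative, and Fubini reduces the claim to the weak identity for
  -- the translates ψ (· - t v), which are supported in W.
  have key : ∀ᵐ x ∂μ, x ∈ V → (f (x + v) - f x) - ∫ t, w (x + t • v) ∂ν = 0 := by
    have hi : Integrable (fun x => (f (x + v) - f x) - ∫ t, w (x + t • v) ∂ν) μ :=
      (hfv.sub hf).sub hint1
    refine hV.ae_eq_zero_of_integral_contDiff_smul_eq_zero
      (hi.locallyIntegrable.locallyIntegrableOn V) ?_
    intro ψ hψ hψc hψV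
    obtain ⟨M, hM⟩ := hψc.exists_bound_of_continuous hψ.continuous
    have hψ1 : ContDiff ℝ 1 ψ := hψ.of_le (by exact_mod_cast le_top)
    have hdc : Continuous (fun x => fderiv ℝ ψ x) := hψ1.continuous_fderiv one_ne_zero
    have hdc' : Continuous (fun x => fderiv ℝ ψ x v) := hdc.clm_apply continuous_const
    obtain ⟨M', hM'⟩ := (hψc.fderiv_apply (𝕜 := ℝ) v).exists_bound_of_continuous hdc'
    have bdd : ∀ (φ : E → ℝ) (u : E → F), Continuous φ → (∃ C, ∀ x, ‖φ x‖ ≤ C) → Integrable u μ →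
        Integrable (fun x => φ x • u x) μ := by
      intro φ u hφ ⟨C, hC⟩ hu
      exact hu.bdd_smul C hφ.aestronglyMeasurable (Eventually.of_forall hC)
    have e1 : ∫ x, ψ x • f (x + v) ∂μ = ∫ x, ψ (x - v) • f x ∂μ := by
      have := integral_add_right_eq_self (μ := μ) (fun x => ψ (x - v) • f x) v
      simpa using this
    have e2 : ∀ x, ψ (x - v) - ψ x = ∫ t, -(fderiv ℝ ψ (x - t • v) v) ∂ν := by
      intro x
      have hd : ∀ t : ℝ, HasDerivAt (fun t : ℝ => ψ (x - t • v)) (-(fderiv ℝ ψ (x - t • v) v)) t := by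
        intro t
        have h1 := ((hψ1.differentiable one_ne_zero) (x - t • v)).hasFDerivAt
        have h2 : HasDerivAt (fun t : ℝ => x - t • v) (-v) t := by
          simpa using ((hasDerivAt_id t).smul_const v).const_sub x
        have h3 := h1.comp_hasDerivAt t h2
        rw [map_neg] at h3
        exact h3
      have := intervalIntegral.integral_eq_sub_of_hasDerivAt (a := 0) (b := 1)
        (fun t _ => hd t) (Continuous.intervalIntegrable (by fun_prop) 0 1)
      rw [intervalIntegral.integral_of_le zero_le_one] at this
      rw [hν, this]
      simp
    have i2 : Integrable (fun p : E × ℝ => (-(fderiv ℝ ψ (p.1 - p.2 • v) v)) • f p.1) (μ.prod ν) := by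
      refine (hf.comp_fst ν).bdd_smul M' ?_ (Eventually.of_forall fun p => ?_)
      · exact Continuous.aestronglyMeasurable (by fun_prop)
      · simpa using hM' (p.1 - p.2 • v)
    have i3 : Integrable (fun p : E × ℝ => ψ p.1 • w (p.1 + p.2 • v)) (μ.prod ν) := by
      refine hint.bdd_smul M ?_ (Eventually.of_forall fun p => hM p.1)
      exact (hψ.continuous.comp continuous_fst).aestronglyMeasurable
    have e3 : ∫ x, (ψ (x - v) - ψ x) • f x ∂μ
        = ∫ t, ∫ x, (-(fderiv ℝ ψ (x - t • v) v)) • f x ∂μ ∂ν := by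
      rw [← integral_integral_swap i2]
      refine integral_congr_ae (Eventually.of_forall fun x => ?_)
      simp only
      rw [e2, integral_smul_const]
    have e4 : ∀ t ∈ Ioc (0 : ℝ) 1, ∫ x, (-(fderiv ℝ ψ (x - t • v) v)) • f x ∂μ
        = ∫ x, ψ x • w (x + t • v) ∂μ := by
      intro t ht
      have hh : IsClosedEmbedding (fun x : E => x - t • v) :=
        (Homeomorph.subRight (t • v)).isClosedEmbedding
      have := h (fun x => ψ (x - t • v)) (by fun_prop)
        (hψc.comp_isClosedEmbedding hh) (by
          intro y hy
          have h1 : y - t • v ∈ tsupport ψ :=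
            tsupport_comp_subset_preimage ψ hh.continuous hy
          have := hVW _ (hψV h1) t ⟨ht.1.le, ht.2⟩
          simpa using this)
      have hfd : ∀ x, fderiv ℝ (fun x => ψ (x - t • v)) x = fderiv ℝ ψ (x - t • v) := by
        intro x; exact fderiv_comp_sub (t • v)
      simp only [hfd] at this
      simp only [neg_smul, integral_neg, this, neg_neg]
      have h2 := integral_add_right_eq_self (μ := μ) (fun x => ψ (x - t • v) • w x) (t • v)
      simpa using h2.symm
    have e5 : ∫ t, ∫ x, (-(fderiv ℝ ψ (x - t • v) v)) • f x ∂μ ∂ν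
        = ∫ x, ψ x • ∫ t, w (x + t • v) ∂ν ∂μ := by
      rw [hν, setIntegral_congr_fun measurableSet_Ioc e4, ← hν, ← integral_integral_swap i3]
      refine integral_congr_ae (Eventually.of_forall fun x => ?_)
      simp only
      rw [integral_smul]
    have hb : ∃ C, ∀ x, ‖ψ x‖ ≤ C := ⟨M, hM⟩
    have j1 := bdd ψ _ hψ.continuous hb hfv
    have j2 := bdd ψ _ hψ.continuous hb hf
    have j3 := bdd ψ _ hψ.continuous hb hint1
    have j4 := bdd (fun x => ψ (x - v)) _ (by fun_prop) ⟨M, fun x => hM _⟩ hf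
    calc ∫ x, ψ x • ((f (x + v) - f x) - ∫ t, w (x + t • v) ∂ν) ∂μ
        = ∫ x, ((ψ x • f (x + v) - ψ x • f x) - ψ x • ∫ t, w (x + t • v) ∂ν) ∂μ := by
          simp only [smul_sub]
      _ = (∫ x, ψ x • f (x + v) ∂μ - ∫ x, ψ x • f x ∂μ) - ∫ x, ψ x • ∫ t, w (x + t • v) ∂ν ∂μ := by
          have j5 : Integrable (fun x => ψ x • f (x + v) - ψ x • f x) μ := j1.sub j2
          rw [integral_sub j5 j3, integral_sub j1 j2]
      _ = 0 := by
          rw [e1, ← integral_sub j4 j2, ← e5, ← e3]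
          simp only [sub_smul, sub_self]
  filter_upwards [key] with x hx hxV
  rw [intervalIntegral.integral_of_le zero_le_one]
  exact sub_eq_zero.mp (hx hxV)

end TranslationIdentity

/-! ### Localization, and classical partial derivatives of continuous Sobolev maps. -/

variable {n : ℕ}

lemma ae_of_locally_ae {X : Type*} [TopologicalSpace X] [SecondCountableTopology X]
    [MeasurableSpace X] {μ : Measure X} {U : Set X} {p : X → Prop}
    (h : ∀ x ∈ U, ∃ s ∈ 𝓝 x, ∀ᵐ y ∂μ, y ∈ s → p y) : ∀ᵐ y ∂μ, y ∈ U → p y := by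
  have : μ {y | y ∈ U ∧ ¬ p y} = 0 := by
    refine measure_null_of_locally_null _ fun x hx => ?_
    obtain ⟨s, hs, hp⟩ := h x hx.1
    refine ⟨s ∩ {y | ¬ p y}, ?_, ?_⟩
    · filter_upwards [mem_nhdsWithin_of_mem_nhds hs, self_mem_nhdsWithin] with y h1 h2
      exact ⟨h1, h2.2⟩
    · rw [ae_iff] at hp
      refine measure_mono_null (fun y hy => ?_) hp
      simpa using hy
  rw [ae_iff]
  refine measure_mono_null (fun y hy => ?_) this
  simpa using hy

lemma setIntegral_smul_eq_integral {E F : Type*} [MeasurableSpace E] {μ : Measure E}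
    [NormedAddCommGroup F] [NormedSpace ℝ F] {U : Set E} {φ : E → ℝ} (u : E → F)
    (h : ∀ x, φ x ≠ 0 → x ∈ U) : ∫ x in U, φ x • u x ∂μ = ∫ x, φ x • u x ∂μ := by
  refine setIntegral_eq_integral_of_forall_compl_eq_zero fun x hx => ?_
  have : φ x = 0 := by
    by_contra h'
    exact hx (h x h')
  simp [this]

lemma fderiv_ne_zero_mem_tsupport {E : Type*} [NormedAddCommGroup E] [NormedSpace ℝ E]
    {φ : E → ℝ} {x v : E} (h : fderiv ℝ φ x v ≠ 0) : x ∈ tsupport φ := by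
  by_contra hx
  have : fderiv ℝ φ x = 0 := by
    by_contra h'
    exact hx (support_fderiv_subset ℝ h')
  simp [this] at h

lemma IsWeakPartial.mono {Ω D : Set (Rn n)} {i : Fin n} {f g : Rn n → Rn n}
    (h : IsWeakPartial D i f g) (hΩ : Ω ⊆ D) : IsWeakPartial Ω i f g := by
  refine ⟨h.locInt.mono_set hΩ, h.locInt_deriv.mono_set hΩ, fun φ h1 h2 h3 => ?_⟩
  have := h.integral_eq φ h1 h2 (h3.trans hΩ)
  rw [setIntegral_smul_eq_integral _ fun x hx => hΩ (h3 (fderiv_ne_zero_mem_tsupport hx)),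
    setIntegral_smul_eq_integral _ fun x hx => hΩ (h3 (subset_tsupport φ hx))] at this
  rw [setIntegral_smul_eq_integral _ fun x hx => h3 (fderiv_ne_zero_mem_tsupport hx),
    setIntegral_smul_eq_integral _ fun x hx => h3 (subset_tsupport φ hx), this]

/-- Near a point of `U`, a continuous map on `U` coincides with a continuous map with compact
support. -/
lemma exists_continuous_localization {U : Set (Rn n)} (hU : IsOpen U) {f : Rn n → Rn n}
    (hf : ContinuousOn f U) {x₀ : Rn n} (hx₀ : x₀ ∈ U) :
    ∃ r : ℝ, 0 < r ∧ closedBall x₀ r ⊆ U ∧ ∃ F : Rn n → Rn n, Continuous F ∧ HasCompactSupport F ∧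
      EqOn F f (closedBall x₀ r) := by
  obtain ⟨R, hR, hRU⟩ := Metric.isOpen_iff.mp hU x₀ hx₀
  let χ : ContDiffBump x₀ := ⟨R / 4, R / 2, by positivity, by linarith⟩
  have hsub : tsupport χ ⊆ U := by
    rw [χ.tsupport_eq]
    exact (Metric.closedBall_subset_ball (by show R / 2 < R; linarith)).trans hRU
  refine ⟨R / 4, by positivity, (Metric.closedBall_subset_ball (by linarith)).trans hRU,
    fun x => χ x • f x, ?_, ?_, ?_⟩
  · refine continuous_of_tsupport fun x hx => ?_
    have : x ∈ tsupport χ := closure_mono (Function.support_smul_subset_left _ _) hx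
    exact χ.continuous.continuousAt.smul (hf.continuousAt (hU.mem_nhds (hsub this)))
  · refine HasCompactSupport.intro (isCompact_closedBall x₀ (R / 2)) fun x hx => ?_
    have h0 : χ x = 0 := χ.zero_of_le_dist (by
      rw [mem_closedBall, not_le] at hx
      exact hx.le)
    rw [h0, zero_smul]
  · intro x hx
    simp only
    rw [χ.one_of_mem_closedBall hx, one_smul]

/-- Cutting off `f` and `u` in different ways is harmless: a test function supported in the ball
sees only values there. This makes globally integrable functions available for the translation
identity. -/
lemma IsWeakPartial.integral_eq_localized {U : Set (Rn n)} {i : Fin n} {f u F : Rn n → Rn n}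
    (h : IsWeakPartial U i f u) {x₀ : Rn n} {r : ℝ} (hr : closedBall x₀ r ⊆ U)
    (hF : EqOn F f (closedBall x₀ r)) {ψ : Rn n → ℝ} (hψ : ContDiff ℝ ∞ ψ)
    (hc : HasCompactSupport ψ) (hs : tsupport ψ ⊆ closedBall x₀ r) :
    ∫ x, (fderiv ℝ ψ x (stdVec i)) • F x
      = - ∫ x, ψ x • (closedBall x₀ r).indicator u x := by
  have := h.integral_eq ψ hψ hc (hs.trans hr)
  rw [setIntegral_smul_eq_integral _ fun x hx => hr (hs (fderiv_ne_zero_mem_tsupport hx)),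
    setIntegral_smul_eq_integral _ fun x hx => hr (hs (subset_tsupport ψ hx))] at this
  have e1 : ∀ x, (fderiv ℝ ψ x (stdVec i)) • F x = (fderiv ℝ ψ x (stdVec i)) • f x := by
    intro x
    by_cases hx : x ∈ closedBall x₀ r
    · rw [hF hx]
    · have : fderiv ℝ ψ x (stdVec i) = 0 := by
        by_contra h'
        exact hx (hs (fderiv_ne_zero_mem_tsupport h'))
      simp [this]
  have e2 : ∀ x, ψ x • (closedBall x₀ r).indicator u x = ψ x • u x := by
    intro x
    by_cases hx : x ∈ closedBall x₀ r
    · simp [hx]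
    · have : ψ x = 0 := by
        by_contra h'
        exact hx (hs (subset_tsupport ψ h'))
      simp [this]
  simp only [e1, e2]
  exact this

lemma IsWeakPartial.integrable_indicator {U : Set (Rn n)} {i : Fin n} {f u : Rn n → Rn n}
    (h : IsWeakPartial U i f u) {x₀ : Rn n} {r : ℝ} (hr : closedBall x₀ r ⊆ U) :
    Integrable ((closedBall x₀ r).indicator u) := by
  rw [integrable_indicator_iff Metric.isClosed_closedBall.measurableSet]
  exact h.locInt_deriv.integrableOn_compact_subset hr (isCompact_closedBall x₀ r)

/-- A continuous map with a weak partial derivative has the corresponding classical partial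
derivative almost everywhere, with the same value. -/
theorem IsWeakPartial.ae_hasLineDerivAt {U : Set (Rn n)} (hU : IsOpen U) {i : Fin n}
    {f u : Rn n → Rn n} (hf : ContinuousOn f U) (h : IsWeakPartial U i f u) :
    ∀ᵐ x, x ∈ U → HasLineDerivAt ℝ f (u x) x (stdVec i) := by
  refine ae_of_locally_ae fun x₀ hx₀ => ?_
  obtain ⟨r, hr, hrU, F, hFc, hFs, hFf⟩ := exists_continuous_localization hU hf hx₀
  set e : Rn n := stdVec i with he
  have hne : ‖e‖ = 1 := by simp [he]
  set w : Rn n → Rn n := (closedBall x₀ r).indicator u with hw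
  have hwi : Integrable w := h.integrable_indicator hrU
  have hFi : Integrable F := hFc.integrable_of_hasCompactSupport hFs
  -- Starting points in the ball of radius r/2 and lengths below r/2 keep the segments in the ball
  -- of radius r, where F and f agree.
  have step1 : ∀ q : ℝ, |q| < r / 2 → ∀ᵐ x, x ∈ ball x₀ (r / 2) →
      F (x + q • e) - F x = ∫ t in (0 : ℝ)..q, w (x + t • e) := by
    intro q hq
    have := ae_sub_eq_integral_of_weak (μ := volume) (f := F) (w := fun x => q • w x) hFi
      (hwi.smul q) (V := ball x₀ (r / 2)) (W := ball x₀ r) Metric.isOpen_ball (q • e) ?_ ?_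
    · filter_upwards [this] with x hx hxV
      rw [hx hxV]
      by_cases hq0 : q = 0
      · simp [hq0]
      have h2 := intervalIntegral.smul_integral_comp_mul_right
        (a := 0) (b := 1) (fun s => w (x + s • e)) q
      simp only [zero_mul, one_mul] at h2
      rw [intervalIntegral.integral_smul, ← h2]
      simp only [smul_smul]
    · intro x hx t ht
      rw [mem_ball_iff_norm] at hx ⊢
      have h1 : ‖t • q • e‖ ≤ |q| := by
        rw [norm_smul, norm_smul, hne, mul_one, Real.norm_eq_abs, Real.norm_eq_abs, abs_of_nonneg ht.1]
        exact mul_le_of_le_one_left (abs_nonneg _) ht.2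
      calc ‖x + t • q • e - x₀‖ = ‖(x - x₀) + t • q • e‖ := by congr 1; abel
        _ ≤ ‖x - x₀‖ + ‖t • q • e‖ := norm_add_le _ _
        _ < r := by linarith
    · intro ψ h1 h2 h3
      have := h.integral_eq_localized hrU hFf h1 h2 (h3.trans Metric.ball_subset_closedBall)
      simp only [map_smul, smul_eq_mul, mul_smul, smul_comm _ q, integral_smul]
      rw [this]
      simp [hw]
  -- Rational lengths share one exceptional null set; both sides are continuous in the length, so
  -- the identity extends to all real lengths.
  have step2 : ∀ᵐ x, x ∈ ball x₀ (r / 2) → ∀ t ∈ Ioo (-(r / 2)) (r / 2),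
      F (x + t • e) - F x = ∫ t in (0 : ℝ)..t, w (x + t • e) := by
    have h1 : ∀ᵐ x, ∀ q : ℚ, |(q : ℝ)| < r / 2 → x ∈ ball x₀ (r / 2) →
      F (x + (q : ℝ) • e) - F x = ∫ t in (0 : ℝ)..q, w (x + t • e) := by
      rw [ae_all_iff]; intro q
      by_cases hq : |(q : ℝ)| < r / 2
      · filter_upwards [step1 q hq] with x hx _ using hx
      · exact Eventually.of_forall fun x h' => absurd h' hq
    have h2 := (integrable_comp_add_smul hwi e (volume.restrict (Ioc (-(r / 2)) (r / 2)))).prod_right_ae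
    filter_upwards [h1, h2] with x hx1 hx2 hxV
    have hII : IntegrableOn (fun t => w (x + t • e)) (Icc (-(r / 2)) (r / 2)) := by
      rw [integrableOn_Icc_iff_integrableOn_Ioc]; exact hx2
    have hII' : IntervalIntegrable (fun t => w (x + t • e)) volume (-(r / 2)) (r / 2) := by
      rw [intervalIntegrable_iff_integrableOn_Ioc_of_le (by linarith)]; exact hx2
    have hc1 : ContinuousOn (fun t => ∫ s in (0 : ℝ)..t, w (x + s • e)) (Icc (-(r / 2)) (r / 2)) := by
      have := intervalIntegral.continuousOn_primitive_interval' (a := 0) hII'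
        (by rw [uIcc_of_le (by linarith)]; constructor <;> linarith)
      rwa [uIcc_of_le (by linarith)] at this
    have hc2 : Continuous (fun t : ℝ => F (x + t • e) - F x) := by fun_prop
    intro t ht
    have hd : Ioo (-(r / 2)) (r / 2) ⊆ closure (Ioo (-(r / 2)) (r / 2) ∩ range ((↑) : ℚ → ℝ)) :=
      Rat.denseRange_cast.open_subset_closure_inter isOpen_Ioo
    have hx3 : EqOn (fun t : ℝ => F (x + t • e) - F x) (fun t => ∫ s in (0 : ℝ)..t, w (x + s • e))
        (Ioo (-(r / 2)) (r / 2) ∩ range ((↑) : ℚ → ℝ)) := by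
      rintro _ ⟨h1, q, rfl⟩
      exact hx1 q (abs_lt.mpr ⟨h1.1, h1.2⟩) hxV
    exact (hx3.of_subset_closure hc2.continuousOn (hc1.mono Ioo_subset_Icc_self)
      inter_subset_left hd) ht
  -- A measurable representative makes G a measurable set, as is needed to exchange the quantifiers
  -- over x and t in `step4`.
  obtain ⟨w', hw'm, hw'e⟩ := hwi.aestronglyMeasurable
  set G : Set (Rn n) := {y | LineDifferentiableAt ℝ F y e ∧ lineDeriv ℝ F y e = w' y} with hG
  have hGm : MeasurableSet G := by
    refine (measurableSet_lineDifferentiableAt hFc).inter ?_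
    exact measurableSet_eq_fun (measurable_lineDeriv hFc) hw'm.measurable
  set ν : Measure ℝ := volume.restrict (Ioo (-(r / 2)) (r / 2)) with hν
  have step3 : ∀ᵐ x, ∀ᵐ t ∂ν, x ∈ ball x₀ (r / 2) → x + t • e ∈ G := by
    have hmp : MeasurePreserving (fun p : ℝ × Rn n => (p.1, p.2 + p.1 • e)) (ν.prod volume)
        (ν.prod volume) := by
      refine MeasurePreserving.skew_product (g := fun t x => x + t • e)
        (MeasurePreserving.id ν) (by fun_prop) ?_
      exact Eventually.of_forall fun t => (measurePreserving_add_right volume (t • e)).map_eq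
    have h1 : ∀ᵐ p ∂(ν.prod (volume : Measure (Rn n))), w p.2 = w' p.2 :=
      Measure.quasiMeasurePreserving_snd.ae hw'e
    have h2 : ∀ᵐ p ∂(ν.prod (volume : Measure (Rn n))),
      w (p.2 + p.1 • e) = w' (p.2 + p.1 • e) := hmp.quasiMeasurePreserving.ae h1
    have h3 : ∀ᵐ p ∂((volume : Measure (Rn n)).prod ν),
      w (p.1 + p.2 • e) = w' (p.1 + p.2 • e) :=
        (Measure.measurePreserving_swap (μ := (volume : Measure (Rn n)))
          (ν := ν)).quasiMeasurePreserving.ae h2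
    have h4 := Measure.ae_ae_of_ae_prod h3
    have h5 := (integrable_comp_add_smul hwi e (volume.restrict (Ioc (-(r / 2)) (r / 2)))).prod_right_ae
    filter_upwards [step2, h4, h5] with x hx2 hx4 hx5
    by_cases hxV : x ∈ ball x₀ (r / 2)
    swap
    · exact Eventually.of_forall fun t h' => absurd h' hxV
    have hII' : IntervalIntegrable (fun t => w (x + t • e)) volume (-(r / 2)) (r / 2) := by
      rw [intervalIntegrable_iff_integrableOn_Ioc_of_le (by linarith)]; exact hx5
    -- One-dimensional Lebesgue differentiation on the line through x: the derivative exists at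
    -- almost every point of the line.
    have hL := hII'.ae_hasDerivAt_integral
    filter_upwards [hx4, ae_restrict_of_ae hL, ae_restrict_mem measurableSet_Ioo] with t ht1 ht2 ht3 _
    have hd := ht2 (by rw [uIcc_of_le (by linarith)]; exact Ioo_subset_Icc_self ht3) 0
      (by rw [uIcc_of_le (by linarith)]; constructor <;> linarith)
    have hd2 : HasDerivAt (fun s : ℝ => F (x + s • e) - F x) (w (x + t • e)) t := by
      refine hd.congr_of_eventuallyEq ?_
      filter_upwards [isOpen_Ioo.mem_nhds ht3] with s hs using hx2 hxV s hs
    have hd3 : HasLineDerivAt ℝ F (w (x + t • e)) (x + t • e) e := by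
      have h6 : HasDerivAt (fun s : ℝ => F (x + s • e)) (w (x + t • e)) t := by
        simpa using hd2.add_const (F x)
      unfold HasLineDerivAt
      have h7 := HasDerivAt.comp_const_add (f := fun s : ℝ => F (x + s • e)) t 0 (by simpa using h6)
      simpa [add_smul, add_assoc] using h7
    exact ⟨hd3.lineDifferentiableAt, by rw [hd3.lineDeriv, ht1]⟩
  have hmeas : MeasurableSet {p : Rn n × ℝ | p.1 ∈ ball x₀ (r / 2) → p.1 + p.2 • e ∈ G} := by
    have : {p : Rn n × ℝ | p.1 ∈ ball x₀ (r / 2) → p.1 + p.2 • e ∈ G}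
        = (Prod.fst ⁻¹' ball x₀ (r / 2))ᶜ ∪ (fun p : Rn n × ℝ => p.1 + p.2 • e) ⁻¹' G := by
      ext p; simp [imp_iff_not_or]
    rw [this]
    exact (measurable_fst Metric.isOpen_ball.measurableSet).compl.union
      ((by fun_prop : Measurable (fun p : Rn n × ℝ => p.1 + p.2 • e)) hGm)
  have step4 : ∀ᵐ t ∂ν, ∀ᵐ x, x ∈ ball x₀ (r / 2) → x + t • e ∈ G :=
    (Measure.ae_ae_comm hmeas).mp step3
  -- One good shift suffices: with |t| < r/4, translating back by t sends the ball of radius r/4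
  -- into the ball of radius r/2, and null sets to null sets.
  obtain ⟨t, ht, htG⟩ : ∃ t ∈ Ioo (-(r / 4)) (r / 4), ∀ᵐ x, x ∈ ball x₀ (r / 2) → x + t • e ∈ G := by
    have h1 : ∀ᵐ t ∂(volume.restrict (Ioo (-(r / 4)) (r / 4))),
        ∀ᵐ x, x ∈ ball x₀ (r / 2) → x + t • e ∈ G :=
      ae_restrict_of_ae_restrict_of_subset (Ioo_subset_Ioo (by linarith) (by linarith)) step4
    have : NeZero (volume.restrict (Ioo (-(r / 4)) (r / 4))) := by
      refine ⟨fun h0 => ?_⟩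
      rw [Measure.restrict_eq_zero, Real.volume_Ioo, ENNReal.ofReal_eq_zero] at h0
      linarith
    obtain ⟨t, h2, h3⟩ := (h1.and (ae_restrict_mem measurableSet_Ioo)).exists
    exact ⟨t, h3, h2⟩
  have htG' : ∀ᵐ x, (x - t • e) ∈ ball x₀ (r / 2) → (x - t • e) + t • e ∈ G :=
    (measurePreserving_sub_right volume (t • e)).quasiMeasurePreserving.ae htG
  refine ⟨ball x₀ (r / 4), Metric.ball_mem_nhds _ (by positivity), ?_⟩
  filter_upwards [htG', hw'e] with y hy hy2 hyb
  have hyG : y ∈ G := by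
    rw [sub_add_cancel] at hy
    refine hy ?_
    rw [mem_ball_iff_norm] at hyb ⊢
    have : ‖t • e‖ < r / 4 := by
      rw [norm_smul, hne, mul_one, Real.norm_eq_abs, abs_lt]; exact ht
    calc ‖y - t • e - x₀‖ = ‖(y - x₀) - t • e‖ := by congr 1; abel
      _ ≤ ‖y - x₀‖ + ‖t • e‖ := norm_sub_le _ _
      _ < r / 2 := by linarith
  have hyc : y ∈ closedBall x₀ r := Metric.ball_subset_closedBall (Metric.ball_subset_ball (by linarith) hyb)
  have h1 : HasLineDerivAt ℝ F (lineDeriv ℝ F y e) y e := hyG.1.hasLineDerivAt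
  rw [hyG.2, ← hy2, hw, indicator_of_mem hyc] at h1
  refine h1.congr_of_eventuallyEq ?_
  filter_upwards [Metric.isOpen_ball.mem_nhds hyb] with z hz
  exact (hFf (Metric.ball_subset_closedBall (Metric.ball_subset_ball (by linarith) hz))).symm

/-! ### Lipschitz pieces of Sobolev maps by maximal function estimates. -/

section LipschitzPieces

variable {n : ℕ}

lemma lintegral_add_smul_closedBall {h : Rn n → ℝ≥0∞} (hh : Measurable h) (x : Rn n) {t ρ : ℝ}
    (ht : 0 < t) :
    ∫⁻ v in closedBall 0 ρ, h (x + t • v)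
      = ENNReal.ofReal ((t ^ n)⁻¹) * ∫⁻ y in closedBall x (t * ρ), h y := by
  have hpre : closedBall (0 : Rn n) ρ = (fun v => t • v) ⁻¹' closedBall 0 (t * ρ) := by
    ext v
    simp [norm_smul, abs_of_pos ht, ht]
  have hpre2 : closedBall (0 : Rn n) (t * ρ) = (fun v => x + v) ⁻¹' closedBall x (t * ρ) := by
    ext v
    simp
  calc ∫⁻ v in closedBall 0 ρ, h (x + t • v)
      = ∫⁻ y in closedBall 0 (t * ρ), h (x + y) ∂(Measure.map (t • ·) volume) := by
        rw [setLIntegral_map measurableSet_closedBall (by fun_prop) (by fun_prop), hpre]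
    _ = ENNReal.ofReal ((t ^ n)⁻¹) * ∫⁻ y in closedBall 0 (t * ρ), h (x + y) := by
        rw [Measure.map_addHaar_smul volume ht.ne', Measure.restrict_smul, lintegral_smul_measure]
        simp [abs_of_pos ht]
    _ = _ := by
        congr 1
        rw [hpre2]
        exact (measurePreserving_add_left volume x).setLIntegral_comp_preimage
          measurableSet_closedBall hh

/-- By Tonelli and the substitution y = x + t v, the segment integrals average to means of h over
the balls of radius t ρ about x, each of which is at most k. -/
lemma lintegral_closedBall_le_of_segment {h : Rn n → ℝ≥0∞} (hh : Measurable h) {F : Rn n → Rn n}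
    {x : Rn n} {k : ℝ≥0∞} {ρ : ℝ} (hρ : 0 < ρ)
    (hineq : ∀ᵐ v, v ∈ closedBall (0 : Rn n) ρ →
      ‖F (x + v) - F x‖ₑ ≤ ‖v‖ₑ * ∫⁻ t in Ioc (0 : ℝ) 1, h (x + t • v))
    (hmax : ∀ s, 0 < s → s ≤ ρ → ∫⁻ y in closedBall x s, h y ≤ k * volume (closedBall x s)) :
    ∫⁻ z in closedBall x ρ, ‖F z - F x‖ₑ
      ≤ ENNReal.ofReal ρ * (k * volume (closedBall x ρ)) := by
  have hpre2 : closedBall (0 : Rn n) ρ = (fun v => x + v) ⁻¹' closedBall x ρ := by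
    ext v
    simp
  have hm : Measurable fun p : Rn n × ℝ => h (x + p.2 • p.1) := by fun_prop
  calc ∫⁻ z in closedBall x ρ, ‖F z - F x‖ₑ
      = ∫⁻ v in closedBall 0 ρ, ‖F (x + v) - F x‖ₑ := by
        rw [hpre2]
        exact ((measurePreserving_add_left volume x).setLIntegral_comp_preimage_emb
          (measurableEmbedding_addLeft x) (fun z => ‖F z - F x‖ₑ) _).symm
    _ ≤ ∫⁻ v in closedBall 0 ρ, ENNReal.ofReal ρ * ∫⁻ t in Ioc (0 : ℝ) 1, h (x + t • v) := by
        refine lintegral_mono_ae ?_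
        filter_upwards [ae_restrict_of_ae hineq, ae_restrict_mem measurableSet_closedBall]
          with v hv hvb
        refine (hv hvb).trans ?_
        gcongr
        rw [← ofReal_norm]
        exact ENNReal.ofReal_le_ofReal (by simpa using hvb)
    _ = ENNReal.ofReal ρ * ∫⁻ t in Ioc (0 : ℝ) 1, ∫⁻ v in closedBall 0 ρ, h (x + t • v) := by
        rw [lintegral_const_mul' _ _ ENNReal.ofReal_ne_top, lintegral_lintegral_swap]
        exact hm.aemeasurable
    _ ≤ ENNReal.ofReal ρ * ∫⁻ t in Ioc (0 : ℝ) 1, k * volume (closedBall x ρ) := by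
        refine mul_le_mul' le_rfl (setLIntegral_mono measurable_const fun t ht => ?_)
        rw [lintegral_add_smul_closedBall hh x ht.1]
        have h1 := hmax (t * ρ) (mul_pos ht.1 hρ) (mul_le_of_le_one_left hρ.le ht.2)
        have h2 : volume (closedBall x (t * ρ))
            = ENNReal.ofReal (t ^ n) * volume (closedBall x ρ) := by
          rw [Measure.addHaar_closedBall_mul_of_pos _ _ ht.1, ← Measure.addHaar_closedBall_center _ x]
          simp
        have h3 : ENNReal.ofReal ((t ^ n)⁻¹) * ENNReal.ofReal (t ^ n) = 1 := by
          rw [← ENNReal.ofReal_mul (by have := ht.1; positivity),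
            inv_mul_cancel₀ (pow_ne_zero _ ht.1.ne'), ENNReal.ofReal_one]
        calc _ ≤ ENNReal.ofReal ((t ^ n)⁻¹) * (k * (ENNReal.ofReal (t ^ n) * volume (closedBall x ρ))) := by
              rw [← h2]; gcongr
          _ = (ENNReal.ofReal ((t ^ n)⁻¹) * ENNReal.ofReal (t ^ n)) * (k * volume (closedBall x ρ)) := by
              ring
          _ = _ := by rw [h3, one_mul]
    _ = _ := by simp

/-- Compare F x and F y with F w and average over w in the ball of radius d = dist x y about x,
which lies in both balls of radius 2d. Each of the two terms costs 2d for the radius and 2^n for the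
volume ratio, whence 4 · 2^n. -/
lemma norm_sub_le_of_maximal {h : Rn n → ℝ≥0∞} (hh : Measurable h) {F : Rn n → Rn n}
    {A : Set (Rn n)} {k : ℝ≥0} {δ : ℝ}
    (hineq : ∀ x ∈ A, ∀ᵐ v, v ∈ closedBall (0 : Rn n) δ →
      ‖F (x + v) - F x‖ₑ ≤ ‖v‖ₑ * ∫⁻ t in Ioc (0 : ℝ) 1, h (x + t • v))
    (hmax : ∀ x ∈ A, ∀ s, 0 < s → s ≤ δ →
      ∫⁻ y in closedBall x s, h y ≤ k * volume (closedBall x s))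
    (hF : Measurable F) {x y : Rn n} (hx : x ∈ A) (hy : y ∈ A) (hxy : 2 * dist x y ≤ δ) :
    dist (F x) (F y) ≤ 4 * 2 ^ n * k * dist x y := by
  rcases eq_or_ne x y with rfl | hne
  · simp
  set d := dist x y with hd
  have hd0 : 0 < d := dist_pos.mpr hne
  have bound : ∀ z ∈ A, ∫⁻ w in closedBall z (2 * d), ‖F w - F z‖ₑ
      ≤ ENNReal.ofReal (2 * d) * (k * volume (closedBall z (2 * d))) := by
    intro z hz
    refine lintegral_closedBall_le_of_segment hh (by positivity) ?_ fun s h1 h2 =>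
      hmax z hz s h1 (h2.trans hxy)
    filter_upwards [hineq z hz] with v hv hvb using hv (closedBall_subset_closedBall hxy hvb)
  have hvol : ∀ z : Rn n, volume (closedBall z (2 * d))
      = ENNReal.ofReal (2 ^ n) * volume (closedBall x d) := by
    intro z
    rw [Measure.addHaar_closedBall_mul_of_pos _ _ two_pos, ← Measure.addHaar_closedBall_center _ x]
    simp
  set V := volume (closedBall x d) with hV
  have hV0 : V ≠ 0 := (measure_closedBall_pos volume x hd0).ne'
  have hVt : V ≠ ⊤ := measure_closedBall_lt_top.ne
  have main : ‖F x - F y‖ₑ * V ≤ ENNReal.ofReal (4 * 2 ^ n * k * d) * V := by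
    calc ‖F x - F y‖ₑ * V = ∫⁻ w in closedBall x d, ‖F x - F y‖ₑ := by simp [hV]
      _ ≤ ∫⁻ w in closedBall x d, (‖F w - F x‖ₑ + ‖F w - F y‖ₑ) := by
          refine lintegral_mono fun w => ?_
          simp only
          rw [← edist_eq_enorm_sub, ← edist_eq_enorm_sub, ← edist_eq_enorm_sub, edist_comm (F w)]
          exact edist_triangle _ _ _
      _ = (∫⁻ w in closedBall x d, ‖F w - F x‖ₑ) + ∫⁻ w in closedBall x d, ‖F w - F y‖ₑ :=
          lintegral_add_left (hF.sub_const _).enorm _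
      _ ≤ (∫⁻ w in closedBall x (2 * d), ‖F w - F x‖ₑ) + ∫⁻ w in closedBall y (2 * d), ‖F w - F y‖ₑ := by
          gcongr
          · linarith
          · refine closedBall_subset_closedBall' ?_
            rw [← hd]; linarith
      _ ≤ ENNReal.ofReal (2 * d) * (k * (ENNReal.ofReal (2 ^ n) * V))
          + ENNReal.ofReal (2 * d) * (k * (ENNReal.ofReal (2 ^ n) * V)) := by
          have h1 := bound x hx
          have h2 := bound y hy
          rw [hvol] at h1 h2
          exact add_le_add h1 h2
      _ = ENNReal.ofReal (4 * 2 ^ n * k * d) * V := by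
          rw [← two_mul, ← mul_assoc (k : ℝ≥0∞), ← mul_assoc, ← mul_assoc]
          congr 1
          have : (k : ℝ≥0∞) = ENNReal.ofReal k := (ENNReal.ofReal_coe_nnreal).symm
          rw [this, show (2 : ℝ≥0∞) = ENNReal.ofReal 2 by simp, ← ENNReal.ofReal_mul (by positivity),
            ← ENNReal.ofReal_mul (by positivity), ← ENNReal.ofReal_mul (by positivity)]
          congr 1
          ring
  have := (ENNReal.mul_le_mul_iff_left hV0 hVt).mp main
  rw [← edist_eq_enorm_sub, edist_dist] at this
  exact (ENNReal.ofReal_le_ofReal_iff (by positivity)).mp this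

lemma integral_fderiv_smul_eq_neg_sum {F : Rn n → Rn n} {g : Fin n → Rn n → Rn n}
    (hF : Integrable F) (hg : ∀ i, Integrable (g i)) {ψ : Rn n → ℝ}
    (h : ∀ i, ∫ x, fderiv ℝ ψ x (stdVec i) • F x = - ∫ x, ψ x • g i x)
    (h1 : ContDiff ℝ ∞ ψ) (h2 : HasCompactSupport ψ) (v : Rn n) :
    ∫ x, fderiv ℝ ψ x v • F x = - ∫ x, ψ x • ∑ i, v i • g i x := by
  have hvs : v = ∑ i, v i • stdVec i := by
    ext j
    simp [Finset.sum_apply, Pi.single_apply]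
  obtain ⟨M, hM⟩ := h2.exists_bound_of_continuous h1.continuous
  have hψ1 : ContDiff ℝ 1 ψ := h1.of_le (by exact_mod_cast le_top)
  have hdc : Continuous (fun x => fderiv ℝ ψ x) := hψ1.continuous_fderiv one_ne_zero
  have j1 : ∀ i, Integrable fun x => v i • (fderiv ℝ ψ x (stdVec i) • F x) := by
    intro i
    have hc : Continuous fun x => fderiv ℝ ψ x (stdVec i) := hdc.clm_apply continuous_const
    obtain ⟨M', hM'⟩ := (h2.fderiv_apply (𝕜 := ℝ) (stdVec i)).exists_bound_of_continuous hc
    exact (hF.bdd_smul M' hc.aestronglyMeasurable (Eventually.of_forall hM')).smul (v i)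
  have j2 : ∀ i, Integrable fun x => v i • (ψ x • g i x) := by
    intro i
    exact ((hg i).bdd_smul M h1.continuous.aestronglyMeasurable
      (Eventually.of_forall hM)).smul (v i)
  have e1 : ∀ x, fderiv ℝ ψ x v • F x = ∑ i, v i • (fderiv ℝ ψ x (stdVec i) • F x) := by
    intro x
    conv_lhs => rw [hvs]
    rw [map_sum, Finset.sum_smul]
    simp only [map_smul, smul_eq_mul, mul_smul]
  have e2 : ∀ x, ψ x • ∑ i, v i • g i x = ∑ i, v i • (ψ x • g i x) := by
    intro x
    rw [Finset.smul_sum]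
    exact Finset.sum_congr rfl fun i _ => smul_comm _ _ _
  simp only [e1, e2]
  rw [integral_finsetSum _ fun i _ => j1 i, integral_finsetSum _ fun i _ => j2 i,
    ← Finset.sum_neg_distrib]
  refine Finset.sum_congr rfl fun i _ => ?_
  rw [integral_smul, integral_smul, h i, smul_neg]

/-- The domain is covered, up to a null set, by countably many closed sets on each of which the
Sobolev map is Lipschitz. -/
theorem exists_lipschitz_pieces {U : Set (Rn n)} (hU : IsOpen U) {f : Rn n → Rn n}
    (hf : ContinuousOn f U) {u : Fin n → Rn n → Rn n} (h : ∀ i, IsWeakPartial U i f (u i))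
    {x₀ : Rn n} (hx₀ : x₀ ∈ U) :
    ∃ s ∈ 𝓝 x₀, s ⊆ U ∧ ∃ (C : ℕ → Set (Rn n)) (L : ℕ → ℝ≥0), (∀ k, IsClosed (C k) ∧ C k ⊆ s) ∧
      (∀ k, LipschitzOnWith (L k) f (C k)) ∧ ∀ᵐ x, x ∈ s → ∃ k, x ∈ C k := by
  obtain ⟨r, hr, hrU, F, hFc, hFs, hFf⟩ := exists_continuous_localization hU hf hx₀
  have hFi : Integrable F := hFc.integrable_of_hasCompactSupport hFs
  set w : Fin n → Rn n → Rn n := fun i => (closedBall x₀ r).indicator (u i) with hw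
  have hwi : ∀ i, Integrable (w i) := fun i => (h i).integrable_indicator hrU
  choose g hgm hge using fun i => (hwi i).aestronglyMeasurable
  have hgi : ∀ i, Integrable (g i) := fun i => (hwi i).congr (hge i)
  set H : Rn n → ℝ≥0∞ := fun x => ∑ i, ‖g i x‖ₑ with hH
  have hHm : Measurable H :=
    Finset.measurable_sum _ fun i _ => (hgm i).measurable.enorm
  have hHi : ∫⁻ x, H x ≠ ⊤ := by
    rw [hH, lintegral_finsetSum _ fun i _ => (hgm i).measurable.enorm]
    exact (ENNReal.sum_lt_top.mpr fun i _ => (hgi i).hasFiniteIntegral).ne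
  have step1 : ∀ v : Rn n, ∀ᵐ x, x ∈ ball x₀ (r / 2) → v ∈ closedBall (0 : Rn n) (r / 2) →
      ‖F (x + v) - F x‖ₑ ≤ ‖v‖ₑ * ∫⁻ t in Ioc (0 : ℝ) 1, H (x + t • v) := by
    intro v
    by_cases hv : v ∈ closedBall (0 : Rn n) (r / 2)
    swap
    · exact Eventually.of_forall fun x _ h' => absurd h' hv
    have hv' : ‖v‖ ≤ r / 2 := by simpa using hv
    have := ae_sub_eq_integral_of_weak (μ := volume) (f := F) (w := fun x => ∑ i, v i • g i x) hFi
      (integrable_finsetSum _ fun i _ => (hgi i).smul (v i))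
      (V := ball x₀ (r / 2)) (W := ball x₀ r) Metric.isOpen_ball v ?_ ?_
    · filter_upwards [this] with x hx hxV _
      rw [hx hxV, intervalIntegral.integral_of_le zero_le_one]
      refine (enorm_integral_le_lintegral_enorm _).trans ?_
      rw [← lintegral_const_mul' _ _ (by simp)]
      refine lintegral_mono fun t => ?_
      simp only [hH]
      rw [Finset.mul_sum]
      refine (enorm_sum_le _ _).trans (Finset.sum_le_sum fun i _ => ?_)
      rw [enorm_smul]
      gcongr
      rw [← ofReal_norm, ← ofReal_norm]
      exact ENNReal.ofReal_le_ofReal (PiLp.norm_apply_le v i)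
    · intro x hx t ht
      rw [mem_ball_iff_norm] at hx ⊢
      have h1 : ‖t • v‖ ≤ ‖v‖ := by
        rw [norm_smul, Real.norm_eq_abs, abs_of_nonneg ht.1]
        exact mul_le_of_le_one_left (norm_nonneg _) ht.2
      calc ‖x + t • v - x₀‖ = ‖(x - x₀) + t • v‖ := by congr 1; abel
        _ ≤ ‖x - x₀‖ + ‖t • v‖ := norm_add_le _ _
        _ < r := by linarith
    · intro ψ h1 h2 h3
      refine integral_fderiv_smul_eq_neg_sum hFi hgi (fun i => ?_) h1 h2 v
      rw [(h i).integral_eq_localized hrU hFf h1 h2 (h3.trans Metric.ball_subset_closedBall)]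
      congr 1
      refine integral_congr_ae ?_
      filter_upwards [hge i] with x hx
      rw [← hx]
  have hmeas : MeasurableSet {p : Rn n × Rn n | p.2 ∈ ball x₀ (r / 2) →
      p.1 ∈ closedBall (0 : Rn n) (r / 2) →
      ‖F (p.2 + p.1) - F p.2‖ₑ ≤ ‖p.1‖ₑ * ∫⁻ t in Ioc (0 : ℝ) 1, H (p.2 + t • p.1)} := by
    have m1 : MeasurableSet {p : Rn n × Rn n |
        ‖F (p.2 + p.1) - F p.2‖ₑ ≤ ‖p.1‖ₑ * ∫⁻ t in Ioc (0 : ℝ) 1, H (p.2 + t • p.1)} := by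
      refine measurableSet_le ?_ ?_
      · exact Measurable.enorm (Continuous.measurable (by fun_prop))
      · refine Measurable.mul (by fun_prop) ?_
        exact Measurable.lintegral_prod_right'
          (f := fun q : (Rn n × Rn n) × ℝ => H (q.1.2 + q.2 • q.1.1)) (by fun_prop)
    have m2 : MeasurableSet {p : Rn n × Rn n | p.2 ∈ ball x₀ (r / 2)} :=
      measurable_snd measurableSet_ball
    have m3 : MeasurableSet {p : Rn n × Rn n | p.1 ∈ closedBall (0 : Rn n) (r / 2)} :=
      measurable_fst measurableSet_closedBall
    exact m2.imp (m3.imp m1)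
  have step2 : ∀ᵐ x : Rn n, ∀ᵐ v : Rn n, x ∈ ball x₀ (r / 2) → v ∈ closedBall (0 : Rn n) (r / 2) →
      ‖F (x + v) - F x‖ₑ ≤ ‖v‖ₑ * ∫⁻ t in Ioc (0 : ℝ) 1, H (x + t • v) :=
    (Measure.ae_ae_comm (μ := (volume : Measure (Rn n))) (ν := (volume : Measure (Rn n))) hmeas).mp
      (Eventually.of_forall step1)
  have hdiff : ∀ᵐ x, Tendsto (fun s => (∫⁻ y in closedBall x s, H y) / volume (closedBall x s))
      (𝓝[>] 0) (𝓝 (H x)) := by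
    filter_upwards [(Besicovitch.vitaliFamily volume).ae_tendsto_lintegral_div' hHm hHi] with x hx
    exact hx.comp (Besicovitch.tendsto_filterAt volume x)
  have hHfin : ∀ᵐ x, H x < ⊤ := ae_lt_top hHm hHi
  -- The bound r/2 is the range of the segment inequality. The bound 1/(k+1) lets scales shrink with
  -- k, so a point where the means of H converge to a finite limit lies in A k for large k.
  set δ : ℕ → ℝ := fun k => min (r / 2) (1 / (k + 1)) with hδ
  have hδ0 : ∀ k, 0 < δ k := fun k => lt_min (by positivity) (by positivity)
  set A : ℕ → Set (Rn n) := fun k => {x | x ∈ closedBall x₀ (r / 4) ∧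
    (∀ᵐ v, v ∈ closedBall (0 : Rn n) (r / 2) →
      ‖F (x + v) - F x‖ₑ ≤ ‖v‖ₑ * ∫⁻ t in Ioc (0 : ℝ) 1, H (x + t • v)) ∧
    ∀ s, 0 < s → s ≤ δ k → ∫⁻ y in closedBall x s, H y ≤ ((k : ℝ≥0) : ℝ≥0∞) * volume (closedBall x s)}
    with hA
  obtain ⟨M, hM⟩ := hFs.exists_bound_of_continuous hFc
  have hM0 : 0 ≤ M := (norm_nonneg _).trans (hM 0)
  have hlip : ∀ k, ∃ L : ℝ≥0, LipschitzOnWith L F (A k) := by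
    intro k
    -- The first constant serves pairs with 2 dist x y ≤ δ k. For distant pairs the trivial bound 2M
    -- on the increment is at most (4M / δ k) dist x y.
    refine ⟨⟨max (4 * 2 ^ n * k) (4 * M / δ k), le_max_of_le_left (by positivity)⟩,
      LipschitzOnWith.of_dist_le_mul fun x hx y hy => ?_⟩
    show dist (F x) (F y) ≤ max (4 * 2 ^ n * (k : ℝ)) (4 * M / δ k) * dist x y
    by_cases hxy : 2 * dist x y ≤ δ k
    · have := norm_sub_le_of_maximal (k := (k : ℝ≥0)) (A := A k) hHm (fun x hx => by
          filter_upwards [hx.2.1] with v hv hvb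
          exact hv (closedBall_subset_closedBall (min_le_left _ _) hvb))
        (fun x hx => hx.2.2) hFc.measurable hx hy hxy
      refine this.trans ?_
      gcongr
      exact le_max_left _ _
    · push Not at hxy
      have h1 : dist (F x) (F y) ≤ 2 * M := by
        rw [dist_eq_norm]
        linarith [norm_sub_le (F x) (F y), hM x, hM y]
      have h2 : 2 * M ≤ 4 * M / δ k * dist x y := by
        rw [div_mul_eq_mul_div, le_div_iff₀ (hδ0 k)]
        nlinarith
      refine (h1.trans h2).trans ?_
      gcongr
      exact le_max_right _ _
  choose L hL using hlip
  -- Passing to closures keeps the Lipschitz bound, since F is continuous, and gives measurable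
  -- pieces without examining A k.
  have hclos : ∀ k, closure (A k) ⊆ closedBall x₀ (r / 4) := fun k =>
    closure_minimal (fun x hx => hx.1) isClosed_closedBall
  refine ⟨closedBall x₀ (r / 4), closedBall_mem_nhds _ (by positivity),
    (closedBall_subset_closedBall (by linarith)).trans hrU, fun k => closure (A k), L,
    fun k => ⟨isClosed_closure, hclos k⟩, fun k => ?_, ?_⟩
  · have h1 : LipschitzOnWith (L k) F (closure (A k)) :=
      (lipschitzOnWith_closure_iff hFc.continuousOn).mpr (hL k)
    intro x hx y hy
    have h2 : closedBall x₀ (r / 4) ⊆ closedBall x₀ r := closedBall_subset_closedBall (by linarith)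
    rw [← hFf (h2 (hclos k hx)), ← hFf (h2 (hclos k hy))]
    exact h1 hx hy
  · filter_upwards [step2, hdiff, hHfin] with x hx1 hx2 hx3 hxb
    obtain ⟨m, hm⟩ := ENNReal.exists_nat_gt hx3.ne
    have h1 : ∀ᶠ s in 𝓝[>] (0 : ℝ), (∫⁻ y in closedBall x s, H y) / volume (closedBall x s) < m :=
      hx2.eventually_lt_const hm
    rw [eventually_nhdsWithin_iff, Metric.eventually_nhds_iff] at h1
    obtain ⟨ε, hε, h2⟩ := h1
    obtain ⟨m', hm'⟩ := exists_nat_one_div_lt hε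
    refine ⟨max m m', subset_closure ⟨hxb, ?_, ?_⟩⟩
    · filter_upwards [hx1] with v hv
      exact hv (closedBall_subset_ball (by linarith) hxb)
    · intro s hs0 hs
      have hs1 : s < ε := by
        refine lt_of_le_of_lt (hs.trans (min_le_right _ _)) (lt_of_le_of_lt ?_ hm')
        apply one_div_le_one_div_of_le (by positivity)
        have : (m' : ℝ) ≤ ((max m m' : ℕ) : ℝ) := by exact_mod_cast le_max_right _ _
        linarith
      have h3 := h2 (y := s) (by simpa [abs_of_pos hs0] using hs1) hs0
      have hV0 : volume (closedBall x s) ≠ 0 := (measure_closedBall_pos volume x hs0).ne'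
      have hVt : volume (closedBall x s) ≠ ⊤ := measure_closedBall_lt_top.ne
      have h4 := ((ENNReal.div_le_iff hV0 hVt).mp h3.le)
      refine h4.trans ?_
      gcongr
      simp

end LipschitzPieces

/-! ### Rademacher on the pieces and the area inequality. -/

section AreaInequality

variable {n : ℕ}

/-- The formal derivative assembled from the classical partial derivatives. -/
noncomputable def formalDeriv (f : Rn n → Rn n) (x : Rn n) : Rn n →L[ℝ] Rn n :=
  Matrix.toEuclideanCLM (n := Fin n) (𝕜 := ℝ) (jacobiMatrix f x)

lemma formalDeriv_stdVec (f : Rn n → Rn n) (x : Rn n) (i : Fin n) :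
    formalDeriv f x (stdVec i) = lineDeriv ℝ f x (stdVec i) := by
  ext k
  simp [formalDeriv, jacobiMatrix]

lemma clm_ext_stdVec {A B : Rn n →L[ℝ] Rn n} (h : ∀ i, A (stdVec i) = B (stdVec i)) : A = B := by
  ext1 v
  have hvs : v = ∑ i, v i • stdVec i := by
    ext j
    simp [Finset.sum_apply, Pi.single_apply]
  rw [hvs, map_sum, map_sum]
  exact Finset.sum_congr rfl fun i _ => by rw [map_smul, map_smul, h]

lemma formalDeriv_eq_of_hasLineDerivAt {f : Rn n → Rn n} {x : Rn n} {A : Rn n →L[ℝ] Rn n}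
    (h : ∀ i, HasLineDerivAt ℝ f (A (stdVec i)) x (stdVec i)) : formalDeriv f x = A :=
  clm_ext_stdVec fun i => by rw [formalDeriv_stdVec, (h i).lineDeriv]

lemma det_formalDeriv (f : Rn n → Rn n) (x : Rn n) :
    (formalDeriv f x).det = (jacobiMatrix f x).det := by
  unfold formalDeriv ContinuousLinearMap.det
  rw [Matrix.coe_toEuclideanCLM_eq_toEuclideanLin,
    show Matrix.toEuclideanLin (jacobiMatrix f x) = Matrix.toLin _ _ (jacobiMatrix f x) from
      congrArg (fun e => e (jacobiMatrix f x)) (Matrix.toLpLin_eq_toLin 2 2)]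
  exact LinearMap.det_toLin _ _

/-- Almost every point of a measurable set is an accumulation point of the set in a prescribed
direction. -/
lemma ae_frequently_add_smul_mem {A : Set (Rn n)} (hA : MeasurableSet A) (e : Rn n) :
    ∀ᵐ x, x ∈ A → ∃ᶠ k : ℕ in atTop, x + (1 / ((k : ℝ) + 1)) • e ∈ A := by
  wlog hfin : volume A ≠ ⊤ generalizing A
  · have h1 : ∀ N : ℕ, ∀ᵐ x, x ∈ A ∩ closedBall 0 N →
        ∃ᶠ k : ℕ in atTop, x + (1 / ((k : ℝ) + 1)) • e ∈ A ∩ closedBall 0 N := fun N =>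
      this (hA.inter measurableSet_closedBall)
        ((measure_mono inter_subset_right).trans_lt measure_closedBall_lt_top).ne
    filter_upwards [ae_all_iff.mpr h1] with x hx hxA
    obtain ⟨N, hN⟩ := exists_nat_ge ‖x‖
    exact (hx N ⟨hxA, by simpa using hN⟩).mono fun k hk => hk.1
  set τ : ℕ → C(Rn n, Rn n) := fun k => ⟨fun x => x + (1 / ((k : ℝ) + 1)) • e, by fun_prop⟩ with hτ
  have hτ0 : Tendsto τ atTop (𝓝 (ContinuousMap.id (Rn n))) := by
    rw [ContinuousMap.tendsto_iff_forall_isCompact_tendstoUniformlyOn]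
    intro K _
    rw [Metric.tendstoUniformlyOn_iff]
    intro ε hε
    have h0 : Tendsto (fun k : ℕ => ‖(1 / ((k : ℝ) + 1)) • e‖) atTop (𝓝 0) := by
      have := (tendsto_one_div_add_atTop_nhds_zero_nat (𝕜 := ℝ)).smul_const e
      simpa using this.norm
    filter_upwards [h0.eventually_lt_const hε] with k hk x _
    simpa [hτ, dist_eq_norm] using hk
  have hlim := tendsto_measure_symmDiff_preimage_nhds_zero (μ := volume) (ν := volume) hτ0
    (Eventually.of_forall fun k => measurePreserving_add_right volume _)
    (MeasurePreserving.id volume) hA.nullMeasurableSet hfin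
  -- For every k ≥ m such a point lies in A but not in the preimage of A under the k-th translation,
  -- and the measure of that symmetric difference tends to 0.
  have hbad : ∀ m : ℕ, volume {x | x ∈ A ∧ ∀ k ≥ m, x + (1 / ((k : ℝ) + 1)) • e ∉ A} = 0 := by
    intro m
    refine le_antisymm (ge_of_tendsto hlim ?_) bot_le
    filter_upwards [eventually_ge_atTop m] with k hk
    refine measure_mono fun x hx => Or.inr ⟨hx.1, hx.2 k hk⟩
  have hbad' : ∀ m : ℕ, ∀ᵐ x, ¬ (x ∈ A ∧ ∀ k ≥ m, x + (1 / ((k : ℝ) + 1)) • e ∉ A) := by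
    intro m
    rw [ae_iff]
    simpa using hbad m
  filter_upwards [ae_all_iff.mpr hbad'] with x hx hxA
  rw [frequently_atTop]
  intro m
  by_contra hcon
  push Not at hcon
  exact hx m ⟨hxA, hcon⟩

/-- Along the indices whose points lie in A, the same difference quotients converge to L e and to w.
This identifies a derivative known only within a set with the classical partial derivatives. -/
lemma HasFDerivWithinAt.apply_eq_of_hasLineDerivAt {f : Rn n → Rn n} {A : Set (Rn n)} {x e w : Rn n}
    {L : Rn n →L[ℝ] Rn n} (h : HasFDerivWithinAt f L A x)
    (hfr : ∃ᶠ k : ℕ in atTop, x + (1 / ((k : ℝ) + 1)) • e ∈ A)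
    (hw : HasLineDerivAt ℝ f w x e) : L e = w := by
  set l : Filter ℕ := atTop ⊓ 𝓟 {k : ℕ | x + (1 / ((k : ℝ) + 1)) • e ∈ A} with hl
  have hne : l.NeBot := frequently_mem_iff_neBot.mp hfr
  have h0 : Tendsto (fun k : ℕ => 1 / ((k : ℝ) + 1)) l (𝓝 0) :=
    (tendsto_one_div_add_atTop_nhds_zero_nat (𝕜 := ℝ)).mono_left inf_le_left
  have hcd : ∀ k : ℕ, ((k : ℝ) + 1) • ((1 / ((k : ℝ) + 1)) • e) = e := by
    intro k
    rw [smul_smul, mul_one_div_cancel (by positivity), one_smul]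
  have h1 : Tendsto (fun k : ℕ => ((k : ℝ) + 1) • (f (x + (1 / ((k : ℝ) + 1)) • e) - f x)) l
      (𝓝 (L e)) := by
    refine h.lim (d := fun k : ℕ => (1 / ((k : ℝ) + 1)) • e) ?_ ?_ ?_
    · simpa using h0.smul_const e
    · exact mem_inf_of_right (mem_principal_self _)
    · simp only [hcd]
      exact tendsto_const_nhds
  have h2 : Tendsto (fun k : ℕ => ((k : ℝ) + 1) • (f (x + (1 / ((k : ℝ) + 1)) • e) - f x)) l
      (𝓝 w) := by
    have h3 := HasDerivAt.tendsto_slope_zero (f := fun t : ℝ => f (x + t • e)) hw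
    have h4 : Tendsto (fun k : ℕ => 1 / ((k : ℝ) + 1)) l (𝓝[≠] 0) :=
      tendsto_nhdsWithin_iff.mpr ⟨h0, Eventually.of_forall fun k => by
        simp only [mem_compl_iff, mem_singleton_iff]; positivity⟩
    have h5 := h3.comp h4
    refine h5.congr fun k => ?_
    simp
  exact tendsto_nhds_unique h1 h2

/-- The domain is covered, up to a null set, by countably many measurable sets along which the
Sobolev map is differentiable with derivative the formal derivative. -/
theorem exists_differentiable_pieces {U : Set (Rn n)} (hU : IsOpen U) {f : Rn n → Rn n}
    (hf : ContinuousOn f U) {u : Fin n → Rn n → Rn n} (h : ∀ i, IsWeakPartial U i f (u i)) :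
    ∃ A : ℕ → Set (Rn n), (∀ k, MeasurableSet (A k)) ∧ (∀ k, A k ⊆ U) ∧
      (∀ k, ∀ x ∈ A k, HasFDerivWithinAt f (formalDeriv f x) (A k) x) ∧
      ∀ᵐ x, x ∈ U → ∃ k, x ∈ A k := by
  rcases U.eq_empty_or_nonempty with rfl | ⟨y₀, hy₀⟩
  · exact ⟨fun _ => ∅, by simp, by simp, by simp, by simp⟩
  choose! s hs hsU C L hC hL hcov using fun x (hx : x ∈ U) => exists_lipschitz_pieces hU hf h hx
  obtain ⟨T, hTU, hTc, hT⟩ := TopologicalSpace.countable_cover_nhdsWithin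
    (f := s) (s := U) fun x hx => mem_nhdsWithin_of_mem_nhds (hs x hx)
  have hTne : T.Nonempty := by
    by_contra h'
    rw [not_nonempty_iff_eq_empty] at h'
    simpa [h'] using hT hy₀
  obtain ⟨q, hq⟩ := hTc.exists_eq_range hTne
  have hqU : ∀ m, q m ∈ U := fun m => hTU (hq ▸ mem_range_self m)
  have good : ∀ m k, ∀ᵐ x, x ∈ C (q m) k →
      HasFDerivWithinAt f (formalDeriv f x) (C (q m) k) x := by
    intro m k
    have hCl := (hC (q m) (hqU m) k).1
    have hCU : C (q m) k ⊆ U := (hC (q m) (hqU m) k).2.trans (hsU _ (hqU m))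
    -- Rademacher's theorem on a Lipschitz piece; the value of the derivative is then read off
    -- direction by direction.
    have h1 := (hL (q m) (hqU m) k).ae_differentiableWithinAt_of_mem (μ := volume)
    have h2 : ∀ᵐ x, ∀ i, x ∈ C (q m) k →
        ∃ᶠ j : ℕ in atTop, x + (1 / ((j : ℝ) + 1)) • stdVec i ∈ C (q m) k :=
      ae_all_iff.mpr fun i => ae_frequently_add_smul_mem hCl.measurableSet (stdVec i)
    have h3 : ∀ᵐ x, ∀ i, x ∈ U → HasLineDerivAt ℝ f (u i x) x (stdVec i) :=
      ae_all_iff.mpr fun i => (h i).ae_hasLineDerivAt hU hf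
    filter_upwards [h1, h2, h3] with x hx1 hx2 hx3 hxC
    have h4 := (hx1 hxC).hasFDerivWithinAt
    have h5 : formalDeriv f x = fderivWithin ℝ f (C (q m) k) x := by
      refine formalDeriv_eq_of_hasLineDerivAt fun i => ?_
      rw [HasFDerivWithinAt.apply_eq_of_hasLineDerivAt h4 (hx2 i hxC) (hx3 i (hCU hxC))]
      exact hx3 i (hCU hxC)
    rwa [h5]
  set N : ℕ → ℕ → Set (Rn n) := fun m k => toMeasurable volume {x | ¬ (x ∈ C (q m) k →
      HasFDerivWithinAt f (formalDeriv f x) (C (q m) k) x)} with hN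
  have hN0 : ∀ m k, volume (N m k) = 0 := fun m k => by
    rw [hN, measure_toMeasurable]
    exact good m k
  have hNgood : ∀ m k x, x ∈ C (q m) k → x ∉ N m k →
      HasFDerivWithinAt f (formalDeriv f x) (C (q m) k) x := by
    intro m k x hx hxN
    by_contra hcon
    exact hxN (subset_toMeasurable _ _ (by
      simp only [mem_ofPred_eq]
      exact fun h' => hcon (h' hx)))
  refine ⟨fun j => C (q j.unpair.1) j.unpair.2 \ N j.unpair.1 j.unpair.2, fun j => ?_, fun j => ?_,
    fun j x hx => ?_, ?_⟩
  · exact (hC _ (hqU _) _).1.measurableSet.diff (measurableSet_toMeasurable _ _)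
  · exact sdiff_subset.trans ((hC _ (hqU _) _).2.trans (hsU _ (hqU _)))
  · exact (hNgood _ _ x hx.1 hx.2).mono sdiff_subset
  · have h1 : ∀ᵐ x, ∀ m, x ∈ s (q m) → ∃ k, x ∈ C (q m) k :=
      ae_all_iff.mpr fun m => hcov (q m) (hqU m)
    have h2 : ∀ᵐ x, ∀ m k, x ∉ N m k :=
      ae_all_iff.mpr fun m => ae_all_iff.mpr fun k => measure_eq_zero_iff_ae_notMem.mp (hN0 m k)
    filter_upwards [h1, h2] with x hx1 hx2 hxU
    obtain ⟨t, htT, hxt⟩ := mem_iUnion₂.mp (hT hxU)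
    obtain ⟨m, rfl⟩ : t ∈ range q := hq ▸ htT
    obtain ⟨k, hk⟩ := hx1 m hxt
    exact ⟨Nat.pair m k, by simpa using ⟨hk, hx2 m k⟩⟩

/-- The area inequality for injective continuous Sobolev maps. -/
theorem lintegral_abs_det_formalDeriv_le {U : Set (Rn n)} (hU : IsOpen U) {f : Rn n → Rn n}
    (hf : ContinuousOn f U) (hinj : InjOn f U) {u : Fin n → Rn n → Rn n}
    (h : ∀ i, IsWeakPartial U i f (u i)) {B : Set (Rn n)} (hB : MeasurableSet B) (hBU : B ⊆ U) :
    ∫⁻ x in B, ENNReal.ofReal |(formalDeriv f x).det| ≤ volume (f '' B) := by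
  obtain ⟨A, hAm, hAU, hAd, hAcov⟩ := exists_differentiable_pieces hU hf h
  set E : ℕ → Set (Rn n) := fun k => B ∩ disjointed A k with hE
  have hEm : ∀ k, MeasurableSet (E k) := fun k => hB.inter (MeasurableSet.disjointed hAm k)
  have hEd : Pairwise (Function.onFun Disjoint E) := fun i j hij =>
    (disjoint_disjointed A hij).mono inter_subset_right inter_subset_right
  have hEB : ∀ k, E k ⊆ B := fun k => inter_subset_left
  have hcov : B ≤ᵐ[volume] ⋃ k, E k := by
    filter_upwards [hAcov] with x hx hxB
    obtain ⟨k, hk⟩ := hx (hBU hxB)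
    have : x ∈ ⋃ k, disjointed A k := by
      rw [iUnion_disjointed]
      exact mem_iUnion.mpr ⟨k, hk⟩
    obtain ⟨j, hj⟩ := mem_iUnion.mp this
    exact mem_iUnion.mpr ⟨j, hxB, hj⟩
  -- The uncovered null set drops out of the integral, but its image may have positive measure, so
  -- only an inequality results.
  calc ∫⁻ x in B, ENNReal.ofReal |(formalDeriv f x).det|
      ≤ ∫⁻ x in ⋃ k, E k, ENNReal.ofReal |(formalDeriv f x).det| := lintegral_mono_set' hcov
    _ = ∑' k, ∫⁻ x in E k, ENNReal.ofReal |(formalDeriv f x).det| :=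
        lintegral_iUnion hEm hEd _
    _ = ∑' k, volume (f '' E k) := by
        congr 1
        ext k
        refine lintegral_abs_det_fderiv_eq_addHaar_image volume (hEm k) (fun x hx => ?_)
          (hinj.mono ((hEB k).trans hBU))
        exact (hAd k x (disjointed_subset A k hx.2)).mono
          (inter_subset_right.trans (disjointed_subset A k))
    _ = volume (⋃ k, f '' E k) := by
        refine (measure_iUnion (fun i j hij => ?_) fun k => ?_).symm
        · refine Set.disjoint_left.mpr ?_
          rintro _ ⟨a, ha, rfl⟩ ⟨b, hb, hab⟩
          have : b = a := hinj (hBU (hEB j hb)) (hBU (hEB i ha)) hab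
          exact Set.disjoint_left.mp (hEd hij) ha (this ▸ hb)
        · exact (hEm k).image_of_continuousOn_injOn (hf.mono ((hEB k).trans hBU))
            (hinj.mono ((hEB k).trans hBU))
    _ ≤ volume (f '' B) := measure_mono (iUnion_subset fun k => image_mono (hEB k))

end AreaInequality

/-! ### The dilatation as a function of the matrix, and AM-GM. -/

section Dilatation

variable {n : ℕ}

open Classical in
/-- The dilatation `P` as a function of the derivative. -/
noncomputable def dilat (A : Rn n →L[ℝ] Rn n) : ℝ≥0∞ :=
  if A.det ≠ 0 then ENNReal.ofReal (‖A‖ ^ n / |A.det|) ^ (1 / ((n : ℝ) - 1))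
  else if A = 0 then 1 else ⊤

lemma one_div_sub_one_pos (hn : 2 ≤ n) : 0 < 1 / ((n : ℝ) - 1) := by
  have : (2 : ℝ) ≤ n := by exact_mod_cast hn
  exact one_div_pos.mpr (by linarith)

lemma P_eq_dilat (hn : 2 ≤ n) {f : Rn n → Rn n} {x : Rn n} (h : HasPartials f x) :
    P f x = dilat (formalDeriv f x) := by
  have h0 : formalDeriv f x = 0 ↔ jacobiMatrix f x = 0 := by
    unfold formalDeriv
    exact map_eq_zero_iff _ (EquivLike.injective _)
  have hp := one_div_sub_one_pos hn
  unfold P K dilat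
  rw [det_formalDeriv, h0]
  simp only [h, true_and]
  split_ifs with h1 h2
  · rfl
  · exact ENNReal.one_rpow _
  · exact ENNReal.top_rpow_of_pos hp

/-- The image of the unit ball has volume |det A| times that of the ball and lies in the ball of
radius ‖A‖. -/
lemma abs_det_le_norm_pow (A : Rn n →L[ℝ] Rn n) : |A.det| ≤ ‖A‖ ^ n := by
  have h1 := Measure.addHaar_image_continuousLinearMap (volume : Measure (Rn n)) A (closedBall 0 1)
  have h2 : A '' closedBall 0 1 ⊆ closedBall 0 (‖A‖ * 1) := by
    rintro _ ⟨v, hv, rfl⟩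
    rw [mem_closedBall_zero_iff] at hv ⊢
    exact A.le_of_opNorm_le_of_le le_rfl hv
  have h3 := measure_mono (μ := (volume : Measure (Rn n))) h2
  rw [h1, Measure.addHaar_closedBall_mul _ _ (norm_nonneg A) zero_le_one] at h3
  have h4 := (ENNReal.mul_le_mul_iff_left (measure_closedBall_pos volume (0 : Rn n) one_pos).ne'
    measure_closedBall_lt_top.ne).mp h3
  rw [ENNReal.ofReal_le_ofReal_iff (by positivity)] at h4
  simpa using h4

lemma one_le_dilat (hn : 2 ≤ n) (A : Rn n →L[ℝ] Rn n) : 1 ≤ dilat A := by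
  have hp := one_div_sub_one_pos hn
  unfold dilat
  split_ifs with h1 h2
  · refine ENNReal.one_le_rpow ?_ hp
    rw [ENNReal.one_le_ofReal, le_div_iff₀ (abs_pos.mpr h1), one_mul]
    exact abs_det_le_norm_pow A
  · exact le_rfl
  · exact le_top

/-- The exponent 1/(n-1) in P is chosen for this homogeneity: it is the equality behind AM-GM with
weights (n-1)/n and 1/n. -/
lemma dilat_toReal_pow_mul (hn : 2 ≤ n) {A : Rn n →L[ℝ] Rn n} (h : A.det ≠ 0) :
    (dilat A).toReal ^ (n - 1) * |A.det| = ‖A‖ ^ n := by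
  have hn' : (2 : ℝ) ≤ n := by exact_mod_cast hn
  have h0 : 0 ≤ ‖A‖ ^ n / |A.det| := by positivity
  have hd : 0 < |A.det| := abs_pos.mpr h
  unfold dilat
  rw [if_pos h, ← ENNReal.toReal_rpow, ENNReal.toReal_ofReal h0, ← Real.rpow_natCast,
    ← Real.rpow_mul h0]
  have : 1 / ((n : ℝ) - 1) * ((n - 1 : ℕ) : ℝ) = 1 := by
    rw [Nat.cast_sub (by omega)]
    push_cast
    rw [one_div_mul_cancel]
    linarith
  rw [this, Real.rpow_one, div_mul_cancel₀ _ hd.ne']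

lemma dilat_ne_top_iff (hn : 2 ≤ n) {A : Rn n →L[ℝ] Rn n} : dilat A ≠ ⊤ ↔ A.det ≠ 0 ∨ A = 0 := by
  have hp := one_div_sub_one_pos hn
  unfold dilat
  split_ifs with h1 h2
  · simpa [h1] using ENNReal.rpow_ne_top_of_nonneg hp.le ENNReal.ofReal_ne_top
  · simp [h2]
  · simp [h1, h2]

/-- The weighted arithmetic-geometric mean inequality in the form used for dilatations. -/
lemma mul_le_of_pow_eq (hn : 2 ≤ n) {x p J s : ℝ} (hx : 0 ≤ x) (hp : 0 ≤ p) (hJ : 0 ≤ J)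
    (hs : 0 ≤ s) (h : p ^ (n - 1) * J = x ^ n) : n * s * x ≤ (n - 1) * p + s ^ n * J := by
  have hn' : (2 : ℝ) ≤ n := by exact_mod_cast hn
  have hn0 : (n : ℝ) ≠ 0 := by positivity
  have h1 := Real.geom_mean_le_arith_mean2_weighted (w₁ := ((n : ℝ) - 1) / n) (w₂ := 1 / n)
    (p₁ := p) (p₂ := s ^ n * J) (div_nonneg (by linarith) (by linarith)) (by positivity) hp
    (by positivity) (by field_simp; ring)
  have h2 : p ^ (((n : ℝ) - 1) / n) * (s ^ n * J) ^ (1 / (n : ℝ)) = s * x := by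
    have h3 : p ^ (((n : ℝ) - 1) / n) = (p ^ (n - 1)) ^ (1 / (n : ℝ)) := by
      rw [← Real.rpow_natCast, ← Real.rpow_mul hp, Nat.cast_sub (by omega)]
      push_cast
      congr 1
      ring
    rw [h3, ← Real.mul_rpow (by positivity) (by positivity)]
    have h4 : p ^ (n - 1) * (s ^ n * J) = (s * x) ^ n := by
      rw [mul_pow, ← h]
      ring
    rw [h4, one_div, Real.pow_rpow_inv_natCast (by positivity) (by omega)]
  rw [h2] at h1
  have h5 : ((n : ℝ) - 1) / n * p + 1 / n * (s ^ n * J) = ((n - 1) * p + s ^ n * J) / n := by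
    field_simp
  rw [h5, le_div_iff₀ (by positivity)] at h1
  linarith

/-- AM-GM when det A ≠ 0; for A = 0 the left side vanishes. These are the only matrices of finite
dilatation. -/
lemma mul_norm_le_dilat (hn : 2 ≤ n) {A : Rn n →L[ℝ] Rn n} (h : dilat A ≠ ⊤) {s : ℝ} (hs : 0 ≤ s) :
    n * s * ‖A‖ ≤ (n - 1) * (dilat A).toReal + s ^ n * |A.det| := by
  have hn' : (2 : ℝ) ≤ n := by exact_mod_cast hn
  rcases (dilat_ne_top_iff hn).mp h with h1 | rfl
  · exact mul_le_of_pow_eq hn (norm_nonneg _) ENNReal.toReal_nonneg (abs_nonneg _) hs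
      (dilat_toReal_pow_mul hn h1)
  · simp only [norm_zero, mul_zero]
    have : 0 ≤ (dilat (0 : Rn n →L[ℝ] Rn n)).toReal := ENNReal.toReal_nonneg
    have := mul_nonneg (by linarith : (0 : ℝ) ≤ n - 1) this
    positivity

/-- Equality in AM-GM requires p = s^n |det A|, which s = p / ‖A‖ achieves. -/
lemma exists_mul_norm_eq_dilat (hn : 2 ≤ n) {A : Rn n →L[ℝ] Rn n} (h : A.det ≠ 0) :
    ∃ s : ℝ, 0 < s ∧ n * s * ‖A‖ - s ^ n * |A.det| = (n - 1) * (dilat A).toReal := by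
  have hd : 0 < |A.det| := abs_pos.mpr h
  have hA : 0 < ‖A‖ := by
    rw [norm_pos_iff]
    rintro rfl
    have := abs_det_le_norm_pow (0 : Rn n →L[ℝ] Rn n)
    rw [norm_zero, zero_pow (by omega)] at this
    linarith
  set p := (dilat A).toReal with hp
  have h1 : p ^ (n - 1) * |A.det| = ‖A‖ ^ n := dilat_toReal_pow_mul hn h
  have hp0 : 0 < p := by
    refine lt_of_le_of_ne ENNReal.toReal_nonneg fun h0 => ?_
    rw [← h0, zero_pow (by omega), zero_mul] at h1
    exact (pow_pos hA n).ne h1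
  refine ⟨p / ‖A‖, by positivity, ?_⟩
  have h2 : (p / ‖A‖) ^ n * |A.det| = p := by
    rw [div_pow, ← h1]
    have : p ^ n = p * p ^ (n - 1) := by rw [← pow_succ']; congr 1; omega
    rw [this]
    field_simp
  rw [h2]
  field_simp

lemma measurable_det : Measurable fun A : Rn n →L[ℝ] Rn n => A.det :=
  ContinuousLinearMap.continuous_det.measurable

lemma measurable_dilat : Measurable (dilat : (Rn n →L[ℝ] Rn n) → ℝ≥0∞) := by
  classical
  unfold dilat
  refine Measurable.ite (measurable_det (measurableSet_singleton 0).compl) ?_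
    (Measurable.ite (measurableSet_singleton 0) measurable_const measurable_const)
  refine Measurable.pow_const ?_ _
  exact ENNReal.measurable_ofReal.comp ((measurable_norm.pow_const n).div measurable_det.abs)

/-- The linear map with prescribed values on the standard basis. -/
noncomputable def ofColumns (w : Fin n → Rn n) : Rn n →L[ℝ] Rn n :=
  ∑ i, (EuclideanSpace.proj i : Rn n →L[ℝ] ℝ).smulRight (w i)

lemma ofColumns_stdVec (w : Fin n → Rn n) (i : Fin n) : ofColumns w (stdVec i) = w i := by
  simp [ofColumns]

lemma norm_ofColumns_le (w : Fin n → Rn n) : ‖ofColumns w‖ ≤ ∑ i, ‖w i‖ := by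
  refine (norm_sum_le _ _).trans (Finset.sum_le_sum fun i _ => ?_)
  rw [ContinuousLinearMap.norm_smulRight_apply]
  refine mul_le_of_le_one_left (norm_nonneg _) ?_
  refine ContinuousLinearMap.opNorm_le_bound _ zero_le_one fun v => ?_
  rw [one_mul]
  exact PiLp.norm_apply_le v i

end Dilatation

/-! ### Affine minorants of Φ and polyconvex minorants of Φ ∘ `dilat`. -/

section ConvexFunctions

variable {Φ : ℝ≥0∞ → ℝ≥0∞}

lemma IsStrictlyConvex.exists_superlinear_bound (hΦ : IsStrictlyConvex Φ) {c : ℝ} (hc : 0 < c) :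
    ∃ t₀ : ℝ, 0 ≤ t₀ ∧ ∀ s : ℝ, ENNReal.ofReal (c * (s - t₀)) ≤ Φ (ENNReal.ofReal s) := by
  have h1 : ∀ᶠ t : ℝ in atTop, ENNReal.ofReal c < Φ (ENNReal.ofReal t) / ENNReal.ofReal t :=
    hΦ.superlinear.eventually_const_lt ENNReal.ofReal_lt_top
  obtain ⟨t₁, ht₁⟩ := eventually_atTop.mp h1
  refine ⟨max t₁ 1, by positivity, fun s => ?_⟩
  rcases le_total s (max t₁ 1) with h | h
  · rw [ENNReal.ofReal_of_nonpos (mul_nonpos_of_nonneg_of_nonpos hc.le (by linarith))]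
    exact bot_le
  · have hs : 0 < s := lt_of_lt_of_le (by positivity) h
    have h2 := (ht₁ s ((le_max_left _ _).trans h)).le
    rw [ENNReal.le_div_iff_mul_le (Or.inl (by simpa using hs)) (Or.inl ENNReal.ofReal_ne_top),
      ← ENNReal.ofReal_mul hc.le] at h2
    refine (ENNReal.ofReal_le_ofReal ?_).trans h2
    have : 0 ≤ max t₁ 1 := by positivity
    nlinarith

lemma IsStrictlyConvex.apply_top (hΦ : IsStrictlyConvex Φ) : Φ ⊤ = ⊤ := by
  obtain ⟨t₀, h0, h⟩ := hΦ.exists_superlinear_bound one_pos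
  refine ENNReal.eq_top_of_forall_nnreal_le fun r => ?_
  have h1 := h (r + t₀ + 1)
  have h2 : Φ (ENNReal.ofReal (r + t₀ + 1)) ≤ Φ ⊤ :=
    hΦ.mono (by
      rw [mem_Ici, ENNReal.one_le_ofReal]
      have := r.2
      have : (0 : ℝ) ≤ r := r.2
      linarith) (by simp) le_top
  refine le_trans ?_ (h1.trans h2)
  rw [← ENNReal.ofReal_coe_nnreal]
  exact ENNReal.ofReal_le_ofReal (by linarith)

/-- Three-point convexity with denominators cleared; the value at t enters through a real y below
it, so its finiteness need not be discussed. -/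
lemma IsStrictlyConvex.real_convex (hΦ : IsStrictlyConvex Φ) {a t b : ℝ} (ha : 1 ≤ a) (hat : a < t)
    (htb : t < b) (hfa : Φ (ENNReal.ofReal a) ≠ ⊤) (hfb : Φ (ENNReal.ofReal b) ≠ ⊤) {y : ℝ}
    (hy : ENNReal.ofReal y < Φ (ENNReal.ofReal t)) :
    (b - a) * y ≤ (b - t) * (Φ (ENNReal.ofReal a)).toReal + (t - a) * (Φ (ENNReal.ofReal b)).toReal := by
  have hba : 0 < b - a := by linarith
  set p : ℝ := (b - t) / (b - a) with hp
  set q : ℝ := (t - a) / (b - a) with hq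
  have hp0 : 0 ≤ p := div_nonneg (by linarith) hba.le
  have hq0 : 0 ≤ q := div_nonneg (by linarith) hba.le
  have hpq : p + q = 1 := by rw [hp, hq]; field_simp; ring
  have hcomb : p * a + q * b = t := by rw [hp, hq]; field_simp; ring
  have hain : ENNReal.ofReal a ∈ Ici (1 : ℝ≥0∞) := by simpa using ha
  have hbin : ENNReal.ofReal b ∈ Ici (1 : ℝ≥0∞) := by
    rw [mem_Ici, ENNReal.one_le_ofReal]
    linarith
  have hpq' : p.toNNReal + q.toNNReal = 1 := by
    rw [← Real.toNNReal_add hp0 hq0, hpq, Real.toNNReal_one]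
  have h1 := hΦ.convex.2 hain hbin (zero_le : 0 ≤ p.toNNReal) (zero_le : 0 ≤ q.toNNReal) hpq'
  have e : ∀ (r : ℝ) (z : ℝ≥0∞), r.toNNReal • z = ENNReal.ofReal r * z := fun r z => rfl
  rw [e, e, e, e, ← ENNReal.ofReal_mul hp0, ← ENNReal.ofReal_mul hq0, ← ENNReal.ofReal_add
    (mul_nonneg hp0 (by linarith)) (mul_nonneg hq0 (by linarith)), hcomb] at h1
  have h2 := hy.le.trans h1
  rw [← ENNReal.ofReal_toReal hfa, ← ENNReal.ofReal_toReal hfb, ← ENNReal.ofReal_mul hp0,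
    ← ENNReal.ofReal_mul hq0, ← ENNReal.ofReal_add (by positivity) (by positivity),
    ENNReal.ofReal_le_ofReal_iff (by positivity)] at h2
  have h3 : (b - a) * p = b - t := by rw [hp]; field_simp
  have h4 : (b - a) * q = t - a := by rw [hq]; field_simp
  calc (b - a) * y ≤ (b - a) * (p * (Φ (ENNReal.ofReal a)).toReal + q * (Φ (ENNReal.ofReal b)).toReal) := by
        gcongr
    _ = _ := by rw [mul_add, ← mul_assoc, ← mul_assoc, h3, h4]

/-- Either `Φ` is finite somewhere to the right of `t`, or `Φ > y` on a left neighbourhood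
of `t`. -/
lemma exists_left_bound (hmono : MonotoneOn Φ (Ici 1))
    (hΦT : LeftContAtFiniteSup Φ) {t y : ℝ} (ht : 1 ≤ t)
    (hy : ENNReal.ofReal y < Φ (ENNReal.ofReal t))
    (hr : ∀ s : ℝ, t < s → Φ (ENNReal.ofReal s) = ⊤) :
    ∃ η > 0, ∀ s : ℝ, 1 ≤ s → s < t → t - η < s → ENNReal.ofReal y ≤ Φ (ENNReal.ofReal s) := by
  have hT : finiteSup Φ ≤ ENNReal.ofReal t := by
    refine sSup_le fun s hs => ?_
    by_contra hlt
    push Not at hlt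
    obtain ⟨r, hr1, hr2⟩ := ENNReal.lt_iff_exists_real_btwn.mp hlt
    obtain ⟨hr2, hr3⟩ := hr2
    have htr : t < r := (ENNReal.ofReal_lt_ofReal_iff_of_nonneg (by linarith)).mp hr2
    have h1 : Φ (ENNReal.ofReal r) ≤ Φ s := hmono
      (by rw [mem_Ici, ENNReal.one_le_ofReal]; linarith) hs.1 hr3.le
    rw [hr r htr] at h1
    exact absurd hs.2 (not_lt.mpr h1)
  -- If T < t then Φ is infinite on (T, t). If T = t the bound is exactly left continuity at T. When
  -- Φ is infinite on all of [1, ∞], T is the supremum of the empty set, hence 0, and the first case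
  -- applies.
  rcases hT.lt_or_eq with hlt | heq
  · set T := (finiteSup Φ).toReal with hTd
    have hTfin : finiteSup Φ ≠ ⊤ := ne_top_of_lt hlt
    have hTt : T < t := by
      rw [← ENNReal.ofReal_toReal hTfin, ENNReal.ofReal_lt_ofReal_iff_of_nonneg
        ENNReal.toReal_nonneg] at hlt
      exact hlt
    refine ⟨t - T, by linarith, fun s hs1 _ hs3 => ?_⟩
    have : Φ (ENNReal.ofReal s) = ⊤ := by
      by_contra hne
      have h1 : ENNReal.ofReal s ≤ finiteSup Φ :=
        le_sSup ⟨by rw [ENNReal.one_le_ofReal]; exact hs1, lt_top_iff_ne_top.mpr hne⟩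
      have h2 := (ENNReal.ofReal_le_iff_le_toReal hTfin).mp h1
      linarith
    rw [this]
    exact le_top
  · have h1 : ∀ᶠ s in 𝓝[Icc 1 (finiteSup Φ)] finiteSup Φ, ENNReal.ofReal y < Φ s := by
      refine Tendsto.eventually_const_lt ?_ hΦT
      rw [heq]
      exact hy
    rw [heq] at h1
    have h2 : Tendsto ENNReal.ofReal (𝓝[Icc 1 t] t) (𝓝[Icc 1 (ENNReal.ofReal t)] ENNReal.ofReal t) := by
      refine tendsto_nhdsWithin_iff.mpr ⟨(ENNReal.continuous_ofReal.tendsto t).mono_left nhdsWithin_le_nhds, ?_⟩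
      filter_upwards [self_mem_nhdsWithin] with s hs
      exact ⟨by rw [ENNReal.one_le_ofReal]; exact hs.1, ENNReal.ofReal_le_ofReal hs.2⟩
    have h3 := h2.eventually h1
    rw [eventually_nhdsWithin_iff, Metric.eventually_nhds_iff] at h3
    obtain ⟨η, hη, h4⟩ := h3
    refine ⟨η, hη, fun s hs1 hs2 hs3 => (h4 (y := s) ?_ ⟨hs1, hs2.le⟩).le⟩
    rw [Real.dist_eq, abs_lt]
    constructor <;> linarith

/-- Through every point strictly below the graph of `Φ` passes a nondecreasing affine minorant. -/
theorem exists_affine_minorant (hΦ : IsStrictlyConvex Φ) (hΦT : LeftContAtFiniteSup Φ) {t y : ℝ}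
    (ht : 1 ≤ t) (hy0 : 0 ≤ y) (hy : ENNReal.ofReal y < Φ (ENNReal.ofReal t)) :
    ∃ a : ℝ, 0 ≤ a ∧ ∀ s : ℝ, 1 ≤ s → ENNReal.ofReal (y + a * (s - t)) ≤ Φ (ENNReal.ofReal s) := by
  set φ : ℝ → ℝ := fun s => (Φ (ENNReal.ofReal s)).toReal with hφ
  have hφ0 : ∀ s, 0 ≤ φ s := fun s => ENNReal.toReal_nonneg
  -- Slopes of chords from points of the graph left of t to (t, y). The least admissible slope is
  -- their supremum, and including 0 makes it nonnegative.
  set S : Set ℝ := {z | z = 0 ∨ ∃ s, 1 ≤ s ∧ s < t ∧ Φ (ENNReal.ofReal s) ≠ ⊤ ∧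
    z = (y - φ s) / (t - s)} with hS
  have h0S : (0 : ℝ) ∈ S := Or.inl rfl
  have hright : ∀ b, t < b → Φ (ENNReal.ofReal b) ≠ ⊤ → ∀ z ∈ S, z ≤ (φ b - y) / (b - t) := by
    rintro b hb hfb z (rfl | ⟨s, hs1, hs2, hs3, rfl⟩)
    · refine div_nonneg ?_ (by linarith)
      have h1 : ENNReal.ofReal y ≤ Φ (ENNReal.ofReal b) := hy.le.trans (hΦ.mono
        (by rw [mem_Ici, ENNReal.one_le_ofReal]; exact ht)
        (by rw [mem_Ici, ENNReal.one_le_ofReal]; linarith) (ENNReal.ofReal_le_ofReal hb.le))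
      have := (ENNReal.ofReal_le_iff_le_toReal hfb).mp h1
      linarith
    · have := hΦ.real_convex hs1 hs2 hb hs3 hfb hy
      rw [div_le_div_iff₀ (by linarith) (by linarith)]
      simp only [hφ]
      linarith
  have hbdd : BddAbove S := by
    by_cases hr : ∀ s : ℝ, t < s → Φ (ENNReal.ofReal s) = ⊤
    · obtain ⟨η, hη, hleft⟩ := exists_left_bound hΦ.mono hΦT ht hy hr
      -- A chord starting at distance at least η from t has slope at most y / η, since Φ ≥ 0; one
      -- starting closer has slope at most 0.
      refine ⟨y / η, ?_⟩
      rintro z (rfl | ⟨s, hs1, hs2, hs3, rfl⟩)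
      · positivity
      · rcases le_or_gt s (t - η) with h | h
        · have := hφ0 s
          rw [div_le_div_iff₀ (by linarith) hη]
          nlinarith
        · have h1 := (ENNReal.ofReal_le_iff_le_toReal hs3).mp (hleft s hs1 hs2 h)
          have : (y - φ s) / (t - s) ≤ 0 := div_nonpos_of_nonpos_of_nonneg (by simp only [hφ]; linarith)
            (by linarith)
          exact this.trans (by positivity)
    · push Not at hr
      obtain ⟨b, hb, hfb⟩ := hr
      exact ⟨_, hright b hb hfb⟩
  refine ⟨sSup S, le_csSup hbdd h0S, fun s hs => ?_⟩
  by_cases hfs : Φ (ENNReal.ofReal s) = ⊤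
  · rw [hfs]; exact le_top
  rcases lt_trichotomy s t with h | rfl | h
  · rw [ENNReal.ofReal_le_iff_le_toReal hfs]
    have h1 : (y - φ s) / (t - s) ≤ sSup S := le_csSup hbdd (Or.inr ⟨s, hs, h, hfs, rfl⟩)
    rw [div_le_iff₀ (by linarith)] at h1
    simp only [hφ] at h1
    linarith
  · simpa using hy.le
  · rw [ENNReal.ofReal_le_iff_le_toReal hfs]
    have h1 : sSup S ≤ (φ s - y) / (s - t) := csSup_le ⟨0, h0S⟩ (hright s h hfs)
    rw [le_div_iff₀ (by linarith)] at h1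
    simp only [hφ] at h1
    linarith

variable {n : ℕ}

/-- Polyconvexity of `Φ ∘ dilat`: strictly below the graph there is a minorant which is affine in
the matrix and its absolute determinant, and nonincreasing in the latter. -/
theorem exists_polyconvex_minorant (hn : 2 ≤ n) (hΦ : IsStrictlyConvex Φ)
    (hΦT : LeftContAtFiniteSup Φ) (A : Rn n →L[ℝ] Rn n) {y : ℝ} (hy0 : 0 ≤ y)
    (hy : ENNReal.ofReal y < Φ (dilat A)) :
    ∃ (L : (Rn n →L[ℝ] Rn n) →L[ℝ] ℝ) (c b : ℝ), 0 ≤ c ∧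
      (∀ B : Rn n →L[ℝ] Rn n, dilat B ≠ ⊤ →
        ENNReal.ofReal (L B - c * |B.det| + b) ≤ Φ (dilat B)) ∧
      y ≤ L A - c * |A.det| + b := by
  have hn' : (2 : ℝ) ≤ n := by exact_mod_cast hn
  have hn1 : (0 : ℝ) < n - 1 := by linarith
  have hone : ∀ B : Rn n →L[ℝ] Rn n, dilat B ≠ ⊤ → 1 ≤ (dilat B).toReal := by
    intro B hB
    have := one_le_dilat hn B
    rwa [← ENNReal.ofReal_toReal hB, ENNReal.one_le_ofReal] at this
  -- An affine minorant a r + β of Φ becomes a minorant in B: bound r = p from below by AM-GM and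
  -- then ‖B‖ by L₀ B, for a functional L₀ of norm 1.
  have general : ∀ (a s β : ℝ) (L₀ : (Rn n →L[ℝ] Rn n) →L[ℝ] ℝ), 0 ≤ a → 0 ≤ s → ‖L₀‖ = 1 →
      (∀ r : ℝ, 1 ≤ r → ENNReal.ofReal (a * r + β) ≤ Φ (ENNReal.ofReal r)) →
      ∀ B : Rn n →L[ℝ] Rn n, dilat B ≠ ⊤ →
        ENNReal.ofReal (((a * n * s / (n - 1)) • L₀) B - (a * s ^ n / (n - 1)) * |B.det| + β)
          ≤ Φ (dilat B) := by
    intro a s β L₀ ha hs hL₀ hmin B hB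
    have h1 := hmin _ (hone B hB)
    rw [ENNReal.ofReal_toReal hB] at h1
    refine (ENNReal.ofReal_le_ofReal ?_).trans h1
    have h2 := mul_norm_le_dilat hn hB hs
    have h3 : L₀ B ≤ ‖B‖ := by
      have := L₀.le_opNorm B
      rw [hL₀, one_mul] at this
      exact (le_abs_self _).trans this
    have h4 : ((a * n * s / (n - 1)) • L₀) B - (a * s ^ n / (n - 1)) * |B.det|
        = a / (n - 1) * (n * s * L₀ B - s ^ n * |B.det|) := by
      simp only [smul_apply, smul_eq_mul]
      field_simp
    have h5 : n * s * L₀ B ≤ n * s * ‖B‖ := mul_le_mul_of_nonneg_left h3 (by positivity)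
    have h6 : a / (n - 1) * (n * s * L₀ B - s ^ n * |B.det|)
        ≤ a / (n - 1) * ((n - 1) * (dilat B).toReal) :=
      mul_le_mul_of_nonneg_left (by linarith) (by positivity)
    have h7 : a / (n - 1) * ((n - 1) * (dilat B).toReal) = a * (dilat B).toReal := by
      field_simp
    linarith
  by_cases hA0 : A = 0
  · subst hA0
    have h1 : dilat (0 : Rn n →L[ℝ] Rn n) ≤ 1 := by
      unfold dilat
      split_ifs with h
      · have := abs_det_le_norm_pow (0 : Rn n →L[ℝ] Rn n)
        rw [norm_zero, zero_pow (by omega)] at this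
        exact absurd (abs_nonpos_iff.mp this) h
      · exact le_rfl
      · exact absurd rfl ‹¬ (0 : Rn n →L[ℝ] Rn n) = 0›
    refine ⟨0, 0, y, le_rfl, fun B _ => ?_, by simp⟩
    have h2 : Φ (dilat (0 : Rn n →L[ℝ] Rn n)) ≤ Φ (dilat B) :=
      hΦ.mono (one_le_dilat hn _) (one_le_dilat hn _) (h1.trans (one_le_dilat hn _))
    simpa using hy.le.trans h2
  obtain ⟨L₀, hL₀, hL₀A⟩ := exists_dual_vector ℝ A (norm_ne_zero_iff.mpr hA0)
  have hL₀A' : L₀ A = ‖A‖ := by simpa using hL₀A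
  have hApos : 0 < ‖A‖ := norm_pos_iff.mpr hA0
  by_cases hdet : A.det = 0
  · obtain ⟨t₀, ht0, hmin⟩ := hΦ.exists_superlinear_bound one_pos
    -- Here the dilatation is infinite and the determinant term vanishes at A, so the minorant at A
    -- grows linearly in s; this s makes it equal to y.
    set s : ℝ := (y + t₀) * (n - 1) / (n * ‖A‖) with hs
    have hs0 : 0 ≤ s := by positivity
    refine ⟨(1 * n * s / (n - 1)) • L₀, 1 * s ^ n / (n - 1), -t₀, by positivity,
      general 1 s (-t₀) L₀ zero_le_one hs0 hL₀ (fun r _ => ?_), ?_⟩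
    · rw [one_mul]
      have := hmin r
      rwa [one_mul, sub_eq_add_neg] at this
    · simp only [smul_apply, smul_eq_mul, hL₀A', hdet, abs_zero, mul_zero]
      have : 1 * n * s / (n - 1) * ‖A‖ = y + t₀ := by rw [hs]; field_simp
      linarith
  · have hfin : dilat A ≠ ⊤ := (dilat_ne_top_iff hn).mpr (Or.inl hdet)
    have hy' := hy
    rw [← ENNReal.ofReal_toReal hfin] at hy'
    obtain ⟨a, ha, hmin⟩ := exists_affine_minorant hΦ hΦT (hone A hfin) hy0 hy'
    obtain ⟨s, hs, hseq⟩ := exists_mul_norm_eq_dilat hn hdet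
    set p := (dilat A).toReal with hp
    refine ⟨(a * n * s / (n - 1)) • L₀, a * s ^ n / (n - 1), y - a * p, by positivity,
      general a s (y - a * p) L₀ ha hs.le hL₀ (fun r hr => ?_), ?_⟩
    · refine (le_of_eq ?_).trans (hmin r hr)
      congr 1
      ring
    · simp only [smul_apply, smul_eq_mul, hL₀A']
      have : a * n * s / (n - 1) * ‖A‖ - a * s ^ n / (n - 1) * |A.det|
          = a / (n - 1) * (n * s * ‖A‖ - s ^ n * |A.det|) := by field_simp
      rw [this, hseq]
      have : a / (n - 1) * ((n - 1) * p) = a * p := by field_simp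
      linarith

/-- The norm of the derivative is controlled by `Φ ∘ dilat` and the Jacobian with small
constants. -/
theorem exists_enorm_le_add (hn : 2 ≤ n) (hΦ : IsStrictlyConvex Φ) {ε : ℝ} (hε : 0 < ε) :
    ∃ N : ℝ, 0 ≤ N ∧ ∀ B : Rn n →L[ℝ] Rn n, dilat B ≠ ⊤ →
      ‖B‖ₑ ≤ ENNReal.ofReal N + ENNReal.ofReal ε * ENNReal.ofReal |B.det|
        + ENNReal.ofReal ε * Φ (dilat B) := by
  have hn' : (2 : ℝ) ≤ n := by exact_mod_cast hn
  -- Since n ≥ 2, this choice gives s^n ≤ s ε. The slope 1/(ε s) below gives p ≤ t₀ + ε s Φ(p), and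
  -- dividing AM-GM by n s leaves the coefficients ε and the constant t₀ / s.
  set s : ℝ := min ε 1 with hs
  have hs0 : 0 < s := lt_min hε one_pos
  obtain ⟨t₀, ht0, hmin⟩ := hΦ.exists_superlinear_bound (c := 1 / (ε * s)) (by positivity)
  refine ⟨t₀ / s, by positivity, fun B hB => ?_⟩
  by_cases hfin : Φ (dilat B) = ⊤
  · rw [hfin, ENNReal.mul_top (by simpa using hε), add_top]
    exact le_top
  have h1 := hmin (dilat B).toReal
  rw [ENNReal.ofReal_toReal hB, ENNReal.ofReal_le_iff_le_toReal hfin] at h1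
  have h2 := mul_norm_le_dilat hn hB hs0.le
  rw [← ENNReal.ofReal_toReal hfin, ← ENNReal.ofReal_mul hε.le, ← ENNReal.ofReal_mul hε.le,
    ← ENNReal.ofReal_add (by positivity) (by positivity),
    ← ENNReal.ofReal_add (by positivity) (by positivity), ← ofReal_norm]
  refine ENNReal.ofReal_le_ofReal ?_
  set p := (dilat B).toReal with hp
  set q := (Φ (dilat B)).toReal with hq
  have hp0 : 0 ≤ p := ENNReal.toReal_nonneg
  have h3 : p ≤ t₀ + ε * s * q := by
    rw [div_mul_eq_mul_div, one_mul, div_le_iff₀ (by positivity)] at h1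
    linarith
  have h4 : s ^ n ≤ s * ε := by
    have : s ^ n = s * s ^ (n - 1) := by rw [← pow_succ']; congr 1; omega
    rw [this]
    refine mul_le_mul_of_nonneg_left ?_ hs0.le
    refine (pow_le_of_le_one hs0.le (min_le_right _ _) (by omega)).trans (min_le_left _ _)
  have h5 : 0 ≤ |B.det| := abs_nonneg _
  have h6 : n * s * ‖B‖ ≤ n * (p + s * ε * |B.det|) := by
    have e1 : s ^ n * |B.det| ≤ s * ε * |B.det| := mul_le_mul_of_nonneg_right h4 h5
    have e2 : 0 ≤ ((n : ℝ) - 1) * (s * ε * |B.det|) := mul_nonneg (by linarith) (by positivity)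
    linarith
  have h7 : s * ‖B‖ ≤ p + s * ε * |B.det| := by
    have : (n : ℝ) * (s * ‖B‖) ≤ n * (p + s * ε * |B.det|) := by linarith
    exact le_of_mul_le_mul_left this (by linarith)
  have h8 : s * ‖B‖ ≤ s * (t₀ / s + ε * |B.det| + ε * q) := by
    have : s * (t₀ / s + ε * |B.det| + ε * q) = t₀ + s * ε * |B.det| + ε * s * q := by field_simp
    linarith
  exact le_of_mul_le_mul_left h8 hs0

end ConvexFunctions

/-! ### Weak L¹ limits of equi-integrable sequences. -/

section WeakLimits

variable {α : Type*} [MeasurableSpace α] {μ : Measure α}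

/-- Uniform integrability in the small-set formulation. -/
def SmallSetIntegrable {α E : Type*} [MeasurableSpace α] [NormedAddCommGroup E] (μ : Measure α)
    (u : ℕ → α → E) : Prop :=
  ∀ ε : ℝ, 0 < ε → ∃ δ : ℝ, 0 < δ ∧ ∀ k, ∀ S, MeasurableSet S → μ S ≤ ENNReal.ofReal δ →
    ∫⁻ x in S, ‖u k x‖ₑ ∂μ ≤ ENNReal.ofReal ε

lemma SmallSetIntegrable.norm_setIntegral_le {E : Type*} [NormedAddCommGroup E] [NormedSpace ℝ E]
    {u : ℕ → α → E} (h : SmallSetIntegrable μ u) {ε : ℝ} (hε : 0 < ε) :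
    ∃ δ : ℝ, 0 < δ ∧ ∀ k, ∀ S, MeasurableSet S → μ S ≤ ENNReal.ofReal δ →
      ‖∫ x in S, u k x ∂μ‖ ≤ ε := by
  obtain ⟨δ, hδ, H⟩ := h ε hε
  refine ⟨δ, hδ, fun k S hS hm => ?_⟩
  have h1 := (enorm_integral_le_lintegral_enorm (μ := μ.restrict S) (u k)).trans (H k S hS hm)
  rw [← ofReal_norm] at h1
  exact (ENNReal.ofReal_le_ofReal_iff hε.le).mp h1

lemma tendsto_measure_iUnion_sdiff_finset [IsFiniteMeasure μ] {s : ℕ → Set α}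
    (hs : ∀ i, MeasurableSet (s i)) (hd : Pairwise (Function.onFun Disjoint s)) :
    Tendsto (fun F : Finset ℕ => μ ((⋃ i, s i) \ ⋃ i ∈ F, s i)) atTop (𝓝 0) := by
  have h1 : ∀ F : Finset ℕ, μ ((⋃ i, s i) \ ⋃ i ∈ F, s i) = μ (⋃ i, s i) - ∑ i ∈ F, μ (s i) := by
    intro F
    rw [measure_sdiff (iUnion₂_subset fun i _ => subset_iUnion s i)
      (Finset.measurableSet_biUnion F fun i _ => hs i).nullMeasurableSet (measure_ne_top _ _),
      measure_biUnion_finset (fun i _ j _ hij => hd hij) fun i _ => hs i]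
  simp only [h1]
  have h2 : Tendsto (fun F : Finset ℕ => ∑ i ∈ F, μ (s i)) atTop (𝓝 (μ (⋃ i, s i))) := by
    rw [measure_iUnion hd hs]
    exact ENNReal.summable.hasSum
  have h3 := ENNReal.Tendsto.sub (tendsto_const_nhds (x := μ (⋃ i, s i))) h2
    (Or.inl (measure_ne_top _ _))
  simpa using h3

/-- If a uniformly integrable sequence has convergent integrals over all measurable sets, the
limits are the integrals of an integrable function. -/
theorem SmallSetIntegrable.exists_limit_density [IsFiniteMeasure μ] {u : ℕ → α → ℝ}
    (hu : ∀ k, Integrable (u k) μ) (h : SmallSetIntegrable μ u)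
    (hlim : ∀ S, MeasurableSet S → ∃ l, Tendsto (fun k => ∫ x in S, u k x ∂μ) atTop (𝓝 l)) :
    ∃ v : α → ℝ, Integrable v μ ∧ ∀ S, MeasurableSet S →
      Tendsto (fun k => ∫ x in S, u k x ∂μ) atTop (𝓝 (∫ x in S, v x ∂μ)) := by
  classical
  choose! l hl using hlim
  -- Smallness on small sets is uniform in k, so it survives in the limit; it gives both absolute
  -- continuity and countable additivity of l.
  have hsmall : ∀ ε : ℝ, 0 < ε → ∃ δ : ℝ, 0 < δ ∧ ∀ S, MeasurableSet S →
      μ S ≤ ENNReal.ofReal δ → |l S| ≤ ε := by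
    intro ε hε
    obtain ⟨δ, hδ, H⟩ := h.norm_setIntegral_le hε
    refine ⟨δ, hδ, fun S hS hm => ?_⟩
    exact le_of_tendsto (hl S hS).norm (Eventually.of_forall fun k => H k S hS hm)
  have hzero : ∀ S, MeasurableSet S → μ S = 0 → l S = 0 := by
    intro S hS hm
    refine abs_nonpos_iff.mp (le_of_forall_pos_le_add fun ε hε => ?_)
    obtain ⟨δ, _, H⟩ := hsmall ε hε
    simpa using H S hS (by simp [hm])
  have hsum : ∀ (s : ℕ → Set α), (∀ i, MeasurableSet (s i)) →
      Pairwise (Function.onFun Disjoint s) → HasSum (fun i => l (s i)) (l (⋃ i, s i)) := by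
    intro s hs hd
    -- Finite additivity passes to the limit, so the error of a partial sum is l of a remainder set
    -- whose measure tends to 0.
    have hdecomp : ∀ F : Finset ℕ, l (⋃ i, s i) - ∑ i ∈ F, l (s i) = l ((⋃ i, s i) \ ⋃ i ∈ F, s i) := by
      intro F
      have hFm := Finset.measurableSet_biUnion F fun i _ => hs i
      have t1 := (hl _ (MeasurableSet.iUnion hs)).sub
        (tendsto_finsetSum F fun i _ => hl (s i) (hs i))
      have t2 := hl _ ((MeasurableSet.iUnion hs).diff hFm)
      refine tendsto_nhds_unique t1 (t2.congr fun k => ?_)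
      have e1 := setIntegral_sdiff (f := u k) (μ := μ) hFm (hu k).integrableOn
        (iUnion₂_subset fun i (_ : i ∈ F) => subset_iUnion s i)
      rw [e1, integral_biUnion_finset F (fun i _ => hs i) (fun i _ j _ hij => hd hij)
        fun i _ => (hu k).integrableOn]
    unfold HasSum
    rw [Metric.tendsto_nhds]
    intro ε hε
    obtain ⟨δ, hδ, H⟩ := hsmall (ε / 2) (by positivity)
    have h1 := (tendsto_measure_iUnion_sdiff_finset (μ := μ) hs hd).eventually_lt_const
      (ENNReal.ofReal_pos.mpr hδ)
    simp only [SummationFilter.unconditional_filter]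
    filter_upwards [h1] with F hF
    rw [dist_comm, Real.dist_eq, hdecomp]
    have := H _ ((MeasurableSet.iUnion hs).diff (Finset.measurableSet_biUnion F fun i _ => hs i)) hF.le
    linarith
  let ν : SignedMeasure α :=
    { measureOf' := fun S => if MeasurableSet S then l S else 0
      empty' := by simpa using hzero ∅ MeasurableSet.empty measure_empty
      not_measurable' := fun S hS => if_neg hS
      m_iUnion' := fun s hs hd => by
        simp only [hs, MeasurableSet.iUnion hs, if_true]
        exact hsum s hs hd }
  have hν : ∀ S, MeasurableSet S → ν S = l S := fun S hS => if_pos hS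
  have hac : ν ≪ᵥ μ.toENNRealVectorMeasure := by
    intro S hS
    by_cases hSm : MeasurableSet S
    · rw [Measure.toENNRealVectorMeasure_apply_measurable hSm] at hS
      rw [hν S hSm, hzero S hSm hS]
    · exact ν.not_measurable hSm
  have hrn := (SignedMeasure.absolutelyContinuous_iff_withDensityᵥ_rnDeriv_eq ν μ).mp hac
  refine ⟨ν.rnDeriv μ, SignedMeasure.integrable_rnDeriv _ _, fun S hS => ?_⟩
  rw [← withDensityᵥ_apply (SignedMeasure.integrable_rnDeriv _ _) hS, hrn, hν S hS]
  exact hl S hS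

variable {n : ℕ}

lemma SmallSetIntegrable.exists_limit_density_vector [IsFiniteMeasure μ] {u : ℕ → α → Rn n}
    (hu : ∀ k, Integrable (u k) μ) (h : SmallSetIntegrable μ u)
    (hlim : ∀ S, MeasurableSet S → ∃ l, Tendsto (fun k => ∫ x in S, u k x ∂μ) atTop (𝓝 l)) :
    ∃ v : α → Rn n, Integrable v μ ∧ ∀ S, MeasurableSet S →
      Tendsto (fun k => ∫ x in S, u k x ∂μ) atTop (𝓝 (∫ x in S, v x ∂μ)) := by
  have hcomp : ∀ (w : α → Rn n), Integrable w μ → ∀ S (m : Fin n),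
      (∫ x in S, w x ∂μ) m = ∫ x in S, w x m ∂μ := by
    intro w hw S m
    exact ((EuclideanSpace.proj m : Rn n →L[ℝ] ℝ).integral_comp_comm hw.integrableOn).symm
  have hcompi : ∀ (w : α → Rn n), Integrable w μ → ∀ m : Fin n, Integrable (fun x => w x m) μ :=
    fun w hw m => (EuclideanSpace.proj m : Rn n →L[ℝ] ℝ).integrable_comp hw
  have key : ∀ m : Fin n, ∃ v : α → ℝ, Integrable v μ ∧ ∀ S, MeasurableSet S →
      Tendsto (fun k => ∫ x in S, u k x m ∂μ) atTop (𝓝 (∫ x in S, v x ∂μ)) := by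
    intro m
    refine SmallSetIntegrable.exists_limit_density (fun k => hcompi _ (hu k) m) ?_ ?_
    · intro ε hε
      obtain ⟨δ, hδ, H⟩ := h ε hε
      refine ⟨δ, hδ, fun k S hS hm => le_trans (lintegral_mono fun x => ?_) (H k S hS hm)⟩
      simp only
      rw [← ofReal_norm, ← ofReal_norm]
      exact ENNReal.ofReal_le_ofReal (PiLp.norm_apply_le (u k x) m)
    · intro S hS
      obtain ⟨l, hl⟩ := hlim S hS
      refine ⟨l m, ?_⟩
      have := ((EuclideanSpace.proj m : Rn n →L[ℝ] ℝ).continuous.tendsto l).comp hl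
      refine this.congr fun k => ?_
      exact hcomp _ (hu k) S m
  choose v hv hvl using key
  have hvi : Integrable (fun x => (WithLp.toLp 2 fun m => v m x : Rn n)) μ := by
    have : (fun x => (WithLp.toLp 2 fun m => v m x : Rn n))
        = fun x => ∑ m, v m x • (stdVec m : Rn n) := by
      ext x j
      simp [Finset.sum_apply, Pi.single_apply]
    rw [this]
    exact integrable_finsetSum _ fun m _ => (hv m).smul_const _
  refine ⟨fun x => WithLp.toLp 2 fun m => v m x, hvi, fun S hS => ?_⟩
  have h2 : Tendsto (fun k => (WithLp.ofLp (∫ x in S, u k x ∂μ) : Fin n → ℝ)) atTop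
      (𝓝 (WithLp.ofLp (∫ x in S, (WithLp.toLp 2 fun m => v m x : Rn n) ∂μ))) := by
    rw [tendsto_pi_nhds]
    intro m
    have e1 : (∫ x in S, (WithLp.toLp 2 fun m => v m x : Rn n) ∂μ) m = ∫ x in S, v m x ∂μ :=
      hcomp _ hvi S m
    rw [e1]
    exact (hvl m S hS).congr fun k => (hcomp _ (hu k) S m).symm
  have h3 := ((PiLp.continuous_toLp 2 fun _ : Fin n => ℝ).tendsto _).comp h2
  exact h3

/-- Round the values down to multiples of ε; boundedness leaves finitely many of them. -/
lemma exists_simpleFunc_approx {φ : α → ℝ} (hφ : Measurable φ) {M : ℝ} (hM : ∀ x, |φ x| ≤ M)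
    {ε : ℝ} (hε : 0 < ε) : ∃ s : SimpleFunc α ℝ, ∀ x, |φ x - s x| ≤ ε := by
  have hfl : Measurable fun x => ⌊φ x / ε⌋ := (hφ.div_const ε).floor
  have hr : (range fun x => ε * (⌊φ x / ε⌋ : ℝ)).Finite := by
    refine ((Set.finite_Icc ⌊-M / ε⌋ ⌊M / ε⌋).image fun z : ℤ => ε * (z : ℝ)).subset ?_
    rintro _ ⟨x, rfl⟩
    refine ⟨⌊φ x / ε⌋, ⟨Int.floor_le_floor ?_, Int.floor_le_floor ?_⟩, rfl⟩
    · exact div_le_div_of_nonneg_right (abs_le.mp (hM x)).1 hε.le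
    · exact div_le_div_of_nonneg_right (abs_le.mp (hM x)).2 hε.le
  have hm : Measurable fun x => ε * (⌊φ x / ε⌋ : ℝ) :=
    ((measurable_of_countable fun z : ℤ => (z : ℝ)).comp hfl).const_mul ε
  refine ⟨⟨fun x => ε * (⌊φ x / ε⌋ : ℝ), fun y => hm (measurableSet_singleton y), hr⟩, fun x => ?_⟩
  show |φ x - ε * (⌊φ x / ε⌋ : ℝ)| ≤ ε
  have h1 : φ x - ε * (⌊φ x / ε⌋ : ℝ) = ε * Int.fract (φ x / ε) := by
    rw [Int.fract, mul_sub, mul_div_cancel₀ _ hε.ne']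
  rw [h1, abs_of_nonneg (mul_nonneg hε.le (Int.fract_nonneg _))]
  exact mul_le_of_le_one_right hε.le (Int.fract_lt_one _).le

/-- Convergence of the integrals over all measurable sets, for a bounded sequence in `L¹`, implies
convergence against all bounded measurable functions. -/
theorem tendsto_integral_smul_of_setIntegral {u : ℕ → α → Rn n} {v : α → Rn n}
    (hu : ∀ k, Integrable (u k) μ) (hv : Integrable v μ) {B : ℝ} (hB : ∀ k, ∫ x, ‖u k x‖ ∂μ ≤ B)
    (h : ∀ S, MeasurableSet S →
      Tendsto (fun k => ∫ x in S, u k x ∂μ) atTop (𝓝 (∫ x in S, v x ∂μ)))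
    {φ : α → ℝ} (hφ : Measurable φ) {M : ℝ} (hM : ∀ x, |φ x| ≤ M) :
    Tendsto (fun k => ∫ x, φ x • u k x ∂μ) atTop (𝓝 (∫ x, φ x • v x ∂μ)) := by
  have hsm : ∀ (s : SimpleFunc α ℝ) (w : α → Rn n), Integrable w μ →
      Integrable (fun x => s x • w x) μ := by
    intro s w hw
    obtain ⟨C, hC⟩ := s.exists_forall_norm_le
    exact hw.bdd_smul C s.aestronglyMeasurable (Eventually.of_forall hC)
  have hsimple : ∀ s : SimpleFunc α ℝ,
      Tendsto (fun k => ∫ x, s x • u k x ∂μ) atTop (𝓝 (∫ x, s x • v x ∂μ)) := by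
    intro s
    induction s using SimpleFunc.induction with
    | const c hS =>
      rename_i S
      have e : ∀ w : α → Rn n, ∫ x, (SimpleFunc.piecewise S hS (SimpleFunc.const α c)
          (SimpleFunc.const α 0)) x • w x ∂μ = c • ∫ x in S, w x ∂μ := by
        intro w
        rw [← integral_smul, ← integral_indicator hS]
        refine integral_congr_ae (Eventually.of_forall fun x => ?_)
        by_cases hx : x ∈ S <;> simp [hx, SimpleFunc.piecewise_apply]
      simp only [e]
      exact (h S hS).const_smul c
    | @add f g _ hf hg =>
      have e : ∀ w : α → Rn n, Integrable w μ →
          ∫ x, (f + g) x • w x ∂μ = (∫ x, f x • w x ∂μ) + ∫ x, g x • w x ∂μ := by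
        intro w hw
        rw [← integral_add (hsm f w hw) (hsm g w hw)]
        simp [add_smul]
      rw [e v hv]
      exact (hf.add hg).congr fun k => (e _ (hu k)).symm
  have hφi : ∀ w : α → Rn n, Integrable w μ → Integrable (fun x => φ x • w x) μ := fun w hw =>
    hw.bdd_smul M hφ.aestronglyMeasurable (Eventually.of_forall hM)
  have hdiff : ∀ (w : α → Rn n), Integrable w μ → ∀ (s : SimpleFunc α ℝ) (ε : ℝ),
      (∀ x, |φ x - s x| ≤ ε) →
      ‖(∫ x, φ x • w x ∂μ) - ∫ x, s x • w x ∂μ‖ ≤ ε * ∫ x, ‖w x‖ ∂μ := by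
    intro w hw s ε hs
    rw [← integral_sub (hφi w hw) (hsm s w hw), ← integral_const_mul]
    refine norm_integral_le_of_norm_le (hw.norm.const_mul ε) (Eventually.of_forall fun x => ?_)
    rw [← sub_smul, norm_smul]
    exact mul_le_mul_of_nonneg_right (hs x) (norm_nonneg _)
  set B' : ℝ := max B (∫ x, ‖v x‖ ∂μ) with hB'
  have hB0 : 0 ≤ B' := le_max_of_le_right (integral_nonneg fun x => norm_nonneg _)
  rw [Metric.tendsto_nhds]
  intro ε hε
  -- Replacing φ by s costs at most η B' ≤ ε/4 on each side, leaving ε/2 for the simple function.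
  set η : ℝ := ε / (4 * (B' + 1)) with hη
  have hη0 : 0 < η := by positivity
  have hηB : η * B' ≤ ε / 4 := by
    rw [hη, div_mul_eq_mul_div, div_le_div_iff₀ (by positivity) (by positivity)]
    nlinarith
  obtain ⟨s, hs⟩ := exists_simpleFunc_approx hφ hM hη0
  filter_upwards [Metric.tendsto_nhds.mp (hsimple s) (ε / 2) (by positivity)] with k hk
  have h1 := (hdiff _ (hu k) s η hs).trans
    (mul_le_mul_of_nonneg_left ((hB k).trans (le_max_left B (∫ x, ‖v x‖ ∂μ))) hη0.le)
  have h2 := (hdiff _ hv s η hs).trans (mul_le_mul_of_nonneg_left (le_max_right B (∫ x, ‖v x‖ ∂μ)) hη0.le)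
  rw [← dist_eq_norm] at h1 h2
  rw [dist_comm] at h2
  calc dist (∫ x, φ x • u k x ∂μ) (∫ x, φ x • v x ∂μ)
      ≤ dist (∫ x, φ x • u k x ∂μ) (∫ x, s x • u k x ∂μ)
        + dist (∫ x, s x • u k x ∂μ) (∫ x, s x • v x ∂μ)
        + dist (∫ x, s x • v x ∂μ) (∫ x, φ x • v x ∂μ) := dist_triangle4 _ _ _ _
    _ < ε := by linarith

end WeakLimits

/-! ### Weak partial derivatives of locally uniform limits. -/

section SobolevLimits

variable {n : ℕ}

lemma exists_smooth_cutoff {K V : Set (Rn n)} (hK : IsCompact K) (hV : IsOpen V) (hKV : K ⊆ V) :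
    ∃ χ : Rn n → ℝ, ContDiff ℝ ∞ χ ∧ HasCompactSupport χ ∧ tsupport χ ⊆ V ∧ EqOn χ 1 K ∧
      ∀ x, χ x ∈ Icc (0 : ℝ) 1 := by
  obtain ⟨L, hL, hKL, hLV⟩ := exists_compact_between hK hV hKV
  have hd : Disjoint (interior L)ᶜ K := by
    rw [Set.disjoint_left]
    exact fun x hx hxK => hx (hKL hxK)
  obtain ⟨χ, h0, h1, h01⟩ := exists_contMDiffMap_zero_one_of_isClosed (n := ⊤)
    (modelWithCornersSelf ℝ (Rn n)) isOpen_interior.isClosed_compl hK.isClosed hd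
  have hsub : tsupport χ ⊆ L := by
    refine closure_minimal (fun x hx => ?_) hL.isClosed
    by_contra hxL
    exact hx (h0 fun h => hxL (interior_subset h))
  exact ⟨χ, χ.contMDiff.contDiff, hL.of_isClosed_subset (isClosed_tsupport _) hsub,
    hsub.trans hLV, h1, h01⟩

lemma tendsto_integral_smul_of_uniform {Ω : Set (Rn n)}
    {f : ℕ → Rn n → Rn n} {g : Rn n → Rn n} (hf : ∀ k, ContinuousOn (f k) Ω)
    (hlim : TendstoLocallyUniformlyOn f g atTop Ω) {ψ : Rn n → ℝ} (hψ : Continuous ψ)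
    (hc : HasCompactSupport ψ) (hs : tsupport ψ ⊆ Ω) :
    Tendsto (fun k => ∫ x, ψ x • f k x) atTop (𝓝 (∫ x, ψ x • g x)) := by
  have hg : ContinuousOn g Ω := hlim.continuousOn (Frequently.of_forall hf)
  set C := tsupport ψ with hC
  have hCc : IsCompact C := hc
  obtain ⟨M, hM⟩ := hc.exists_bound_of_continuous hψ
  have hM0 : 0 ≤ M := (norm_nonneg _).trans (hM 0)
  have hunif : TendstoUniformlyOn f g atTop C :=
    (tendstoLocallyUniformlyOn_iff_tendstoUniformlyOn_of_compact hCc).mp (hlim.mono hs)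
  have hi : ∀ w : Rn n → Rn n, ContinuousOn w Ω → IntegrableOn (fun x => ψ x • w x) C := fun w hw =>
    (hψ.continuousOn.smul (hw.mono hs)).integrableOn_compact hCc
  have he : ∀ w : Rn n → Rn n, ∫ x, ψ x • w x = ∫ x in C, ψ x • w x := fun w =>
    (setIntegral_smul_eq_integral w fun x hx => subset_tsupport ψ hx).symm
  simp only [he]
  rw [Metric.tendsto_nhds]
  intro ε hε
  set V : ℝ := volume.real C with hV
  have hV0 : 0 ≤ V := measureReal_nonneg
  set η : ℝ := ε / (2 * (M + 1) * (V + 1)) with hη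
  have hη0 : 0 < η := by positivity
  filter_upwards [Metric.tendstoUniformlyOn_iff.mp hunif η hη0] with k hk
  rw [dist_eq_norm, ← integral_sub (hi _ (hf k)) (hi _ hg)]
  have h1 : ‖∫ x in C, (ψ x • f k x - ψ x • g x)‖ ≤ (M * η) * V := by
    refine norm_setIntegral_le_of_norm_le_const hCc.measure_lt_top fun x hx => ?_
    rw [← smul_sub, norm_smul]
    have := hk x hx
    rw [dist_comm, dist_eq_norm] at this
    exact mul_le_mul (hM x) this.le (norm_nonneg _) hM0
  refine h1.trans_lt ?_
  have h2 : (M * η) * V = ε * (M / (M + 1) * (V / (V + 1))) / 2 := by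
    rw [hη]; field_simp
  have h3 : M / (M + 1) * (V / (V + 1)) ≤ 1 :=
    mul_le_one₀ ((div_le_one (by linarith)).mpr (by linarith)) (by positivity)
      ((div_le_one (by linarith)).mpr (by linarith))
  rw [h2]
  nlinarith

lemma IsWeakPartial.integral_smul_eq {Ω : Set (Rn n)} {i : Fin n} {f u : Rn n → Rn n}
    (h : IsWeakPartial Ω i f u) {φ : Rn n → ℝ} (h1 : ContDiff ℝ ∞ φ) (h2 : HasCompactSupport φ)
    (h3 : tsupport φ ⊆ Ω) : ∫ x, φ x • u x = - ∫ x, fderiv ℝ φ x (stdVec i) • f x := by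
  have := h.integral_eq φ h1 h2 h3
  rw [setIntegral_smul_eq_integral _ fun x hx => h3 (fderiv_ne_zero_mem_tsupport hx),
    setIntegral_smul_eq_integral _ fun x hx => h3 (subset_tsupport φ hx)] at this
  rw [this, neg_neg]

/-- The derivative is moved onto φ, after which uniform convergence on the support of φ suffices. -/
lemma tendsto_integral_smul_weakPartial {Ω : Set (Rn n)} {i : Fin n}
    {f u : ℕ → Rn n → Rn n} {g : Rn n → Rn n} (hf : ∀ k, ContinuousOn (f k) Ω)
    (hlim : TendstoLocallyUniformlyOn f g atTop Ω) (hu : ∀ k, IsWeakPartial Ω i (f k) (u k))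
    {φ : Rn n → ℝ} (h1 : ContDiff ℝ ∞ φ) (h2 : HasCompactSupport φ) (h3 : tsupport φ ⊆ Ω) :
    Tendsto (fun k => ∫ x, φ x • u k x) atTop (𝓝 (-∫ x, fderiv ℝ φ x (stdVec i) • g x)) := by
  have hφ1 : ContDiff ℝ 1 φ := h1.of_le (by exact_mod_cast le_top)
  have hc : Continuous fun x => fderiv ℝ φ x (stdVec i) :=
    (hφ1.continuous_fderiv one_ne_zero).clm_apply continuous_const
  refine (tendsto_integral_smul_of_uniform hf hlim hc (h2.fderiv_apply (𝕜 := ℝ) _)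
    ((tsupport_fderiv_apply_subset ℝ (stdVec i)).trans h3)).neg.congr fun k => ?_
  exact ((hu k).integral_smul_eq h1 h2 h3).symm

/-- Replace the indicator of S by a smooth cutoff χ equal to 1 on a compact K ⊆ S and supported in
an open V ⊇ S. They differ only on V \ K, which is small, so equi-integrability makes the error
uniform in k and the Cauchy property is inherited from the integrals against χ. -/
lemma exists_tendsto_setIntegral_weakPartial {Ω : Set (Rn n)} {i : Fin n}
    {f u : ℕ → Rn n → Rn n} {g : Rn n → Rn n} (hf : ∀ k, ContinuousOn (f k) Ω)
    (hlim : TendstoLocallyUniformlyOn f g atTop Ω) (hu : ∀ k, IsWeakPartial Ω i (f k) (u k))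
    {C : Set (Rn n)} (hC : IsCompact C) (hCΩ : C ⊆ Ω) (hUI : SmallSetIntegrable (volume.restrict C) u)
    {S : Set (Rn n)} (hS : MeasurableSet S) (hSC : S ⊆ interior C) :
    ∃ l, Tendsto (fun k => ∫ x in S, u k x) atTop (𝓝 l) := by
  have hSC' : S ⊆ C := hSC.trans interior_subset
  have hSfin : volume S ≠ ⊤ := ((measure_mono hSC').trans_lt hC.measure_lt_top).ne
  have hui : ∀ k, IntegrableOn (u k) C := fun k =>
    (hu k).locInt_deriv.integrableOn_compact_subset hCΩ hC
  refine cauchySeq_tendsto_of_complete ?_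
  rw [Metric.cauchySeq_iff']
  intro ε hε
  obtain ⟨δ, hδ, H⟩ := hUI (ε / 8) (by positivity)
  have hδ2 : ENNReal.ofReal (δ / 2) ≠ 0 := by simpa using hδ
  obtain ⟨K, hKS, hK, hKδ⟩ := hS.exists_isCompact_sdiff_lt hSfin hδ2
  obtain ⟨V', hSV, hV'o, _, hVδ⟩ := hS.exists_isOpen_sdiff_lt hSfin hδ2
  set V := V' ∩ interior C with hV
  have hVC : V ⊆ C := inter_subset_right.trans interior_subset
  have hVo : IsOpen V := hV'o.inter isOpen_interior
  have hSV' : S ⊆ V := subset_inter hSV hSC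
  obtain ⟨χ, hχ1, hχ2, hχV, hχK, hχ01⟩ := exists_smooth_cutoff hK hVo (hKS.trans hSV')
  set W := V \ K with hW
  have hWm : MeasurableSet W := hVo.measurableSet.diff hK.measurableSet
  have hWC : W ⊆ C := sdiff_subset.trans hVC
  have hWδ : (volume.restrict C) W ≤ ENNReal.ofReal δ := by
    rw [Measure.restrict_apply hWm]
    have : W ∩ C ⊆ (V' \ S) ∪ (S \ K) := by
      rintro x ⟨⟨hx1, hx2⟩, _⟩
      by_cases hxS : x ∈ S
      · exact Or.inr ⟨hxS, hx2⟩
      · exact Or.inl ⟨hx1.1, hxS⟩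
    calc volume (W ∩ C) ≤ volume (V' \ S) + volume (S \ K) :=
          (measure_mono this).trans (measure_union_le _ _)
      _ ≤ ENNReal.ofReal (δ / 2) + ENNReal.ofReal (δ / 2) := add_le_add hVδ.le hKδ.le
      _ = ENNReal.ofReal δ := by
          rw [← ENNReal.ofReal_add (by positivity) (by positivity)]
          congr 1; ring
  have happ : ∀ k, ‖(∫ x in S, u k x) - ∫ x, χ x • u k x‖ ≤ ε / 8 := by
    intro k
    have e1 : ∫ x in S, u k x = ∫ x in C, S.indicator (u k) x := by
      rw [setIntegral_indicator hS, inter_eq_self_of_subset_right hSC']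
    have e2 : ∫ x, χ x • u k x = ∫ x in C, χ x • u k x :=
      (setIntegral_smul_eq_integral _ fun x hx => hVC (hχV (subset_tsupport χ hx))).symm
    have i2 : IntegrableOn (fun x => χ x • u k x) C :=
      (hui k).bdd_smul 1 hχ1.continuous.aestronglyMeasurable (Eventually.of_forall fun x => by
        rw [Real.norm_eq_abs, abs_of_nonneg (hχ01 x).1]; exact (hχ01 x).2)
    rw [e1, e2, ← integral_sub ((hui k).indicator hS) i2]
    have h1 : ‖∫ x in C, (S.indicator (u k) x - χ x • u k x)‖ₑ ≤ ENNReal.ofReal (ε / 8) := by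
      refine (enorm_integral_le_lintegral_enorm _).trans (le_trans ?_ (H k W hWm hWδ))
      rw [← lintegral_indicator hWm]
      refine lintegral_mono fun x => ?_
      by_cases hxW : x ∈ W
      · rw [indicator_of_mem hxW]
        have hcoef : S.indicator (u k) x - χ x • u k x = (S.indicator (fun _ => (1 : ℝ)) x - χ x) • u k x := by
          by_cases hxS : x ∈ S <;> simp [hxS, sub_smul]
        have hle : ‖S.indicator (fun _ => (1 : ℝ)) x - χ x‖ ≤ 1 := by
          have := hχ01 x
          rw [Real.norm_eq_abs, abs_le]
          by_cases hxS : x ∈ S <;> simp [hxS] <;> constructor <;> linarith [this.1, this.2]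
        rw [hcoef, enorm_smul]
        refine mul_le_of_le_one_left' ?_
        rw [← ofReal_norm]
        exact ENNReal.ofReal_le_one.mpr hle
      · rw [indicator_of_notMem hxW]
        by_cases hxV : x ∈ V
        · have hxK : x ∈ K := by
            by_contra h'
            exact hxW ⟨hxV, h'⟩
          simp [hKS hxK, hχK hxK]
        · have hχ0 : χ x = 0 := by
            by_contra h'
            exact hxV (hχV (subset_tsupport χ h'))
          have hxS : x ∉ S := fun h' => hxV (hSV' h')
          simp [hxS, hχ0]
    rw [← ofReal_norm] at h1
    exact (ENNReal.ofReal_le_ofReal_iff (by positivity)).mp h1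
  have hconv := tendsto_integral_smul_weakPartial hf hlim hu hχ1 hχ2
    (hχV.trans (hVC.trans hCΩ))
  obtain ⟨N, hN⟩ := Metric.cauchySeq_iff'.mp hconv.cauchySeq (ε / 2) (by positivity)
  refine ⟨N, fun k hk => ?_⟩
  have a1 := happ k
  have a2 := happ N
  rw [← dist_eq_norm] at a1 a2
  rw [dist_comm] at a2
  have a3 := dist_triangle4 (∫ x in S, u k x) (∫ x, χ x • u k x) (∫ x, χ x • u N x) (∫ x in S, u N x)
  have a4 := hN k hk
  linarith

/-- Weak `L¹` compactness: if continuous Sobolev maps converge locally uniformly and their weak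
partial derivatives are bounded and uniformly integrable on compact sets, then the classical partial
derivative of the limit is its weak partial derivative and the weak limit of the derivatives. -/
theorem weakPartial_of_smallSetIntegrable {Ω : Set (Rn n)} (hΩ : IsOpen Ω) {i : Fin n}
    {f u : ℕ → Rn n → Rn n} {g : Rn n → Rn n} (hf : ∀ k, ContinuousOn (f k) Ω)
    (hlim : TendstoLocallyUniformlyOn f g atTop Ω) (hu : ∀ k, IsWeakPartial Ω i (f k) (u k))
    (hUI : ∀ C, IsCompact C → C ⊆ Ω → SmallSetIntegrable (volume.restrict C) u)
    (hbd : ∀ C, IsCompact C → C ⊆ Ω → ∃ B : ℝ, ∀ k, ∫ x in C, ‖u k x‖ ≤ B) :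
    IsWeakPartial Ω i g (fun x => lineDeriv ℝ g x (stdVec i)) ∧
    ∀ C, IsCompact C → C ⊆ Ω → ∀ φ : Rn n → ℝ, Measurable φ → (∃ M : ℝ, ∀ x, |φ x| ≤ M) →
      Tendsto (fun k => ∫ x in C, φ x • u k x) atTop
        (𝓝 (∫ x in C, φ x • lineDeriv ℝ g x (stdVec i))) := by
  have hg : ContinuousOn g Ω := hlim.continuousOn (Frequently.of_forall hf)
  have hui : ∀ C, IsCompact C → C ⊆ Ω → ∀ k, IntegrableOn (u k) C := fun C hC hCΩ k =>
    (hu k).locInt_deriv.integrableOn_compact_subset hCΩ hC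
  have local_limit : ∀ C, IsCompact C → C ⊆ Ω →
      IntegrableOn (fun x => lineDeriv ℝ g x (stdVec i)) C ∧
      ∀ φ : Rn n → ℝ, Measurable φ → (∃ M : ℝ, ∀ x, |φ x| ≤ M) →
      Tendsto (fun k => ∫ x in C, φ x • u k x) atTop
        (𝓝 (∫ x in C, φ x • lineDeriv ℝ g x (stdVec i))) := by
    intro C hC hCΩ
    -- Two margins: the weak derivative is identified on the interior of C₁ ⊇ C, and sets inside C₁
    -- need room in C₂ for smooth cutoffs.
    obtain ⟨C₁, hC₁, hCC₁, hC₁Ω⟩ := exists_compact_between hC hΩ hCΩ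
    obtain ⟨C₂, hC₂, hC₁C₂, hC₂Ω⟩ := exists_compact_between hC₁ hΩ hC₁Ω
    have : IsFiniteMeasure (volume.restrict C₁) := ⟨by simpa using hC₁.measure_lt_top⟩
    obtain ⟨v, hv, hvl⟩ := SmallSetIntegrable.exists_limit_density_vector
      (μ := volume.restrict C₁) (hui C₁ hC₁ hC₁Ω) (hUI C₁ hC₁ hC₁Ω) (fun S hS => by
        rw [Measure.restrict_restrict hS]
        exact exists_tendsto_setIntegral_weakPartial hf hlim hu hC₂ hC₂Ω (hUI C₂ hC₂ hC₂Ω)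
          (hS.inter hC₁.measurableSet) (inter_subset_right.trans hC₁C₂))
    obtain ⟨B, hB⟩ := hbd C₁ hC₁ hC₁Ω
    have hw : ∀ φ : Rn n → ℝ, Measurable φ → (∃ M : ℝ, ∀ x, |φ x| ≤ M) →
        Tendsto (fun k => ∫ x in C₁, φ x • u k x) atTop (𝓝 (∫ x in C₁, φ x • v x)) :=
      fun φ hφ ⟨M, hM⟩ => tendsto_integral_smul_of_setIntegral (hui C₁ hC₁ hC₁Ω) hv hB hvl hφ hM
    have hvw : IsWeakPartial (interior C₁) i g v := by
      refine ⟨(hg.mono (interior_subset.trans hC₁Ω)).locallyIntegrableOn isOpen_interior.measurableSet,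
        (IntegrableOn.locallyIntegrableOn hv).mono_set interior_subset, fun φ h1 h2 h3 => ?_⟩
      rw [setIntegral_smul_eq_integral _ fun x hx => h3 (fderiv_ne_zero_mem_tsupport hx),
        setIntegral_smul_eq_integral _ fun x hx => h3 (subset_tsupport φ hx)]
      have t1 := tendsto_integral_smul_weakPartial hf hlim hu h1 h2
        (h3.trans (interior_subset.trans hC₁Ω))
      have t2 := hw φ h1.continuous.measurable (by
        obtain ⟨M, hM⟩ := h2.exists_bound_of_continuous h1.continuous
        exact ⟨M, hM⟩)
      have e : ∀ w : Rn n → Rn n, ∫ x in C₁, φ x • w x = ∫ x, φ x • w x := fun w =>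
        setIntegral_smul_eq_integral w fun x hx => interior_subset (h3 (subset_tsupport φ hx))
      simp only [e] at t2
      rw [tendsto_nhds_unique t2 t1, neg_neg]
    -- Continuity of g identifies the abstract density with the classical partial derivative, so the
    -- local densities agree for all choices of compact sets.
    have hae := hvw.ae_hasLineDerivAt isOpen_interior (hg.mono (interior_subset.trans hC₁Ω))
    have hae' : ∀ᵐ x, x ∈ C → v x = lineDeriv ℝ g x (stdVec i) := by
      filter_upwards [hae] with x hx hxC
      exact (hx (hCC₁ hxC)).lineDeriv.symm
    have hCC : C ⊆ C₁ := hCC₁.trans interior_subset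
    refine ⟨(IntegrableOn.mono_set hv hCC).congr
      ((ae_restrict_iff' hC.measurableSet).mpr hae'), fun φ hφ ⟨M, hM⟩ => ?_⟩
    have hM0 : 0 ≤ M := (abs_nonneg _).trans (hM 0)
    have t := hw (C.indicator φ) (hφ.indicator hC.measurableSet) ⟨M, fun x => by
      by_cases hx : x ∈ C
      · simpa [hx] using hM x
      · simpa [hx] using hM0⟩
    have e : ∀ w : Rn n → Rn n, ∫ x in C₁, C.indicator φ x • w x = ∫ x in C, φ x • w x := by
      intro w
      have : (fun x => C.indicator φ x • w x) = C.indicator fun x => φ x • w x := by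
        ext1 x
        by_cases hx : x ∈ C <;> simp [hx]
      rw [this, setIntegral_indicator hC.measurableSet, inter_eq_self_of_subset_right hCC]
    simp only [e] at t
    refine t.trans (le_of_eq ?_)
    congr 1
    refine setIntegral_congr_ae hC.measurableSet ?_
    filter_upwards [hae'] with x hx hxC
    rw [hx hxC]
  refine ⟨⟨hg.locallyIntegrableOn hΩ.measurableSet, ?_, fun φ h1 h2 h3 => ?_⟩,
    fun C hC hCΩ => (local_limit C hC hCΩ).2⟩
  · rw [locallyIntegrableOn_iff hΩ.isLocallyClosed]
    exact fun C hCΩ hC => (local_limit C hC hCΩ).1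
  · rw [setIntegral_smul_eq_integral _ fun x hx => h3 (fderiv_ne_zero_mem_tsupport hx),
      setIntegral_smul_eq_integral _ fun x hx => h3 (subset_tsupport φ hx)]
    have t1 := tendsto_integral_smul_weakPartial hf hlim hu h1 h2 h3
    have t2 := (local_limit (tsupport φ) h2 h3).2 φ h1.continuous.measurable (by
      obtain ⟨M, hM⟩ := h2.exists_bound_of_continuous h1.continuous
      exact ⟨M, hM⟩)
    have e : ∀ w : Rn n → Rn n, ∫ x in tsupport φ, φ x • w x = ∫ x, φ x • w x := fun w =>
      setIntegral_smul_eq_integral w fun x hx => subset_tsupport φ hx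
    simp only [e] at t2
    rw [tendsto_nhds_unique t2 t1, neg_neg]

end SobolevLimits

/-! ### Equi-integrability of derivatives under bounded energy. -/

section SobolevMaps

variable {n : ℕ}

/-- Continuous Sobolev maps, with the classical partial derivatives as weak partial derivatives. -/
structure SobolevOn (Ω : Set (Rn n)) (f : Rn n → Rn n) : Prop where
  cont : ContinuousOn f Ω
  weak : ∀ i, IsWeakPartial Ω i f (fun x => lineDeriv ℝ f x (stdVec i))

lemma IsWeakPartial.congr_ae {Ω : Set (Rn n)} (hΩ : IsOpen Ω) {i : Fin n} {f u v : Rn n → Rn n}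
    (h : IsWeakPartial Ω i f u) (huv : ∀ᵐ x, x ∈ Ω → u x = v x) : IsWeakPartial Ω i f v := by
  have huv' : u =ᵐ[volume.restrict Ω] v := (ae_restrict_iff' hΩ.measurableSet).mpr huv
  refine ⟨h.locInt, ?_, fun φ h1 h2 h3 => ?_⟩
  · rw [locallyIntegrableOn_iff hΩ.isLocallyClosed]
    intro C hCΩ hC
    exact (h.locInt_deriv.integrableOn_compact_subset hCΩ hC).congr
      (ae_restrict_of_ae_restrict_of_subset hCΩ huv')
  · rw [h.integral_eq φ h1 h2 h3]
    congr 1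
    refine integral_congr_ae ?_
    filter_upwards [huv'] with x hx
    rw [hx]

/-- The classical partial derivatives exist almost everywhere and equal any weak ones, so they may
serve as canonical representatives. -/
lemma SobolevOn.of_memW11loc {Ω : Set (Rn n)} (hΩ : IsOpen Ω) {f : Rn n → Rn n}
    (hf : ContinuousOn f Ω) (h : MemW11loc Ω f) : SobolevOn Ω f := by
  refine ⟨hf, fun i => ?_⟩
  obtain ⟨u, hu⟩ := h.2 i
  refine hu.congr_ae hΩ ?_
  filter_upwards [hu.ae_hasLineDerivAt hΩ hf] with x hx hxΩ
  exact (hx hxΩ).lineDeriv.symm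

lemma SobolevOn.mono {Ω D : Set (Rn n)} {f : Rn n → Rn n} (h : SobolevOn D f) (hΩ : Ω ⊆ D) :
    SobolevOn Ω f :=
  ⟨h.cont.mono hΩ, fun i => (h.weak i).mono hΩ⟩

lemma SobolevOn.ae_hasPartials {Ω : Set (Rn n)} (hΩ : IsOpen Ω) {f : Rn n → Rn n}
    (h : SobolevOn Ω f) : ∀ᵐ x ∂(volume.restrict Ω), HasPartials f x := by
  rw [ae_restrict_iff' hΩ.measurableSet]
  filter_upwards [ae_all_iff.mpr fun i => (h.weak i).ae_hasLineDerivAt hΩ h.cont] with x hx hxΩ i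
  exact (hx i hxΩ).lineDifferentiableAt

lemma formalDeriv_eq_ofColumns (f : Rn n → Rn n) (x : Rn n) :
    formalDeriv f x = ofColumns fun i => lineDeriv ℝ f x (stdVec i) :=
  clm_ext_stdVec fun i => by rw [formalDeriv_stdVec, ofColumns_stdVec]

lemma continuous_ofColumns : Continuous (ofColumns : (Fin n → Rn n) → Rn n →L[ℝ] Rn n) := by
  unfold ofColumns
  refine continuous_finsetSum _ fun i _ => ?_
  exact ((ContinuousLinearMap.smulRightL ℝ (Rn n) (Rn n)
    (EuclideanSpace.proj i : Rn n →L[ℝ] ℝ)).continuous).comp (continuous_apply i)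

lemma SobolevOn.aestronglyMeasurable {Ω : Set (Rn n)} {f : Rn n → Rn n} (h : SobolevOn Ω f) :
    AEStronglyMeasurable (formalDeriv f) (volume.restrict Ω) := by
  have h1 : AEStronglyMeasurable (fun x i => lineDeriv ℝ f x (stdVec i)) (volume.restrict Ω) := by
    refine AEMeasurable.aestronglyMeasurable (aemeasurable_pi_lambda _ fun i => ?_)
    exact (h.weak i).locInt_deriv.aestronglyMeasurable.aemeasurable
  have h2 := continuous_ofColumns.comp_aestronglyMeasurable h1
  refine h2.congr (Eventually.of_forall fun x => ?_)
  exact (formalDeriv_eq_ofColumns f x).symm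

lemma norm_lineDeriv_le (f : Rn n → Rn n) (x : Rn n) (i : Fin n) :
    ‖lineDeriv ℝ f x (stdVec i)‖ ≤ ‖formalDeriv f x‖ := by
  rw [← formalDeriv_stdVec]
  simpa using (formalDeriv f x).le_opNorm (stdVec i)

lemma SobolevOn.integrableOn {Ω : Set (Rn n)} {f : Rn n → Rn n} (h : SobolevOn Ω f)
    {C : Set (Rn n)} (hC : IsCompact C) (hCΩ : C ⊆ Ω) : IntegrableOn (formalDeriv f) C := by
  have h1 : Integrable (fun x => ∑ i, ‖lineDeriv ℝ f x (stdVec i)‖) (volume.restrict C) :=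
    integrable_finsetSum _ fun i _ =>
      ((h.weak i).locInt_deriv.integrableOn_compact_subset hCΩ hC).norm
  refine h1.mono' (h.aestronglyMeasurable.mono_set hCΩ) (Eventually.of_forall fun x => ?_)
  rw [formalDeriv_eq_ofColumns]
  exact norm_ofColumns_le _

variable {Φ : ℝ≥0∞ → ℝ≥0∞}

/-- Φ is monotone only on [1, ∞]; since `dilat` takes values there, Φ may be replaced by the
globally monotone t ↦ Φ (max 1 t). -/
lemma IsStrictlyConvex.measurable_comp_dilat (hn : 2 ≤ n) (hΦ : IsStrictlyConvex Φ) :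
    Measurable fun A : Rn n →L[ℝ] Rn n => Φ (dilat A) := by
  have h1 : Monotone fun t : ℝ≥0∞ => Φ (max 1 t) := fun a b hab =>
    hΦ.mono (mem_Ici.mpr (le_max_left _ _)) (mem_Ici.mpr (le_max_left _ _)) (max_le_max le_rfl hab)
  have h2 : (fun A : Rn n →L[ℝ] Rn n => Φ (dilat A)) = fun A => Φ (max 1 (dilat A)) := by
    ext A
    rw [max_eq_right (one_le_dilat hn A)]
  rw [h2]
  exact h1.measurable.comp measurable_dilat

lemma SobolevOn.lintegral_P_eq (hn : 2 ≤ n) {Ω : Set (Rn n)} (hΩ : IsOpen Ω) {f : Rn n → Rn n}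
    (h : SobolevOn Ω f) : ∫⁻ x in Ω, Φ (P f x) = ∫⁻ x in Ω, Φ (dilat (formalDeriv f x)) := by
  refine lintegral_congr_ae ?_
  filter_upwards [h.ae_hasPartials hΩ] with x hx
  rw [P_eq_dilat hn hx]

/-- Superlinear growth forces Φ(∞) = ∞, so finite energy excludes infinite dilatation on a set of
positive measure. -/
lemma SobolevOn.ae_dilat_ne_top (hn : 2 ≤ n) (hΦ : IsStrictlyConvex Φ) {Ω : Set (Rn n)}
    {f : Rn n → Rn n} (h : SobolevOn Ω f)
    (hfin : ∫⁻ x in Ω, Φ (dilat (formalDeriv f x)) ≠ ⊤) :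
    ∀ᵐ x ∂(volume.restrict Ω), dilat (formalDeriv f x) ≠ ⊤ := by
  have hm : AEMeasurable (fun x => Φ (dilat (formalDeriv f x))) (volume.restrict Ω) :=
    (hΦ.measurable_comp_dilat hn).comp_aemeasurable h.aestronglyMeasurable.aemeasurable
  filter_upwards [ae_lt_top' hm hfin] with x hx htop
  rw [htop, hΦ.apply_top] at hx
  exact lt_irrefl _ hx

/-- For large k the images lie in the closed 1-neighbourhood of the compact set g(C); the finitely
many remaining images are compact. -/
lemma exists_image_measure_bound {Ω : Set (Rn n)} {f : ℕ → Rn n → Rn n}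
    {g : Rn n → Rn n} (hf : ∀ k, ContinuousOn (f k) Ω)
    (hlim : TendstoLocallyUniformlyOn f g atTop Ω) {C : Set (Rn n)} (hC : IsCompact C)
    (hCΩ : C ⊆ Ω) : ∃ B : ℝ≥0, ∀ k, volume (f k '' C) ≤ B := by
  have hg : ContinuousOn g Ω := hlim.continuousOn (Frequently.of_forall hf)
  have hunif : TendstoUniformlyOn f g atTop C :=
    (tendstoLocallyUniformlyOn_iff_tendstoUniformlyOn_of_compact hC).mp (hlim.mono hCΩ)
  obtain ⟨N, hN⟩ := eventually_atTop.mp (Metric.tendstoUniformlyOn_iff.mp hunif 1 one_pos)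
  have hT : IsCompact (cthickening 1 (g '' C)) :=
    (hC.image_of_continuousOn (hg.mono hCΩ)).cthickening
  set b : ℝ≥0∞ := volume (cthickening 1 (g '' C)) + ∑ k ∈ Finset.range N, volume (f k '' C) with hb
  have hbt : b ≠ ⊤ := by
    refine ENNReal.add_ne_top.mpr ⟨hT.measure_lt_top.ne, (ENNReal.sum_lt_top.mpr fun k _ => ?_).ne⟩
    exact (hC.image_of_continuousOn ((hf k).mono hCΩ)).measure_lt_top
  refine ⟨b.toNNReal, fun k => ?_⟩
  rw [ENNReal.coe_toNNReal hbt]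
  rcases lt_or_ge k N with hk | hk
  · exact (Finset.single_le_sum (f := fun k => volume (f k '' C)) (fun _ _ => bot_le)
      (Finset.mem_range.mpr hk)).trans le_add_self
  · refine le_trans (measure_mono ?_) le_self_add
    rintro _ ⟨x, hx, rfl⟩
    refine mem_cthickening_of_dist_le (f k x) (g x) 1 _ ⟨x, hx, rfl⟩ ?_
    rw [dist_comm]
    exact (hN k hk x hx).le

/-- Uniform control of the derivatives on small sets in terms of the energy `∫ Φ (P f)`. -/
lemma exists_lintegral_enorm_le (hn : 2 ≤ n) (hΦ : IsStrictlyConvex Φ) {Ω : Set (Rn n)}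
    (hΩ : IsOpen Ω) {f : ℕ → Rn n → Rn n} {g : Rn n → Rn n} (hf : ∀ k, SobolevOn Ω (f k))
    (hinj : ∀ k, InjOn (f k) Ω) (hlim : TendstoLocallyUniformlyOn f g atTop Ω) {m : ℝ≥0}
    (hm : ∀ k, ∫⁻ x in Ω, Φ (dilat (formalDeriv (f k) x)) ≤ m) {C : Set (Rn n)}
    (hC : IsCompact C) (hCΩ : C ⊆ Ω) {ε : ℝ} (hε : 0 < ε) :
    ∃ N : ℝ, 0 ≤ N ∧ ∀ k, ∀ S, MeasurableSet S → S ⊆ C →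
      ∫⁻ x in S, ‖formalDeriv (f k) x‖ₑ ≤ ENNReal.ofReal N * volume S + ENNReal.ofReal ε := by
  obtain ⟨B, hB⟩ := exists_image_measure_bound (fun k => (hf k).cont) hlim hC hCΩ
  -- Jacobian integrals are at most B and energies at most m, so their joint contribution η (B + m)
  -- stays below ε.
  set η : ℝ := ε / (B + m + 1) with hη
  have hη0 : 0 < η := by positivity
  obtain ⟨N, hN0, hN⟩ := exists_enorm_le_add (n := n) hn hΦ hη0
  refine ⟨N, hN0, fun k S hS hSC => ?_⟩
  have hSΩ : S ⊆ Ω := hSC.trans hCΩ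
  have hfin := (hf k).ae_dilat_ne_top hn hΦ ((hm k).trans_lt ENNReal.coe_lt_top).ne
  have hdm : AEMeasurable (fun x => ENNReal.ofReal η * ENNReal.ofReal |(formalDeriv (f k) x).det|)
      (volume.restrict S) := by
    have h1 := measurable_det.comp_aemeasurable ((hf k).aestronglyMeasurable.mono_set hSΩ).aemeasurable
    exact (ENNReal.measurable_ofReal.comp_aemeasurable (measurable_norm.comp_aemeasurable h1)).const_mul _
  have hJ : ∫⁻ x in S, ENNReal.ofReal |(formalDeriv (f k) x).det| ≤ B :=
    (lintegral_abs_det_formalDeriv_le hΩ (hf k).cont (hinj k) (hf k).weak hS hSΩ).trans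
      ((measure_mono (image_mono hSC)).trans (hB k))
  have hE : ∫⁻ x in S, Φ (dilat (formalDeriv (f k) x)) ≤ m :=
    (lintegral_mono_set hSΩ).trans (hm k)
  calc ∫⁻ x in S, ‖formalDeriv (f k) x‖ₑ
      ≤ ∫⁻ x in S, ((ENNReal.ofReal N + ENNReal.ofReal η * ENNReal.ofReal |(formalDeriv (f k) x).det|)
        + ENNReal.ofReal η * Φ (dilat (formalDeriv (f k) x))) := by
        refine lintegral_mono_ae ?_
        filter_upwards [ae_restrict_of_ae_restrict_of_subset hSΩ hfin] with x hx
        exact hN _ hx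
    _ = ENNReal.ofReal N * volume S
        + ENNReal.ofReal η * (∫⁻ x in S, ENNReal.ofReal |(formalDeriv (f k) x).det|)
        + ENNReal.ofReal η * ∫⁻ x in S, Φ (dilat (formalDeriv (f k) x)) := by
        rw [lintegral_add_left' (f := fun x => ENNReal.ofReal N
          + ENNReal.ofReal η * ENNReal.ofReal |(formalDeriv (f k) x).det|)
          (aemeasurable_const.add hdm), lintegral_add_left' aemeasurable_const,
          lintegral_const_mul' _ _ ENNReal.ofReal_ne_top, lintegral_const_mul' _ _ ENNReal.ofReal_ne_top]
        simp
    _ ≤ ENNReal.ofReal N * volume S + ENNReal.ofReal η * B + ENNReal.ofReal η * m := by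
        gcongr
    _ ≤ ENNReal.ofReal N * volume S + ENNReal.ofReal ε := by
        rw [add_assoc, ← mul_add]
        gcongr
        rw [← ENNReal.ofReal_coe_nnreal, ← ENNReal.ofReal_coe_nnreal, ← ENNReal.ofReal_add B.coe_nonneg m.coe_nonneg,
          ← ENNReal.ofReal_mul hη0.le]
        refine ENNReal.ofReal_le_ofReal ?_
        have hB0 : (0 : ℝ) ≤ B := B.2
        have hm0 : (0 : ℝ) ≤ m := m.2
        rw [hη, div_mul_eq_mul_div, div_le_iff₀ (by positivity)]
        nlinarith

/-- The limit of Sobolev homeomorphisms with bounded energy is a Sobolev map, and the partial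
derivatives converge weakly in `L¹` on compact sets. -/
theorem sobolev_limit (hn : 2 ≤ n) (hΦ : IsStrictlyConvex Φ) {Ω : Set (Rn n)}
    (hΩ : IsOpen Ω) {f : ℕ → Rn n → Rn n} {g : Rn n → Rn n} (hf : ∀ k, SobolevOn Ω (f k))
    (hinj : ∀ k, InjOn (f k) Ω) (hlim : TendstoLocallyUniformlyOn f g atTop Ω) {m : ℝ≥0}
    (hm : ∀ k, ∫⁻ x in Ω, Φ (dilat (formalDeriv (f k) x)) ≤ m) :
    SobolevOn Ω g ∧ ∀ i C, IsCompact C → C ⊆ Ω → ∀ φ : Rn n → ℝ, Measurable φ →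
      (∃ M : ℝ, ∀ x, |φ x| ≤ M) →
      Tendsto (fun k => ∫ x in C, φ x • lineDeriv ℝ (f k) x (stdVec i)) atTop
        (𝓝 (∫ x in C, φ x • lineDeriv ℝ g x (stdVec i))) := by
  have hle : ∀ i k (S : Set (Rn n)), ∫⁻ x in S, ‖lineDeriv ℝ (f k) x (stdVec i)‖ₑ
      ≤ ∫⁻ x in S, ‖formalDeriv (f k) x‖ₑ := fun i k S => by
    refine lintegral_mono fun x => ?_
    simp only
    rw [← ofReal_norm, ← ofReal_norm]
    exact ENNReal.ofReal_le_ofReal (norm_lineDeriv_le _ _ _)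
  have key : ∀ i, _ := fun i => weakPartial_of_smallSetIntegrable (i := i) hΩ
    (fun k => (hf k).cont) hlim (fun k => (hf k).weak i)
    (fun C hC hCΩ ε hε => by
      obtain ⟨N, hN0, hN⟩ := exists_lintegral_enorm_le hn hΦ hΩ hf hinj hlim hm hC hCΩ
        (half_pos hε)
      -- With this δ the term N · |S| is at most ε/2.
      refine ⟨ε / (2 * (N + 1)), by positivity, fun k S hS hSδ => ?_⟩
      rw [Measure.restrict_apply hS] at hSδ
      rw [Measure.restrict_restrict hS]
      refine (hle i k _).trans ((hN k (S ∩ C) (hS.inter hC.measurableSet) inter_subset_right).trans ?_)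
      calc ENNReal.ofReal N * volume (S ∩ C) + ENNReal.ofReal (ε / 2)
          ≤ ENNReal.ofReal N * ENNReal.ofReal (ε / (2 * (N + 1))) + ENNReal.ofReal (ε / 2) := by
            gcongr
        _ = ENNReal.ofReal (N * (ε / (2 * (N + 1))) + ε / 2) := by
            rw [← ENNReal.ofReal_mul hN0, ← ENNReal.ofReal_add (by positivity) (by positivity)]
        _ ≤ ENNReal.ofReal ε := by
            refine ENNReal.ofReal_le_ofReal ?_
            have : N * (ε / (2 * (N + 1))) ≤ ε / 2 := by
              rw [mul_div_assoc', div_le_div_iff₀ (by positivity) (by positivity)]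
              nlinarith
            linarith)
    (fun C hC hCΩ => by
      obtain ⟨N, hN0, hN⟩ := exists_lintegral_enorm_le hn hΦ hΩ hf hinj hlim hm hC hCΩ one_pos
      refine ⟨(ENNReal.ofReal N * volume C + ENNReal.ofReal 1).toReal, fun k => ?_⟩
      rw [integral_norm_eq_lintegral_enorm
        ((hf k).weak i |>.locInt_deriv.integrableOn_compact_subset hCΩ hC).aestronglyMeasurable]
      refine ENNReal.toReal_mono ?_ ((hle i k C).trans (hN k C hC.measurableSet Subset.rfl))
      exact ENNReal.add_ne_top.mpr ⟨ENNReal.mul_ne_top ENNReal.ofReal_ne_top hC.measure_lt_top.ne,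
        ENNReal.ofReal_ne_top⟩)
  exact ⟨⟨hlim.continuousOn (Frequently.of_forall fun k => (hf k).cont), fun i => (key i).1⟩,
    fun i => (key i).2⟩

end SobolevMaps

/-! ### Local inequality at Lebesgue points and the Vitali covering. -/

section Semicontinuity

variable {n : ℕ}

lemma ae_tendsto_average_closedBall {F : Type*} [NormedAddCommGroup F] [NormedSpace ℝ F]
    [CompleteSpace F] {Ω : Set (Rn n)} (hΩ : IsOpen Ω) {w : Rn n → F}
    (hw : LocallyIntegrableOn w Ω) :
    ∀ᵐ x, x ∈ Ω → Tendsto (fun r => ⨍ y in closedBall x r, w y) (𝓝[>] 0) (𝓝 (w x)) := by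
  refine ae_of_locally_ae fun x₀ hx₀ => ?_
  obtain ⟨R, hR, hRΩ⟩ := Metric.isOpen_iff.mp hΩ x₀ hx₀
  have hsub : closedBall x₀ (R / 2) ⊆ Ω := (closedBall_subset_ball (by linarith)).trans hRΩ
  have hi : Integrable ((closedBall x₀ (R / 2)).indicator w) := by
    rw [integrable_indicator_iff measurableSet_closedBall]
    exact hw.integrableOn_compact_subset hsub (isCompact_closedBall _ _)
  refine ⟨ball x₀ (R / 2), ball_mem_nhds _ (by positivity), ?_⟩
  filter_upwards [(Besicovitch.vitaliFamily volume).ae_tendsto_average hi.locallyIntegrable]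
    with x hx hxb
  have h1 := hx.comp (Besicovitch.tendsto_filterAt volume x)
  rw [indicator_of_mem (ball_subset_closedBall hxb)] at h1
  refine h1.congr' ?_
  have hpos : 0 < R / 2 - dist x x₀ := by
    rw [mem_ball] at hxb; linarith
  filter_upwards [Ioo_mem_nhdsGT hpos] with r hr
  refine setAverage_congr_fun measurableSet_closedBall (Eventually.of_forall fun y hy => ?_)
  refine indicator_of_mem ?_ _
  rw [mem_closedBall] at hy ⊢
  have := dist_triangle y x x₀
  linarith [hr.2]

open scoped Pointwise in
/-- Near a point of differentiability, the measure of the images of small balls under a locally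
uniformly convergent sequence is controlled by the Jacobian of the limit. -/
lemma eventually_image_closedBall_le {Ω : Set (Rn n)} (hΩ : IsOpen Ω) {f : ℕ → Rn n → Rn n}
    {g : Rn n → Rn n} (hlim : TendstoLocallyUniformlyOn f g atTop Ω) {x : Rn n} (hx : x ∈ Ω)
    (hd : DifferentiableAt ℝ g x) {ε : ℝ} (hε : 0 < ε) :
    ∀ᶠ r in 𝓝[>] (0 : ℝ), closedBall x r ⊆ Ω ∧ ∀ᶠ k in atTop,
      volume (f k '' closedBall x r)
        ≤ ENNReal.ofReal (|(fderiv ℝ g x).det| + ε) * volume (closedBall x r) := by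
  set A := fderiv ℝ g x with hA
  set K : Set (Rn n) := A '' closedBall 0 1 with hK
  set V := volume (closedBall (0 : Rn n) 1) with hV
  have hKc : IsCompact K := (isCompact_closedBall 0 1).image A.continuous
  have hV0 : V ≠ 0 := (measure_closedBall_pos volume (0 : Rn n) one_pos).ne'
  have hVt : V ≠ ⊤ := measure_closedBall_lt_top.ne
  have hKV : volume K = ENNReal.ofReal |A.det| * V :=
    Measure.addHaar_image_continuousLinearMap volume A _
  have hlt : volume K < ENNReal.ofReal (|A.det| + ε) * V := by
    rw [hKV, ENNReal.mul_lt_mul_iff_left hV0 hVt]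
    exact (ENNReal.ofReal_lt_ofReal_iff (by positivity)).mpr (by linarith)
  have h1 := (tendsto_measure_cthickening_of_isCompact (μ := volume) hKc).eventually_lt_const hlt
  obtain ⟨η, hη, hη0⟩ : ∃ η, volume (cthickening η K) < ENNReal.ofReal (|A.det| + ε) * V ∧ 0 < η :=
    ((h1.filter_mono nhdsWithin_le_nhds).and (self_mem_nhdsWithin (s := Ioi (0 : ℝ)))).exists
  have h2 : ∀ᶠ y in 𝓝 x, ‖g y - g x - A (y - x)‖ ≤ η / 2 * ‖y - x‖ :=
    hd.hasFDerivAt.isLittleO.def (half_pos hη0)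
  obtain ⟨ρ₁, hρ₁, H₁⟩ := Metric.eventually_nhds_iff.mp h2
  obtain ⟨ρ₂, hρ₂, H₂⟩ := Metric.isOpen_iff.mp hΩ x hx
  filter_upwards [Ioo_mem_nhdsGT (lt_min hρ₁ hρ₂)] with r hr
  have hr0 : 0 < r := hr.1
  have hBΩ : closedBall x r ⊆ Ω :=
    (closedBall_subset_ball (hr.2.trans_le (min_le_right _ _))).trans H₂
  refine ⟨hBΩ, ?_⟩
  have hunif : TendstoUniformlyOn f g atTop (closedBall x r) :=
    (tendstoLocallyUniformlyOn_iff_tendstoUniformlyOn_of_compact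
      (isCompact_closedBall x r)).mp (hlim.mono hBΩ)
  filter_upwards [Metric.tendstoUniformlyOn_iff.mp hunif (η / 2 * r) (by positivity)] with k hk
  -- The error η r splits in two halves: the linearization of g at x, and the uniform distance of f
  -- k from g on the ball.
  have hsub : f k '' closedBall x r ⊆ (fun z => g x + z) '' (r • cthickening η K) := by
    rintro _ ⟨y, hy, rfl⟩
    have hyr : ‖y - x‖ ≤ r := by rwa [mem_closedBall_iff_norm] at hy
    have e1 := H₁ (y := y) (by
      rw [dist_eq_norm]
      exact (hyr.trans_lt hr.2).trans_le (min_le_left _ _))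
    have e2 := hk y hy
    rw [dist_comm, dist_eq_norm] at e2
    refine ⟨f k y - g x, ⟨r⁻¹ • (f k y - g x), ?_, ?_⟩, by simp⟩
    · refine mem_cthickening_of_dist_le _ (A (r⁻¹ • (y - x))) η K ⟨r⁻¹ • (y - x), ?_, rfl⟩ ?_
      · rw [mem_closedBall_zero_iff, norm_smul, Real.norm_eq_abs, abs_of_pos (inv_pos.mpr hr0)]
        rw [inv_mul_le_iff₀ hr0, mul_one]
        exact hyr
      · rw [dist_eq_norm, map_smul, ← smul_sub, norm_smul, Real.norm_eq_abs,
          abs_of_pos (inv_pos.mpr hr0), inv_mul_le_iff₀ hr0]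
        calc ‖f k y - g x - A (y - x)‖ = ‖(f k y - g y) + (g y - g x - A (y - x))‖ := by
              congr 1; abel
          _ ≤ ‖f k y - g y‖ + ‖g y - g x - A (y - x)‖ := norm_add_le _ _
          _ ≤ η / 2 * r + η / 2 * r := by
              have : η / 2 * ‖y - x‖ ≤ η / 2 * r := mul_le_mul_of_nonneg_left hyr (by positivity)
              linarith
          _ = r * η := by ring
    · simp only
      rw [smul_smul, mul_inv_cancel₀ hr0.ne', one_smul]
  calc volume (f k '' closedBall x r) ≤ volume ((fun z => g x + z) '' (r • cthickening η K)) :=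
        measure_mono hsub
    _ = ENNReal.ofReal (r ^ n) * volume (cthickening η K) := by
        rw [image_add_left, measure_preimage_add, Measure.addHaar_smul]
        simp [abs_of_pos hr0]
    _ ≤ ENNReal.ofReal (r ^ n) * (ENNReal.ofReal (|A.det| + ε) * V) := by gcongr
    _ = ENNReal.ofReal (|A.det| + ε) * volume (closedBall x r) := by
        have h3 : volume (closedBall x r) = ENNReal.ofReal (r ^ n) * V := by
          have h4 := Measure.addHaar_closedBall_mul_of_pos volume x hr0 1
          rw [mul_one, finrank_euclideanSpace, Fintype.card_fin] at h4
          exact h4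
        rw [h3]
        ring

/-- Integration commutes with assembling columns, so convergence of the integrals of each partial
derivative gives that of the whole matrix. -/
lemma integral_formalDeriv {Ω C : Set (Rn n)} {f : Rn n → Rn n} (hf : SobolevOn Ω f)
    (hC : IsCompact C) (hCΩ : C ⊆ Ω) :
    ∫ x in C, formalDeriv f x = ofColumns fun i => ∫ x in C, lineDeriv ℝ f x (stdVec i) := by
  have hi : ∀ i, IntegrableOn (fun x => lineDeriv ℝ f x (stdVec i)) C := fun i =>
    (hf.weak i).locInt_deriv.integrableOn_compact_subset hCΩ hC
  set T : Fin n → Rn n →L[ℝ] Rn n →L[ℝ] Rn n := fun i =>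
    ContinuousLinearMap.smulRightL ℝ (Rn n) (Rn n) (EuclideanSpace.proj i : Rn n →L[ℝ] ℝ) with hT
  have e : ∀ w : Fin n → Rn n, ofColumns w = ∑ i, T i (w i) := fun w => rfl
  simp only [formalDeriv_eq_ofColumns, e]
  rw [integral_finsetSum _ fun i _ => (T i).integrable_comp (hi i)]
  exact Finset.sum_congr rfl fun i _ => (T i).integral_comp_comm (hi i)

lemma ofReal_integral_le_lintegral {α : Type*} [MeasurableSpace α] {μ : Measure α} {h : α → ℝ}
    (hh : Integrable h μ) : ENNReal.ofReal (∫ x, h x ∂μ) ≤ ∫⁻ x, ENNReal.ofReal (h x) ∂μ := by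
  rw [integral_eq_lintegral_pos_part_sub_lintegral_neg_part hh]
  refine (ENNReal.ofReal_le_ofReal (sub_le_self _ ENNReal.toReal_nonneg)).trans ?_
  exact ENNReal.ofReal_toReal_le

variable {Φ : ℝ≥0∞ → ℝ≥0∞}

/-- Local form of the lower semicontinuity, at a Lebesgue point of the derivative of the limit. -/
theorem eventually_lintegral_closedBall_le (hn : 2 ≤ n) (hΦ : IsStrictlyConvex Φ)
    (hΦT : LeftContAtFiniteSup Φ) {Ω : Set (Rn n)} (hΩ : IsOpen Ω) {f : ℕ → Rn n → Rn n}
    {g : Rn n → Rn n} (hf : ∀ k, SobolevOn Ω (f k)) (hg : SobolevOn Ω g)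
    (hinj : ∀ k, InjOn (f k) Ω) (hlim : TendstoLocallyUniformlyOn f g atTop Ω)
    (hconv : ∀ i C, IsCompact C → C ⊆ Ω →
      Tendsto (fun k => ∫ x in C, lineDeriv ℝ (f k) x (stdVec i)) atTop
        (𝓝 (∫ x in C, lineDeriv ℝ g x (stdVec i))))
    (hfin : ∀ k, ∀ᵐ x ∂(volume.restrict Ω), dilat (formalDeriv (f k) x) ≠ ⊤)
    {F : Rn n → ℝ} (hF : LocallyIntegrableOn F Ω) (hF0 : ∀ x, 0 ≤ F x)
    {x : Rn n} (hx : x ∈ Ω) (hd : DifferentiableAt ℝ g x)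
    (hFx : ENNReal.ofReal (F x) ≤ Φ (dilat (formalDeriv g x)))
    (hLG : Tendsto (fun r => ⨍ y in closedBall x r, formalDeriv g y) (𝓝[>] 0) (𝓝 (formalDeriv g x)))
    (hLF : Tendsto (fun r => ⨍ y in closedBall x r, F y) (𝓝[>] 0) (𝓝 (F x)))
    {ε : ℝ} (hε : 0 < ε) :
    ∀ᶠ r in 𝓝[>] (0 : ℝ), ∀ᶠ k in atTop, ∫⁻ y in closedBall x r, ENNReal.ofReal (F y)
      ≤ (∫⁻ y in closedBall x r, Φ (dilat (formalDeriv (f k) y)))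
        + ENNReal.ofReal ε * volume (closedBall x r) := by
  have hAeq : formalDeriv g x = fderiv ℝ g x :=
    formalDeriv_eq_of_hasLineDerivAt fun i => hd.hasFDerivAt.hasLineDerivAt _
  set A := formalDeriv g x with hA
  obtain ⟨L, c, b, hc, hmin, hval⟩ : ∃ (L : (Rn n →L[ℝ] Rn n) →L[ℝ] ℝ) (c b : ℝ), 0 ≤ c ∧
      (∀ B : Rn n →L[ℝ] Rn n, dilat B ≠ ⊤ →
        ENNReal.ofReal (L B - c * |B.det| + b) ≤ Φ (dilat B)) ∧
      F x - ε / 4 ≤ L A - c * |A.det| + b := by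
    rcases (hF0 x).eq_or_lt with h0 | h0
    · exact ⟨0, 0, 0, le_rfl, fun B _ => by simp, by simp [← h0]; linarith⟩
    · have hy : max (F x - ε / 4) 0 < F x := max_lt (by linarith) h0
      obtain ⟨L, c, b, h1, h2, h3⟩ := exists_polyconvex_minorant hn hΦ hΦT A (le_max_right _ 0)
        (((ENNReal.ofReal_lt_ofReal_iff h0).mpr hy).trans_le hFx)
      exact ⟨L, c, b, h1, h2, (le_max_left _ _).trans h3⟩
  set η : ℝ := ε / (8 * (c + 1)) with hη
  have hη0 : 0 < η := by positivity
  have hcη : c * η ≤ ε / 8 := by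
    rw [hη, mul_div_assoc', div_le_div_iff₀ (by positivity) (by positivity)]
    nlinarith
  have e1 := hLF.eventually_lt_const (show F x < F x + ε / 8 by linarith)
  have e2 := ((L.continuous.tendsto A).comp hLG).eventually_const_lt
    (show L A - ε / 8 < L A by linarith)
  have e3 := eventually_image_closedBall_le hΩ hlim hx hd hη0
  filter_upwards [e1, e2, e3, self_mem_nhdsWithin] with r hr1 hr2 hr3 hr0
  obtain ⟨hBΩ, hr3⟩ := hr3
  set B := closedBall x r with hB
  have hBc : IsCompact B := isCompact_closedBall x r
  have hBm : MeasurableSet B := measurableSet_closedBall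
  have hVt : volume B ≠ ⊤ := measure_closedBall_lt_top.ne
  set V : ℝ := volume.real B with hV
  have hV0 : 0 < V := ENNReal.toReal_pos (measure_closedBall_pos volume x hr0).ne' hVt
  have hVe : volume B = ENNReal.ofReal V := (ENNReal.ofReal_toReal hVt).symm
  have hFi : IntegrableOn F B := hF.integrableOn_compact_subset hBΩ hBc
  have hFint : ∫ y in B, F y ≤ (F x + ε / 8) * V := by
    rw [setAverage_eq, smul_eq_mul, inv_mul_lt_iff₀ hV0] at hr1
    linarith
  have hGint : (L A - ε / 8) * V ≤ L (∫ y in B, formalDeriv g y) := by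
    simp only [Function.comp_apply] at hr2
    rw [setAverage_eq, map_smul, smul_eq_mul, lt_inv_mul_iff₀ hV0] at hr2
    linarith
  have hGk : Tendsto (fun k => L (∫ y in B, formalDeriv (f k) y)) atTop
      (𝓝 (L (∫ y in B, formalDeriv g y))) := by
    refine (L.continuous.tendsto _).comp ?_
    simp only [integral_formalDeriv (hf _) hBc hBΩ, integral_formalDeriv hg hBc hBΩ]
    exact (continuous_ofColumns.tendsto _).comp
      (tendsto_pi_nhds.mpr fun i => hconv i B hBc hBΩ)
  have e4 := hGk.eventually_const_lt (show L (∫ y in B, formalDeriv g y) - ε / 8 * V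
    < L (∫ y in B, formalDeriv g y) by nlinarith)
  filter_upwards [hr3, e4] with k hk1 hk2
  have hGki : IntegrableOn (formalDeriv (f k)) B := (hf k).integrableOn hBc hBΩ
  have hJle : ∫⁻ y in B, ENNReal.ofReal |(formalDeriv (f k) y).det|
      ≤ ENNReal.ofReal ((|A.det| + η) * V) := by
    refine (lintegral_abs_det_formalDeriv_le hΩ (hf k).cont (hinj k) (hf k).weak hBm hBΩ).trans
      (hk1.trans_eq ?_)
    rw [hAeq, hVe, ← ENNReal.ofReal_mul (by positivity)]
  have hJm : AEStronglyMeasurable (fun y => |(formalDeriv (f k) y).det|) (volume.restrict B) :=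
    (measurable_norm.comp_aemeasurable
      (measurable_det.comp_aemeasurable hGki.aestronglyMeasurable.aemeasurable)).aestronglyMeasurable
  have hJi : IntegrableOn (fun y => |(formalDeriv (f k) y).det|) B := by
    refine ⟨hJm, ?_⟩
    rw [hasFiniteIntegral_iff_ofReal (Eventually.of_forall fun y => abs_nonneg _)]
    exact hJle.trans_lt ENNReal.ofReal_lt_top
  have hJint : ∫ y in B, |(formalDeriv (f k) y).det| ≤ (|A.det| + η) * V := by
    rw [← ofReal_integral_eq_lintegral_ofReal hJi (Eventually.of_forall fun y => abs_nonneg _),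
      ENNReal.ofReal_le_ofReal_iff (by positivity)] at hJle
    exact hJle
  set h : Rn n → ℝ := fun y => L (formalDeriv (f k) y) - c * |(formalDeriv (f k) y).det| + b with hh
  have i1 : IntegrableOn (fun y => L (formalDeriv (f k) y)) B := L.integrable_comp hGki
  have i2 : IntegrableOn (fun y => c * |(formalDeriv (f k) y).det|) B := hJi.const_mul c
  have i3 : IntegrableOn (fun _ : Rn n => b) B := integrableOn_const hVt
  have i12 : IntegrableOn (fun y => L (formalDeriv (f k) y) - c * |(formalDeriv (f k) y).det|) B :=
    i1.sub i2
  have hhi : IntegrableOn h B := i12.add i3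
  have hhint : ∫ y in B, h y = L (∫ y in B, formalDeriv (f k) y)
      - c * (∫ y in B, |(formalDeriv (f k) y).det|) + b * V := by
    simp only [hh]
    rw [integral_add i12 i3, integral_sub i1 i2, integral_const_mul, L.integral_comp_comm hGki]
    simp [hV, mul_comm]
  have hQ : ENNReal.ofReal (∫ y in B, h y) ≤ ∫⁻ y in B, Φ (dilat (formalDeriv (f k) y)) := by
    refine (ofReal_integral_le_lintegral hhi).trans (lintegral_mono_ae ?_)
    filter_upwards [ae_restrict_of_ae_restrict_of_subset hBΩ (hfin k)] with y hy
    exact hmin _ hy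
  -- Per unit volume the errors are ε/8 for the mean of F, ε/4 for the minorant at x, and ε/8 each
  -- for the mean of the derivative of g, the weak convergence and the Jacobian: 3ε/4 altogether.
  have hfinal : ∫ y in B, F y ≤ (∫ y in B, h y) + ε * V := by
    rw [hhint]
    have q1 : c * (∫ y in B, |(formalDeriv (f k) y).det|) ≤ (c * |A.det| + c * η) * V := by
      have := mul_le_mul_of_nonneg_left hJint hc
      linarith
    have q2 : (c * |A.det| + c * η) * V ≤ (c * |A.det| + ε / 8) * V :=
      mul_le_mul_of_nonneg_right (by linarith) hV0.le
    have q3 : (F x - ε / 4) * V ≤ (L A - c * |A.det| + b) * V :=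
      mul_le_mul_of_nonneg_right hval hV0.le
    have q4 : 0 ≤ ε * V := by positivity
    linarith
  rw [← ofReal_integral_eq_lintegral_ofReal hFi (Eventually.of_forall hF0)]
  calc ENNReal.ofReal (∫ y in B, F y) ≤ ENNReal.ofReal ((∫ y in B, h y) + ε * V) :=
        ENNReal.ofReal_le_ofReal hfinal
    _ ≤ ENNReal.ofReal (∫ y in B, h y) + ENNReal.ofReal (ε * V) := ENNReal.ofReal_add_le
    _ ≤ _ := by
        rw [ENNReal.ofReal_mul hε.le, ← hVe]
        gcongr

/-- Passage from small balls to open sets by the Vitali covering theorem. -/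
theorem lintegral_le_of_eventually_closedBall {Ω : Set (Rn n)} (hΩ : IsOpen Ω)
    {F : Rn n → ℝ≥0∞} {Q : ℕ → Rn n → ℝ≥0∞} {m ε : ℝ≥0∞} (hQ : ∀ k, ∫⁻ x in Ω, Q k x ≤ m)
    (hloc : ∀ᵐ x, x ∈ Ω → ∀ᶠ r in 𝓝[>] (0 : ℝ), ∀ᶠ k in atTop,
      ∫⁻ y in closedBall x r, F y
        ≤ (∫⁻ y in closedBall x r, Q k y) + ε * volume (closedBall x r)) :
    ∫⁻ x in Ω, F x ≤ m + ε * volume Ω := by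
  set P₀ : Rn n → ℝ → Prop := fun x r => closedBall x r ⊆ Ω ∧ ∀ᶠ k in atTop,
      ∫⁻ y in closedBall x r, F y
        ≤ (∫⁻ y in closedBall x r, Q k y) + ε * volume (closedBall x r) with hP₀
  set s : Set (Rn n) := {x | x ∈ Ω ∧ ∀ᶠ r in 𝓝[>] (0 : ℝ), P₀ x r} with hs
  have hsΩ : ∀ᵐ x, x ∈ Ω → x ∈ s := by
    filter_upwards [hloc] with x hx hxΩ
    refine ⟨hxΩ, ?_⟩
    obtain ⟨ρ, hρ, H⟩ := Metric.isOpen_iff.mp hΩ x hxΩ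
    filter_upwards [hx hxΩ, Ioo_mem_nhdsGT hρ] with r h1 h2
    exact ⟨(closedBall_subset_ball h2.2).trans H, h1⟩
  obtain ⟨t, r, htc, hts, hr, hcov, hdisj⟩ := Besicovitch.exists_disjoint_closedBall_covering_ae
    (volume : Measure (Rn n)) (fun x => {r | P₀ x r}) s (fun x hx δ hδ => by
      obtain ⟨r, h1, h2⟩ := (hx.2.and (Ioo_mem_nhdsGT hδ)).exists
      exact ⟨r, h1, h2⟩) (fun _ => 1) (fun _ _ => one_pos)
  have hsub : Ω ≤ᵐ[volume] ⋃ x ∈ t, closedBall x (r x) := by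
    have h1 : ∀ᵐ x, x ∉ s \ ⋃ x ∈ t, closedBall x (r x) := measure_eq_zero_iff_ae_notMem.mp hcov
    filter_upwards [hsΩ, h1] with x hx1 hx2 hxΩ
    by_contra hcon
    exact hx2 ⟨hx1 hxΩ, hcon⟩
  have : Countable t := htc.to_subtype
  calc ∫⁻ x in Ω, F x ≤ ∫⁻ x in ⋃ x ∈ t, closedBall x (r x), F x := lintegral_mono_set' hsub
    _ = ∑' x : t, ∫⁻ y in closedBall (x : Rn n) (r x), F y :=
        lintegral_biUnion htc (fun x _ => measurableSet_closedBall) hdisj _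
    _ ≤ m + ε * volume Ω := by
        -- The index beyond which the local inequality holds depends on the ball, so one k is chosen
        -- for finitely many balls at a time; the bound m does not depend on k.
        rw [ENNReal.tsum_eq_iSup_sum]
        refine iSup_le fun T => ?_
        have hev : ∀ᶠ k in atTop, ∀ x ∈ T, ∫⁻ y in closedBall (x : Rn n) (r x), F y
            ≤ (∫⁻ y in closedBall (x : Rn n) (r x), Q k y) + ε * volume (closedBall (x : Rn n) (r x)) :=
          (Filter.eventually_all_finset T).mpr fun x _ => (hr x x.2).1.2
        obtain ⟨k, hk⟩ := hev.exists
        have hd : (T : Set t).PairwiseDisjoint fun x => closedBall (x : Rn n) (r x) :=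
          fun x _ y _ hxy => hdisj x.2 y.2 fun h => hxy (Subtype.ext h)
        have hU : (⋃ x ∈ T, closedBall (x : Rn n) (r x)) ⊆ Ω :=
          iUnion₂_subset fun x _ => (hr x x.2).1.1
        calc ∑ x ∈ T, ∫⁻ y in closedBall (x : Rn n) (r x), F y
            ≤ ∑ x ∈ T, ((∫⁻ y in closedBall (x : Rn n) (r x), Q k y)
              + ε * volume (closedBall (x : Rn n) (r x))) := Finset.sum_le_sum hk
          _ = (∫⁻ y in ⋃ x ∈ T, closedBall (x : Rn n) (r x), Q k y)
              + ε * volume (⋃ x ∈ T, closedBall (x : Rn n) (r x)) := by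
            rw [Finset.sum_add_distrib, ← Finset.mul_sum,
              lintegral_biUnion_finset hd fun x _ => measurableSet_closedBall,
              measure_biUnion_finset hd fun x _ => measurableSet_closedBall]
          _ ≤ m + ε * volume Ω := by
            gcongr
            exact (lintegral_mono_set hU).trans (hQ k)

end Semicontinuity

/-! ### Semicontinuity on open sets and passage to subsequences. -/

section LowerSemicontinuity

variable {n : ℕ} {Φ : ℝ≥0∞ → ℝ≥0∞}

/-- Bounds on the energy `∫ Φ (P f)` pass to locally uniform limits. -/
theorem lintegral_dilat_le_of_tendsto (hn : 2 ≤ n) (hΦ : IsStrictlyConvex Φ)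
    (hΦT : LeftContAtFiniteSup Φ) {Ω : Set (Rn n)} (hΩ : IsOpen Ω) {f : ℕ → Rn n → Rn n}
    {g : Rn n → Rn n} (hf : ∀ k, SobolevOn Ω (f k)) (hinj : ∀ k, InjOn (f k) Ω)
    (hlim : TendstoLocallyUniformlyOn f g atTop Ω)
    (hdiff : ∀ᵐ x, x ∈ Ω → DifferentiableAt ℝ g x) {m : ℝ≥0}
    (hm : ∀ k, ∫⁻ x in Ω, Φ (dilat (formalDeriv (f k) x)) ≤ m) :
    ∫⁻ x in Ω, Φ (dilat (formalDeriv g x)) ≤ m := by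
  obtain ⟨hg, hconv⟩ := sobolev_limit hn hΦ hΩ hf hinj hlim hm
  have hconv1 : ∀ i C, IsCompact C → C ⊆ Ω →
      Tendsto (fun k => ∫ x in C, lineDeriv ℝ (f k) x (stdVec i)) atTop
        (𝓝 (∫ x in C, lineDeriv ℝ g x (stdVec i))) := fun i C hC hCΩ => by
    simpa using hconv i C hC hCΩ (fun _ => 1) measurable_const ⟨1, by simp⟩
  have hfin : ∀ k, ∀ᵐ x ∂(volume.restrict Ω), dilat (formalDeriv (f k) x) ≠ ⊤ := fun k =>
    (hf k).ae_dilat_ne_top hn hΦ ((hm k).trans_lt ENNReal.coe_lt_top).ne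
  set H : Rn n → ℝ≥0∞ := fun x => Φ (dilat (formalDeriv g x)) with hH
  have hHm : AEMeasurable H (volume.restrict Ω) :=
    (hΦ.measurable_comp_dilat hn).comp_aemeasurable hg.aestronglyMeasurable.aemeasurable
  have hGloc : LocallyIntegrableOn (formalDeriv g) Ω :=
    (locallyIntegrableOn_iff hΩ.isLocallyClosed).mpr fun C hCΩ hC => hg.integrableOn hC hCΩ
  have hGm : ∀ N : ℕ, AEMeasurable (fun x => min (N : ℝ≥0∞) (H x)) (volume.restrict Ω) :=
    fun N => aemeasurable_const.min hHm
  -- Truncating at height N makes the integrand locally integrable, so that Lebesgue points are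
  -- available before the limit energy is known to be finite; intersecting with a ball makes the
  -- error ε times the volume harmless.
  have key : ∀ N : ℕ, ∫⁻ x in Ω ∩ ball 0 N, min (N : ℝ≥0∞) (H x) ≤ m := fun N => by
    set F : Rn n → ℝ := fun x => (min (N : ℝ≥0∞) (H x)).toReal with hFdef
    have hF : ∀ x, ENNReal.ofReal (F x) = min (N : ℝ≥0∞) (H x) := fun x =>
      ENNReal.ofReal_toReal (ne_top_of_le_ne_top (ENNReal.natCast_ne_top N) (min_le_left _ _))
    have hFloc : LocallyIntegrableOn F Ω := by
      refine (locallyIntegrableOn_iff hΩ.isLocallyClosed).mpr fun C hCΩ hC => ?_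
      have : IsFiniteMeasure (volume.restrict C) :=
        isFiniteMeasure_restrict.mpr hC.measure_lt_top.ne
      refine Integrable.of_bound (C := N)
        (((hGm N).mono_set hCΩ).ennreal_toReal.aestronglyMeasurable) (Eventually.of_forall fun x => ?_)
      rw [Real.norm_eq_abs, abs_of_nonneg ENNReal.toReal_nonneg]
      simpa using ENNReal.toReal_mono (ENNReal.natCast_ne_top N) (min_le_left (N : ℝ≥0∞) (H x))
    have hUo : IsOpen (Ω ∩ ball (0 : Rn n) N) := hΩ.inter isOpen_ball
    have hUt : volume (Ω ∩ ball (0 : Rn n) N) ≠ ⊤ :=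
      measure_ne_top_of_subset inter_subset_right measure_ball_lt_top.ne
    refine ENNReal.le_of_forall_pos_le_add fun ε hε _ => ?_
    set V : ℝ≥0 := (volume (Ω ∩ ball (0 : Rn n) N)).toNNReal with hV
    have hδ : (0 : ℝ) < ε / (V + 1) := by positivity
    have h1 := lintegral_le_of_eventually_closedBall hUo (F := fun x => ENNReal.ofReal (F x))
      (Q := fun k x => Φ (dilat (formalDeriv (f k) x))) (m := m)
      (ε := ENNReal.ofReal (ε / (V + 1)))
      (fun k => (lintegral_mono_set inter_subset_left).trans (hm k)) (by
        filter_upwards [ae_tendsto_average_closedBall hΩ hGloc,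
          ae_tendsto_average_closedBall hΩ hFloc, hdiff] with x h1 h2 h3 hx
        exact eventually_lintegral_closedBall_le hn hΦ hΦT hΩ hf hg hinj hlim hconv1 hfin hFloc
          (fun _ => ENNReal.toReal_nonneg) hx.1 (h3 hx.1) ((hF x).trans_le (min_le_right _ _))
          (h1 hx.1) (h2 hx.1) hδ)
    simp only [hF] at h1
    refine h1.trans ?_
    gcongr
    rw [← ENNReal.coe_toNNReal hUt, ← ENNReal.ofReal_coe_nnreal, ← ENNReal.ofReal_mul hδ.le,
      ← ENNReal.ofReal_coe_nnreal (p := ε)]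
    refine ENNReal.ofReal_le_ofReal ?_
    rw [div_mul_eq_mul_div, div_le_iff₀ (by positivity)]
    exact mul_le_mul_of_nonneg_left (by simp [hV]) ε.2
  have hsup : ∀ x, H x = ⨆ N : ℕ, (ball (0 : Rn n) N).indicator (fun x => min (N : ℝ≥0∞) (H x)) x := by
    intro x
    refine le_antisymm (le_of_forall_lt fun y hy => ?_) (iSup_le fun N => ?_)
    · obtain ⟨N₁, hN₁⟩ := ENNReal.exists_nat_gt hy.ne_top
      obtain ⟨N₂, hN₂⟩ := exists_nat_gt ‖x‖
      refine lt_of_lt_of_le ?_ (le_iSup _ (max N₁ N₂))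
      rw [indicator_of_mem (mem_ball_zero_iff.mpr (hN₂.trans_le (by simp)))]
      exact lt_min (hN₁.trans_le (by exact_mod_cast le_max_left _ _)) hy
    · exact indicator_le (fun x _ => min_le_right _ _) x
  calc ∫⁻ x in Ω, H x
      = ∫⁻ x in Ω, ⨆ N : ℕ, (ball (0 : Rn n) N).indicator (fun x => min (N : ℝ≥0∞) (H x)) x :=
        lintegral_congr hsup
    _ = ⨆ N : ℕ, ∫⁻ x in Ω, (ball (0 : Rn n) N).indicator (fun x => min (N : ℝ≥0∞) (H x)) x := by
        refine lintegral_iSup' (fun N => (hGm N).indicator measurableSet_ball)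
          (Eventually.of_forall fun x N N' hN => ?_)
        have hN' : (N : ℝ≥0∞) ≤ N' := by exact_mod_cast hN
        simp only
        refine (indicator_le_indicator_of_subset (ball_subset_ball (by exact_mod_cast hN))
          (fun _ => zero_le) x).trans (indicator_le_indicator ?_)
        exact min_le_min_right _ hN'
    _ ≤ m := by
        refine iSup_le fun N => ?_
        rw [lintegral_indicator measurableSet_ball, Measure.restrict_restrict measurableSet_ball,
          inter_comm]
        exact key N

lemma IsHomeoInto.continuousOn {D : Set (Rn n)} {f : Rn n → Rn n} (h : IsHomeoInto D f) :
    ContinuousOn f D :=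
  continuousOn_iff_continuous_domRestrict.mpr h.continuous

lemma IsHomeoInto.injOn {D : Set (Rn n)} {f : Rn n → Rn n} (h : IsHomeoInto D f) : InjOn f D :=
  injOn_iff_injective.mpr h.injective

lemma tendstoLocallyUniformlyOn_comp {Ω : Set (Rn n)} {f : ℕ → Rn n → Rn n} {g : Rn n → Rn n}
    (h : TendstoLocallyUniformlyOn f g atTop Ω) {s : ℕ → ℕ} (hs : Tendsto s atTop atTop) :
    TendstoLocallyUniformlyOn (fun k => f (s k)) g atTop Ω := by
  intro u hu x hx
  obtain ⟨t, ht, h1⟩ := h u hu x hx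
  exact ⟨t, ht, hs.eventually h1⟩

lemma exists_subseq_le_of_liminf_lt {E : ℕ → ℝ≥0∞} {m : ℝ≥0∞} (h : liminf E atTop < m) :
    ∃ s : ℕ → ℕ, StrictMono s ∧ ∀ k, E (s k) ≤ m := by
  obtain ⟨s, hs, h1⟩ := extraction_of_frequently_atTop (frequently_lt_of_liminf_lt (by isBoundedDefault) h)
  exact ⟨s, hs, fun k => (h1 k).le⟩

/-- Any finite b above the lower limit bounds the energies along a subsequence, which still
converges to g. -/
theorem lintegral_dilat_le_liminf (hn : 2 ≤ n) (hΦ : IsStrictlyConvex Φ)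
    (hΦT : LeftContAtFiniteSup Φ) {Ω : Set (Rn n)} (hΩ : IsOpen Ω) {f : ℕ → Rn n → Rn n}
    {g : Rn n → Rn n} (hf : ∀ k, SobolevOn Ω (f k)) (hinj : ∀ k, InjOn (f k) Ω)
    (hlim : TendstoLocallyUniformlyOn f g atTop Ω)
    (hdiff : ∀ᵐ x, x ∈ Ω → DifferentiableAt ℝ g x) :
    ∫⁻ x in Ω, Φ (dilat (formalDeriv g x))
      ≤ liminf (fun k => ∫⁻ x in Ω, Φ (dilat (formalDeriv (f k) x))) atTop := by
  refine le_of_forall_gt_imp_ge_of_dense fun b hb => ?_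
  rcases eq_or_ne b ⊤ with rfl | hbt
  · exact le_top
  lift b to ℝ≥0 using hbt
  obtain ⟨s, hs, h1⟩ := exists_subseq_le_of_liminf_lt hb
  exact lintegral_dilat_le_of_tendsto hn hΦ hΦT hΩ (fun k => hf (s k)) (fun k => hinj (s k))
    (tendstoLocallyUniformlyOn_comp hlim hs.tendsto_atTop) hdiff h1

lemma sobolevOn_of_liminf_lt_top (hn : 2 ≤ n) (hΦ : IsStrictlyConvex Φ)
    {Ω : Set (Rn n)} (hΩ : IsOpen Ω) {f : ℕ → Rn n → Rn n}
    {g : Rn n → Rn n} (hf : ∀ k, SobolevOn Ω (f k)) (hinj : ∀ k, InjOn (f k) Ω)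
    (hlim : TendstoLocallyUniformlyOn f g atTop Ω)
    (hfin : liminf (fun k => ∫⁻ x in Ω, Φ (dilat (formalDeriv (f k) x))) atTop < ⊤) :
    SobolevOn Ω g := by
  obtain ⟨m, hm, -⟩ := ENNReal.lt_iff_exists_nnreal_btwn.mp hfin
  obtain ⟨s, hs, h1⟩ := exists_subseq_le_of_liminf_lt hm
  exact (sobolev_limit hn hΦ hΩ (fun k => hf (s k)) (fun k => hinj (s k))
    (tendstoLocallyUniformlyOn_comp hlim hs.tendsto_atTop) h1).1

lemma SobolevOn.memW11loc {Ω : Set (Rn n)} (hΩ : IsOpen Ω) {g : Rn n → Rn n} (h : SobolevOn Ω g) :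
    MemW11loc Ω g :=
  ⟨h.cont.locallyIntegrableOn hΩ.measurableSet, fun i => ⟨_, h.weak i⟩⟩

/-- A finite upper limit bounds the energies of a whole tail, so no subsequence is needed. Arbitrary
weak derivatives u and v are compared with the classical ones, which they equal almost everywhere.
-/
theorem tendstoWeaklyL1loc_of_limsup_lt_top (hn : 2 ≤ n) (hΦ : IsStrictlyConvex Φ)
    {Ω : Set (Rn n)} (hΩ : IsOpen Ω) {f : ℕ → Rn n → Rn n}
    {g : Rn n → Rn n} (hf : ∀ k, SobolevOn Ω (f k)) (hinj : ∀ k, InjOn (f k) Ω)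
    (hlim : TendstoLocallyUniformlyOn f g atTop Ω)
    (hfin : limsup (fun k => ∫⁻ x in Ω, Φ (dilat (formalDeriv (f k) x))) atTop < ⊤)
    {i : Fin n} {u : ℕ → Rn n → Rn n} {v : Rn n → Rn n}
    (hu : ∀ k, IsWeakPartial Ω i (f k) (u k)) (hv : IsWeakPartial Ω i g v) :
    TendstoWeaklyL1loc Ω u v := by
  obtain ⟨m, hm, -⟩ := ENNReal.lt_iff_exists_nnreal_btwn.mp hfin
  obtain ⟨N, hN⟩ := eventually_atTop.mp (eventually_lt_of_limsup_lt hm)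
  have hlimN := tendstoLocallyUniformlyOn_comp hlim (tendsto_add_atTop_nat N)
  obtain ⟨hg, hconv⟩ := sobolev_limit hn hΦ hΩ (fun k => hf (k + N)) (fun k => hinj (k + N)) hlimN
    (fun k => (hN (k + N) (Nat.le_add_left _ _)).le)
  have hae : ∀ {C : Set (Rn n)} {F w : Rn n → Rn n}, IsCompact C → C ⊆ Ω → ContinuousOn F Ω →
      IsWeakPartial Ω i F w → ∀ φ : Rn n → ℝ,
      ∫ x in C, φ x • lineDeriv ℝ F x (stdVec i) = ∫ x in C, φ x • w x := by
    intro C F w hC hCΩ hF hw φ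
    refine integral_congr_ae ((ae_restrict_iff' hC.measurableSet).mpr ?_)
    filter_upwards [hw.ae_hasLineDerivAt hΩ hF] with x hx hxC
    rw [(hx (hCΩ hxC)).lineDeriv]
  refine fun C hC hCΩ => ⟨fun k => (hu k).locInt_deriv.integrableOn_compact_subset hCΩ hC,
    hv.locInt_deriv.integrableOn_compact_subset hCΩ hC, fun φ hφ hφb => ?_⟩
  rw [← tendsto_add_atTop_iff_nat N, ← hae hC hCΩ hg.cont hv φ]
  refine (hconv i C hC hCΩ φ hφ hφb).congr fun k => ?_
  exact hae hC hCΩ (hf (k + N)).cont (hu (k + N)) φ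

end LowerSemicontinuity

end OuterDilatation

/-! ### The main theorem. -/

theorem mainTheorem2 (n : ℕ) (hn : 2 ≤ n) (D : Set (OuterDilatation.Rn n))
    (hDo : IsOpen D) (hDc : IsConnected D)
    (f : ℕ → OuterDilatation.Rn n → OuterDilatation.Rn n)
    (g : OuterDilatation.Rn n → OuterDilatation.Rn n)
    (hf : ∀ j, OuterDilatation.IsHomeoInto D (f j))
    (hW : ∀ j, OuterDilatation.MemW11loc D (f j))
    (hlim : TendstoLocallyUniformlyOn f g atTop D)
    (hdiff : ∀ᵐ x ∂(volume.restrict D), DifferentiableAt ℝ g x)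
    (Ω : Set (OuterDilatation.Rn n)) (hΩo : IsOpen Ω) (hΩ : Ω ⊆ D)
    (Φ : ℝ≥0∞ → ℝ≥0∞) (hΦ : OuterDilatation.IsStrictlyConvex Φ)
    (hΦT : OuterDilatation.LeftContAtFiniteSup Φ) :
    (∫⁻ x in Ω, Φ (OuterDilatation.P g x) ≤
      liminf (fun j => ∫⁻ x in Ω, Φ (OuterDilatation.P (f j) x)) atTop) ∧
    (OuterDilatation.IsHomeoInto D g →
      liminf (fun j => ∫⁻ x in Ω, Φ (OuterDilatation.P (f j) x)) atTop < ⊤ →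
      OuterDilatation.MemW11loc Ω g ∧
      (limsup (fun j => ∫⁻ x in Ω, Φ (OuterDilatation.P (f j) x)) atTop < ⊤ →
        ∀ (i : Fin n) (u : ℕ → OuterDilatation.Rn n → OuterDilatation.Rn n)
          (v : OuterDilatation.Rn n → OuterDilatation.Rn n),
          (∀ j, OuterDilatation.IsWeakPartial Ω i (f j) (u j)) →
          OuterDilatation.IsWeakPartial Ω i g v →
          OuterDilatation.TendstoWeaklyL1loc Ω u v)) := by
  have hfD : ∀ k, OuterDilatation.SobolevOn D (f k) := fun k =>
    .of_memW11loc hDo (hf k).continuousOn (hW k)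
  have hfΩ : ∀ k, OuterDilatation.SobolevOn Ω (f k) := fun k => (hfD k).mono hΩ
  have hinj : ∀ k, InjOn (f k) Ω := fun k => (hf k).injOn.mono hΩ
  have hlimΩ : TendstoLocallyUniformlyOn f g atTop Ω := hlim.mono hΩ
  have hd : ∀ᵐ x, x ∈ Ω → DifferentiableAt ℝ g x :=
    ((ae_restrict_iff' hDo.measurableSet).mp hdiff).mono fun x hx hxΩ => hx (hΩ hxΩ)
  simp only [fun k => (hfΩ k).lintegral_P_eq (Φ := Φ) hn hΩo]
  refine ⟨?_, fun _ hfin => ⟨?_, fun hfin' i u v hu hv => ?_⟩⟩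
  -- Before the limit is known to be Sobolev, its partial derivatives exist almost everywhere by the
  -- assumed differentiability, so P and `dilat` agree for it too.
  · refine le_of_eq_of_le (lintegral_congr_ae ?_)
      (OuterDilatation.lintegral_dilat_le_liminf hn hΦ hΦT hΩo hfΩ hinj hlimΩ hd)
    filter_upwards [(ae_restrict_iff' hΩo.measurableSet).mpr hd] with x hx
    rw [OuterDilatation.P_eq_dilat hn fun i => (hx.hasFDerivAt.hasLineDerivAt _).lineDifferentiableAt]
  · exact (OuterDilatation.sobolevOn_of_liminf_lt_top hn hΦ hΩo hfΩ hinj hlimΩ hfin).memW11loc hΩo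
  · exact OuterDilatation.tendstoWeaklyL1loc_of_limsup_lt_top hn hΦ hΩo hfΩ hinj hlimΩ hfin' hu hv
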